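/- Let $n\ge 1$. For $f\in L^1_{loc}(\mathbb{R}^n)$ let $$Mf(x)=\sup_{B\ni x}\frac{1}{|B|}\int_B|f(y)|\,dy\in[0,\infty]\qquad(x\in\mathbb{R}^n)$$ be the non-centered Hardy–Littlewood maximal function, the supremum being over all open balls $B\subset\mathbb{R}^n$ that contain $x$. There is a constant $C_n$, depending only on $n$, such that the following holds for every radial real-valued $f\in W^{1,1}(\mathbb{R}^n)$ (radial: $f(x)=g(|x|)$ for a.e. $x$, for some function $g:[0,\infty)\to\mathbb{R}$). The maximal function $Mf$ is finite almost everywhere, locally integrable and weakly differentiable on $\mathbb{R}^n$, its weak gradient $DMf$ belongs to $L^1(\mathbb{R}^n)$ (so that $Mf\in W^{1,1}_{loc}(\mathbb{R}^n)$), and $$\|DMf\|_{1}\le C_n\|Df\|_{1}.$$ -/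

import Mathlib

open MeasureTheory Metric
open scoped ENNReal ContDiff

/-- The non-centered Hardy-Littlewood maximal function
`M f (x) = sup { ⨍_B |f| : B an open ball containing x }`, with values in `[0, ∞]`. -/
noncomputable def maximalFunction {n : ℕ} (f : EuclideanSpace ℝ (Fin n) → ℝ)
    (x : EuclideanSpace ℝ (Fin n)) : ℝ≥0∞ :=
  ⨆ (z : EuclideanSpace ℝ (Fin n)) (r : ℝ) (_ : x ∈ ball z r), ⨍⁻ y in ball z r, ‖f y‖ₑ ∂volume

/-- `G` is the weak gradient of `f` on `ℝⁿ`: both are locally integrable, and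
`∫ f ∂ᵢφ = - ∫ Gᵢ φ` for all test functions `φ ∈ C_c^∞(ℝⁿ)` and all `i`. -/
structure HasWeakGradient {n : ℕ} (f : EuclideanSpace ℝ (Fin n) → ℝ)
    (G : EuclideanSpace ℝ (Fin n) → EuclideanSpace ℝ (Fin n)) : Prop where
  locallyIntegrable : LocallyIntegrable f volume
  locallyIntegrable_gradient : LocallyIntegrable G volume
  integral_eq : ∀ φ : EuclideanSpace ℝ (Fin n) → ℝ, ContDiff ℝ ∞ φ → HasCompactSupport φ →
    ∀ i : Fin n, ∫ x, f x * fderiv ℝ φ x (EuclideanSpace.single i 1) = - ∫ x, G x i * φ x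

/-- `f ∈ W^{1,1}(ℝⁿ)`: `f` is integrable and has an integrable weak gradient. -/
def MemW11 {n : ℕ} (f : EuclideanSpace ℝ (Fin n) → ℝ) : Prop :=
  Integrable f volume ∧ ∃ F, HasWeakGradient f F ∧ Integrable F volume

/-- `f` is radial: `f(x) = g(|x|)` for almost every `x`, for some `g : [0, ∞) → ℝ`
(the values of `g` at negative numbers are irrelevant). -/
def IsRadial {n : ℕ} (f : EuclideanSpace ℝ (Fin n) → ℝ) : Prop :=
  ∃ g : ℝ → ℝ, ∀ᵐ x ∂(volume : Measure (EuclideanSpace ℝ (Fin n))), f x = g ‖x‖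

/-!
A radial `f ∈ W^{1,1}(ℝⁿ)` has a continuous profile `g` on `(0, ∞)` with
`|g(t) - g(s)| ≤ ∫ₛᵗ w`, where the weight `w` is the absolute value of the spherical mean of the
radial derivative of `f` (`exists_profile`, by testing the weak gradient with the fields
`ψ(|x|) |x|⁻ⁿ x`). Its maximal function is radial too, with profile `m` (`maxProfile`) above
`p = |g|`, and everything reduces to a weighted estimate on the half-line:
`∫ ρⁿ⁻¹ |m'| dρ ≤ C ∫ ρⁿ⁻¹ w dρ`.

On the contact set `{m = p}` the variation of `m` is controlled by that of `p`. On the open detached set `{m > p}` the following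
facts hold.

* `m` is locally Lipschitz: only balls of radius bounded below matter, and dilating a ball about the
  origin changes the average of a radial function by a controlled amount
  (`abs_ballAvg_smul_sub_le`). Dilations do what translations cannot, because they preserve
  radiality, so that the change involves only a moment of `w`.
* `m` has no strict local maximum (`maxProfile_le_max`): the average over a ball squeezed between
  two radii is at most the maximum of `p` between them.

Hence on a component of the detached set `m` decreases and then increases, and if both endpoints are
contact points its variation is at most that of `p` (`lintegral_Ioo_abs_deriv_le`). On an arbitrary
interval `(a, b)` the at most two components that reach an endpoint cost a multiple of the
oscillation of `m` (`lintegral_detached_abs_deriv_le`).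

In dimension one `0 ≤ m ≤ ∫ w`, and the unweighted estimate on all of `(0, ∞)` follows. In dimension
`n ≥ 2` the weight `ρⁿ⁻¹` is frozen on `(a, 2a)`, where small balls and dilations bound the
oscillation of `m` by a multiple of `∫ w(u) (u / max(a, u))ⁿ du` (`maxProfile_sub_le`); the integral
over all scales `a`, against `aⁿ⁻² da`, is at most `2 ∫ uⁿ⁻¹ w(u) du` by Tonelli, the small scales
being integrable because `n ≥ 2`.

Finally these bounds show that `m` is absolutely continuous on compact subintervals of `(0, ∞)` with
`ρⁿ⁻¹ m'` integrable. Such a profile defines a weakly differentiable function on all of `ℝⁿ`: cutting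
off large values of `m'` gives Lipschitz approximations, and dominated convergence applies
(`hasWeakGradient_radial`). The origin causes no trouble, not even in dimension one.
-/

open Set Filter Topology
open scoped NNReal

/-! ### Majorants without interior local maxima -/

/-- `m` is a continuous majorant of `p` on `(0, ∞)` which, away from the contact set `{m = p}`, is
locally Lipschitz and has no strict interior local maximum. The increments of `p` are controlled by
the integral of the nonnegative weight `w`. -/
structure IsContactMajorant (p w m : ℝ → ℝ) : Prop where
  continuousOn : ContinuousOn m (Ioi 0)
  weight_nonneg : ∀ t, 0 ≤ w t
  weight_integrable : ∀ s t, 0 < s → 0 < t → IntervalIntegrable w volume s t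
  abs_sub_le : ∀ s t, 0 < s → s ≤ t → |p t - p s| ≤ ∫ u in s..t, w u
  le : ∀ t, 0 < t → p t ≤ m t
  lipschitz : ∀ t, 0 < t → p t < m t → ∃ K : ℝ≥0, ∃ S ∈ 𝓝 t, LipschitzOnWith K m S
  quasiconvex : ∀ s t, 0 < s → s ≤ t → (∀ x ∈ Icc s t, p x < m x) →
    ∀ x ∈ Icc s t, m x ≤ max (m s) (m t)

/-- The part of `(0, ∞)` where `m` lies strictly above `p`. -/
def detachedSet (p m : ℝ → ℝ) : Set ℝ := {t | 0 < t ∧ p t < m t}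

theorem continuousOn_of_abs_sub_le {p w : ℝ → ℝ}
    (hw : ∀ s t, 0 < s → 0 < t → IntervalIntegrable w volume s t)
    (h : ∀ s t, 0 < s → s ≤ t → |p t - p s| ≤ ∫ u in s..t, w u) : ContinuousOn p (Ioi 0) := by
  intro x hx
  have hx : 0 < x := hx
  refine ContinuousAt.continuousWithinAt ?_
  have hcont : ContinuousAt (fun y => ∫ u in x..y, w u) x := by
    have h1 := intervalIntegral.continuousOn_primitive_interval' (a := x)
      (hw (x/2) (x+1) (by linarith) (by linarith)) (by rw [uIcc_of_le] <;> grind)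
    exact h1.continuousAt (by rw [uIcc_of_le (by linarith)]; exact Icc_mem_nhds (by linarith) (by linarith))
  have h0 : Tendsto (fun y => |∫ u in x..y, w u|) (𝓝 x) (𝓝 0) := by
    have := hcont.abs.tendsto
    simpa using this
  rw [ContinuousAt, tendsto_iff_dist_tendsto_zero]
  refine squeeze_zero' (Eventually.of_forall fun _ => dist_nonneg) ?_ h0
  filter_upwards [lt_mem_nhds hx] with y hy
  rw [Real.dist_eq]
  rcases le_total x y with hxy | hxy
  · exact (h x y hx hxy).trans (le_abs_self _)
  · rw [intervalIntegral.integral_symm, abs_neg, abs_sub_comm]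
    exact (h y x hy hxy).trans (le_abs_self _)

namespace IsContactMajorant

variable {p w m : ℝ → ℝ}

theorem continuousOn_base (h : IsContactMajorant p w m) : ContinuousOn p (Ioi 0) :=
  continuousOn_of_abs_sub_le h.weight_integrable h.abs_sub_le

theorem isOpen_detachedSet (h : IsContactMajorant p w m) : IsOpen (detachedSet p m) := by
  have h1 : ContinuousOn (fun t => m t - p t) (Ioi 0) := h.continuousOn.sub h.continuousOn_base
  have := h1.isOpen_inter_preimage isOpen_Ioi (isOpen_Ioi (a := (0 : ℝ)))
  convert this using 1
  ext t
  simp [detachedSet]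

theorem absolutelyContinuousOnInterval (h : IsContactMajorant p w m) {s t : ℝ} (hst : s ≤ t)
    (hU : Icc s t ⊆ detachedSet p m) : AbsolutelyContinuousOnInterval m s t := by
  have h1 : LocallyLipschitzOn (Icc s t) m := by
    intro x hx
    obtain ⟨K, S, hS, hl⟩ := h.lipschitz x (hU hx).1 (hU hx).2
    exact ⟨K, S, mem_nhdsWithin_of_mem_nhds hS, hl⟩
  obtain ⟨K, hK⟩ := h1.exists_lipschitzOnWith_of_compact isCompact_Icc
  refine LipschitzOnWith.absolutelyContinuousOnInterval (K := K) ?_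
  rwa [uIcc_of_le hst]

/-- On an interval inside the detached set, `m` decreases to its minimum and increases afterwards,
which determines its total variation. -/
theorem exists_integral_abs_deriv_le (h : IsContactMajorant p w m) {s t : ℝ} (hst : s ≤ t)
    (hU : Icc s t ⊆ detachedSet p m) :
    ∃ c ∈ Icc s t, ∫ x in s..t, |deriv m x| ≤ m s + m t - 2 * m c := by
  have hs0 : 0 < s := (hU (left_mem_Icc.2 hst)).1
  have hcont : ContinuousOn m (Icc s t) :=
    h.continuousOn.mono fun x hx => lt_of_lt_of_le hs0 hx.1
  obtain ⟨c, hc, hmin⟩ := isCompact_Icc.exists_isMinOn (nonempty_Icc.2 hst) hcont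
  have hmin' : ∀ x ∈ Icc s t, m c ≤ m x := fun x hx => hmin hx
  have hanti : AntitoneOn m (Icc s c) := by
    intro x hx y hy hxy
    have hxc : Icc x c ⊆ Icc s t := Icc_subset_Icc hx.1 hc.2
    have := h.quasiconvex x c (by linarith [hx.1]) hx.2 (fun z hz => (hU (hxc hz)).2) y ⟨hxy, hy.2⟩
    rwa [max_eq_left (hmin' x ⟨hx.1, hx.2.trans hc.2⟩)] at this
  have hmono : MonotoneOn m (Icc c t) := by
    intro x hx y hy hxy
    have hxc : Icc c y ⊆ Icc s t := Icc_subset_Icc hc.1 hy.2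
    have := h.quasiconvex c y (by linarith [hc.1]) hy.1 (fun z hz => (hU (hxc hz)).2) x ⟨hx.1, hxy⟩
    rwa [max_eq_right (hmin' y ⟨hc.1.trans hy.1, hy.2⟩)] at this
  have hac1 := h.absolutelyContinuousOnInterval hc.1 ((Icc_subset_Icc le_rfl hc.2).trans hU)
  have hac2 := h.absolutelyContinuousOnInterval hc.2 ((Icc_subset_Icc hc.1 le_rfl).trans hU)
  have e1 : ∫ x in s..c, |deriv m x| = m s - m c := by
    have : ∫ x in s..c, |deriv m x| = ∫ x in s..c, - deriv m x := by
      rw [intervalIntegral.integral_of_le hc.1, intervalIntegral.integral_of_le hc.1,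
        integral_Ioc_eq_integral_Ioo, integral_Ioc_eq_integral_Ioo]
      refine setIntegral_congr_fun measurableSet_Ioo fun x hx => abs_of_nonpos ?_
      rw [← derivWithin_of_mem_nhds (Icc_mem_nhds hx.1 hx.2)]
      exact hanti.derivWithin_nonpos
    rw [this, intervalIntegral.integral_neg, hac1.integral_deriv_eq_sub]
    ring
  have e2 : ∫ x in c..t, |deriv m x| = m t - m c := by
    have : ∫ x in c..t, |deriv m x| = ∫ x in c..t, deriv m x := by
      rw [intervalIntegral.integral_of_le hc.2, intervalIntegral.integral_of_le hc.2,
        integral_Ioc_eq_integral_Ioo, integral_Ioc_eq_integral_Ioo]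
      refine setIntegral_congr_fun measurableSet_Ioo fun x hx => abs_of_nonneg ?_
      rw [← derivWithin_of_mem_nhds (Icc_mem_nhds hx.1 hx.2)]
      exact hmono.derivWithin_nonneg
    rw [this, hac2.integral_deriv_eq_sub]
  refine ⟨c, hc, ?_⟩
  rw [← intervalIntegral.integral_add_adjacent_intervals hac1.intervalIntegrable_deriv.abs
    hac2.intervalIntegrable_deriv.abs, e1, e2]
  linarith

theorem lintegral_abs_deriv_eq (h : IsContactMajorant p w m) {s t : ℝ} (hst : s ≤ t)
    (hU : Icc s t ⊆ detachedSet p m) :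
    ∫⁻ x in Ioc s t, ENNReal.ofReal |deriv m x| = ENNReal.ofReal (∫ x in s..t, |deriv m x|) := by
  have hac := h.absolutelyContinuousOnInterval hst hU
  have hi := hac.intervalIntegrable_deriv.abs
  rw [intervalIntegral.integral_of_le hst, ofReal_integral_eq_lintegral_ofReal
    ((intervalIntegrable_iff_integrableOn_Ioc_of_le hst).1 hi)]
  exact Eventually.of_forall fun x => abs_nonneg _

end IsContactMajorant

/-- A lower integral over an open interval is the limit of those over compactly contained ones. -/
theorem exists_seq_tendsto_lintegral_Ioo {α β : ℝ} (hαβ : α < β) (F : ℝ → ℝ≥0∞) :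
    ∃ s t : ℕ → ℝ, (∀ k, α < s k ∧ s k ≤ t k ∧ t k < β) ∧ Tendsto s atTop (𝓝 α) ∧
      Tendsto t atTop (𝓝 β) ∧
      Tendsto (fun k => ∫⁻ x in Ioc (s k) (t k), F x) atTop (𝓝 (∫⁻ x in Ioo α β, F x)) := by
  obtain ⟨s, hs_anti, hs, hs_lim⟩ := exists_seq_strictAnti_tendsto' (show α < (α + β) / 2 by linarith)
  obtain ⟨t, ht_mono, ht, ht_lim⟩ := exists_seq_strictMono_tendsto' (show (α + β) / 2 < β by linarith)
  refine ⟨s, t, fun k => ⟨(hs k).1, ((hs k).2.trans (ht k).1).le, (ht k).2⟩, hs_lim, ht_lim, ?_⟩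
  have hmono : Monotone fun k => Ioc (s k) (t k) := fun i j hij =>
    Ioc_subset_Ioc (hs_anti.antitone hij) (ht_mono.monotone hij)
  have hU : (⋃ k, Ioc (s k) (t k)) = Ioo α β := by
    ext x
    simp only [mem_iUnion, mem_Ioc, mem_Ioo]
    constructor
    · rintro ⟨k, h1, h2⟩
      exact ⟨(hs k).1.trans h1, h2.trans_lt (ht k).2⟩
    · rintro ⟨h1, h2⟩
      obtain ⟨k, hk⟩ := ((hs_lim.eventually_lt_const h1).and
        (ht_lim.eventually_const_lt h2)).exists
      exact ⟨k, hk.1, hk.2.le⟩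
  rw [← hU, setLIntegral_iUnion_of_directed _ hmono.directed_le]
  exact tendsto_atTop_iSup fun i j hij => lintegral_mono_set (hmono hij)

namespace IsContactMajorant

variable {p w m : ℝ → ℝ}

/-- The variation of `m` on an interval inside the detached set is at most twice its oscillation. -/
theorem lintegral_Ioo_abs_deriv_le_of_osc (h : IsContactMajorant p w m) {α β K : ℝ} (hαβ : α < β)
    (hU : Ioo α β ⊆ detachedSet p m) (hK : ∀ x ∈ Ioo α β, ∀ y ∈ Ioo α β, m x - m y ≤ K) :
    ∫⁻ x in Ioo α β, ENNReal.ofReal |deriv m x| ≤ ENNReal.ofReal (2 * K) := by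
  obtain ⟨s, t, hst, -, -, hlim⟩ := exists_seq_tendsto_lintegral_Ioo hαβ
    fun x => ENNReal.ofReal |deriv m x|
  refine le_of_tendsto' hlim fun k => ?_
  obtain ⟨h1, h2, h3⟩ := hst k
  have hsub : Icc (s k) (t k) ⊆ Ioo α β := fun x hx => ⟨h1.trans_le hx.1, hx.2.trans_lt h3⟩
  rw [h.lintegral_abs_deriv_eq h2 (hsub.trans hU)]
  obtain ⟨c, hc, hle⟩ := h.exists_integral_abs_deriv_le h2 (hsub.trans hU)
  refine ENNReal.ofReal_le_ofReal (hle.trans ?_)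
  linarith [hK _ (hsub (left_mem_Icc.2 h2)) _ (hsub hc), hK _ (hsub (right_mem_Icc.2 h2)) _ (hsub hc)]

/-- Over a component of the detached set whose endpoints are contact points, the variation of `m` is
at most that of `p`. -/
theorem lintegral_Ioo_abs_deriv_le (h : IsContactMajorant p w m) {α β : ℝ} (hα : 0 < α)
    (hαβ : α < β) (hU : Ioo α β ⊆ detachedSet p m) (hpα : p α = m α) (hpβ : p β = m β) :
    ∫⁻ x in Ioo α β, ENNReal.ofReal |deriv m x| ≤ ∫⁻ x in Ioo α β, ENNReal.ofReal (w x) := by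
  obtain ⟨s, t, hst, hs_lim, ht_lim, hlim⟩ := exists_seq_tendsto_lintegral_Ioo hαβ
    fun x => ENNReal.ofReal |deriv m x|
  have hβ : 0 < β := hα.trans hαβ
  have hwi := h.weight_integrable α β hα hβ
  have hw : ∫⁻ x in Ioo α β, ENNReal.ofReal (w x) = ENNReal.ofReal (∫ x in α..β, w x) := by
    rw [intervalIntegral.integral_of_le hαβ.le, integral_Ioc_eq_integral_Ioo,
      ofReal_integral_eq_lintegral_ofReal]
    · exact ((intervalIntegrable_iff_integrableOn_Ioo_of_le hαβ.le).1 hwi)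
    · exact Eventually.of_forall h.weight_nonneg
  have hmα : ContinuousAt m α := h.continuousOn.continuousAt (Ioi_mem_nhds hα)
  have hmβ : ContinuousAt m β := h.continuousOn.continuousAt (Ioi_mem_nhds hβ)
  have hlim2 : Tendsto (fun k => ENNReal.ofReal ((m (s k) - m α) + (m (t k) - m β) +
      ∫ x in α..β, w x)) atTop (𝓝 (ENNReal.ofReal (∫ x in α..β, w x))) := by
    have := (((hmα.tendsto.comp hs_lim).sub_const (m α)).add
      ((hmβ.tendsto.comp ht_lim).sub_const (m β))).add_const (∫ x in α..β, w x)
    have := ENNReal.tendsto_ofReal this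
    simpa using this
  rw [hw]
  refine le_of_tendsto_of_tendsto' hlim hlim2 fun k => ?_
  obtain ⟨h1, h2, h3⟩ := hst k
  have hsub : Icc (s k) (t k) ⊆ Ioo α β := fun x hx => ⟨h1.trans_le hx.1, hx.2.trans_lt h3⟩
  rw [h.lintegral_abs_deriv_eq h2 (hsub.trans hU)]
  obtain ⟨c, hc, hle⟩ := h.exists_integral_abs_deriv_le h2 (hsub.trans hU)
  refine ENNReal.ofReal_le_ofReal (hle.trans ?_)
  have hcαβ := hsub hc
  have hc0 : 0 < c := hα.trans hcαβ.1
  -- `m α + m β - 2 * m c ≤ (p α - p c) + (p β - p c)`, as `m ≥ p` at the minimum point `c`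
  have e1 := (abs_le.1 (h.abs_sub_le α c hα hcαβ.1.le)).1
  have e2 := (abs_le.1 (h.abs_sub_le c β hc0 hcαβ.2.le)).2
  have e3 := intervalIntegral.integral_add_adjacent_intervals (h.weight_integrable α c hα hc0)
    (h.weight_integrable c β hc0 hβ)
  linarith [h.le c hc0]

/-- Between two contact points, the variation of `m` on the detached set is at most that of `p`:
sum over the components. -/
theorem lintegral_inter_Ioo_abs_deriv_le (h : IsContactMajorant p w m) {a b : ℝ} (ha : 0 < a)
    (hpa : p a = m a) (hpb : p b = m b) :
    ∫⁻ x in detachedSet p m ∩ Ioo a b, ENNReal.ofReal |deriv m x| ≤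
      ∫⁻ x in Ioo a b, ENNReal.ofReal (w x) := by
  set V : Set ℝ := detachedSet p m ∩ Ioo a b with hV
  have hVo : IsOpen V := h.isOpen_detachedSet.inter isOpen_Ioo
  have hVab : V ⊆ Icc a b := inter_subset_right.trans Ioo_subset_Icc_self
  set 𝒞 : Set (Set ℝ) := (fun x => connectedComponentIn V x) '' V with h𝒞
  have hdisj : 𝒞.PairwiseDisjoint id := by
    rintro _ ⟨x, hx, rfl⟩ _ ⟨y, hy, rfl⟩ hne
    refine Set.disjoint_left.2 fun z hz1 hz2 => hne ?_
    exact (connectedComponentIn_eq hz1).trans (connectedComponentIn_eq hz2).symm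
  have hopen : ∀ C ∈ 𝒞, IsOpen C := by
    rintro _ ⟨x, hx, rfl⟩
    exact hVo.connectedComponentIn
  have hne : ∀ C ∈ 𝒞, C.Nonempty := by
    rintro _ ⟨x, hx, rfl⟩
    exact ⟨x, mem_connectedComponentIn hx⟩
  have hcount : 𝒞.Countable := hdisj.countable_of_isOpen hopen hne
  have hUn : V = ⋃ C ∈ 𝒞, id C := by
    ext x
    simp only [mem_iUnion, id, exists_prop]
    constructor
    · exact fun hx => ⟨_, ⟨x, hx, rfl⟩, mem_connectedComponentIn hx⟩
    · rintro ⟨_, ⟨y, hy, rfl⟩, hx⟩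
      exact connectedComponentIn_subset _ _ hx
  have key : ∀ C ∈ 𝒞, ∫⁻ x in C, ENNReal.ofReal |deriv m x| ≤ ∫⁻ x in C, ENNReal.ofReal (w x) := by
    rintro C hC
    have hCo := hopen C hC
    have hCne := hne C hC
    obtain ⟨x, hx, rfl⟩ := hC
    set C := connectedComponentIn V x with hCdef
    have hCV : C ⊆ V := connectedComponentIn_subset _ _
    have hconn : IsPreconnected C := isPreconnected_connectedComponentIn
    have hbb : BddBelow C := ⟨a, fun y hy => (hVab (hCV hy)).1⟩
    have hba : BddAbove C := ⟨b, fun y hy => (hVab (hCV hy)).2⟩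
    have hinf : sInf C ∉ C := fun hmem => by
      obtain ⟨ε, hε, hball⟩ := Metric.isOpen_iff.1 hCo _ hmem
      have : sInf C - ε / 2 ∈ C := hball (by rw [mem_ball, Real.dist_eq, abs_lt]; constructor <;> linarith)
      linarith [csInf_le hbb this]
    have hsup : sSup C ∉ C := fun hmem => by
      obtain ⟨ε, hε, hball⟩ := Metric.isOpen_iff.1 hCo _ hmem
      have : sSup C + ε / 2 ∈ C := hball (by rw [mem_ball, Real.dist_eq, abs_lt]; constructor <;> linarith)
      linarith [le_csSup hba this]
    have hIoo : C = Ioo (sInf C) (sSup C) := by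
      refine Subset.antisymm (fun y hy => ⟨?_, ?_⟩) (IsConnected.Ioo_csInf_csSup_subset ⟨hCne, hconn⟩ hbb hba)
      · exact lt_of_le_of_ne (csInf_le hbb hy) fun e => hinf (e ▸ hy)
      · exact lt_of_le_of_ne (le_csSup hba hy) fun e => hsup (e ▸ hy)
    have hαa : a ≤ sInf C := le_csInf hCne fun y hy => (hVab (hCV hy)).1
    have hβb : sSup C ≤ b := csSup_le hCne fun y hy => (hVab (hCV hy)).2
    have hxC : x ∈ Ioo (sInf C) (sSup C) := hIoo ▸ mem_connectedComponentIn hx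
    have hlt : sInf C < sSup C := hxC.1.trans hxC.2
    -- an endpoint inside `V` could be added to the component
    have hαV : sInf C ∉ V := fun hmem => by
      have h1 : IsPreconnected (insert (sInf C) C) := by
        rw [hIoo, csInf_Ioo hlt, Ioo_insert_left hlt]
        exact isPreconnected_Ico
      exact hinf (h1.subset_connectedComponentIn (mem_insert_of_mem _ (mem_connectedComponentIn hx))
        (insert_subset hmem hCV) (mem_insert _ _))
    have hβV : sSup C ∉ V := fun hmem => by
      have h1 : IsPreconnected (insert (sSup C) C) := by
        rw [hIoo, csSup_Ioo hlt, Ioo_insert_right hlt]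
        exact isPreconnected_Ioc
      exact hsup (h1.subset_connectedComponentIn (mem_insert_of_mem _ (mem_connectedComponentIn hx))
        (insert_subset hmem hCV) (mem_insert _ _))
    have hα0 : 0 < sInf C := ha.trans_le hαa
    have hcontact : ∀ y, a ≤ y → y ≤ b → y ∉ V → p y = m y := by
      intro y h1 h2 h3
      rcases h1.eq_or_lt with rfl | h1
      · exact hpa
      rcases h2.eq_or_lt with rfl | h2
      · exact hpb
      by_contra hcon
      exact h3 ⟨⟨ha.trans h1, lt_of_le_of_ne (h.le y (ha.trans h1)) hcon⟩, h1, h2⟩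
    have := h.lintegral_Ioo_abs_deriv_le hα0 hlt (hIoo ▸ hCV.trans inter_subset_left)
      (hcontact _ hαa (hlt.le.trans hβb) hαV) (hcontact _ (hαa.trans hlt.le) hβb hβV)
    rwa [← hIoo] at this
  have hm : ∀ C ∈ 𝒞, MeasurableSet (id C) := fun C hC => (hopen C hC).measurableSet
  calc ∫⁻ x in V, ENNReal.ofReal |deriv m x|
      = ∑' C : 𝒞, ∫⁻ x in id (C : Set ℝ), ENNReal.ofReal |deriv m x| := by
        conv_lhs => rw [hUn]
        exact lintegral_biUnion hcount hm hdisj _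
    _ ≤ ∑' C : 𝒞, ∫⁻ x in id (C : Set ℝ), ENNReal.ofReal (w x) :=
        ENNReal.tsum_le_tsum fun C => key C C.2
    _ = ∫⁻ x in V, ENNReal.ofReal (w x) := by
        conv_rhs => rw [hUn]
        exact (lintegral_biUnion hcount hm hdisj _).symm
    _ ≤ _ := lintegral_mono_set inter_subset_right

/-- The increment of `m` across an interval inside the detached set is at most the integral of
`|m'|`. -/
theorem ofReal_abs_sub_le_of_Ioo (h : IsContactMajorant p w m) {α β : ℝ} (hα : 0 < α)
    (hαβ : α ≤ β) (hU : Ioo α β ⊆ detachedSet p m) :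
    ENNReal.ofReal |m β - m α| ≤ ∫⁻ x in Ioo α β, ENNReal.ofReal |deriv m x| := by
  rcases hαβ.eq_or_lt with rfl | hαβ
  · simp
  obtain ⟨s, t, hst, hs_lim, ht_lim, hlim⟩ := exists_seq_tendsto_lintegral_Ioo hαβ
    fun x => ENNReal.ofReal |deriv m x|
  have hmα : ContinuousAt m α := h.continuousOn.continuousAt (Ioi_mem_nhds hα)
  have hmβ : ContinuousAt m β := h.continuousOn.continuousAt (Ioi_mem_nhds (hα.trans hαβ))
  have hlim2 := ENNReal.tendsto_ofReal
    (((hmβ.tendsto.comp ht_lim).sub (hmα.tendsto.comp hs_lim)).abs)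
  refine le_of_tendsto_of_tendsto' hlim2 hlim fun k => ?_
  obtain ⟨h1, h2, h3⟩ := hst k
  have hsub : Icc (s k) (t k) ⊆ Ioo α β := fun x hx => ⟨h1.trans_le hx.1, hx.2.trans_lt h3⟩
  rw [h.lintegral_abs_deriv_eq h2 (hsub.trans hU)]
  refine ENNReal.ofReal_le_ofReal ?_
  simp only [Function.comp]
  rw [← (h.absolutelyContinuousOnInterval h2 (hsub.trans hU)).integral_deriv_eq_sub]
  exact intervalIntegral.abs_integral_le_integral_abs h2

/-- Either `[a, b]` contains no contact point, or it has a first and a last one. -/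
theorem Icc_subset_or_exists_contact (h : IsContactMajorant p w m) {a b : ℝ} (ha : 0 < a) :
    Icc a b ⊆ detachedSet p m ∨ ∃ c d, a ≤ c ∧ c ≤ d ∧ d ≤ b ∧ p c = m c ∧ p d = m d ∧
      Ioo a c ⊆ detachedSet p m ∧ Ioo d b ⊆ detachedSet p m := by
  by_cases hne : (Icc a b \ detachedSet p m).Nonempty
  · right
    have hcomp : IsCompact (Icc a b \ detachedSet p m) := isCompact_Icc.diff h.isOpen_detachedSet
    obtain ⟨c, hc⟩ := hcomp.exists_isLeast hne
    obtain ⟨d, hd⟩ := hcomp.exists_isGreatest hne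
    have hcontact : ∀ y ∈ Icc a b \ detachedSet p m, p y = m y := by
      rintro y ⟨h1, h2⟩
      by_contra hcon
      have hy := ha.trans_le h1.1
      exact h2 ⟨hy, lt_of_le_of_ne (h.le y hy) hcon⟩
    refine ⟨c, d, hc.1.1.1, hc.2 hd.1, hd.1.1.2, hcontact c hc.1, hcontact d hd.1, ?_, ?_⟩
    · intro x hx
      by_contra hcon
      exact absurd (hc.2 ⟨⟨hx.1.le, hx.2.le.trans hc.1.1.2⟩, hcon⟩) (not_le.2 hx.2)
    · intro x hx
      by_contra hcon
      exact absurd (hd.2 ⟨⟨hd.1.1.1.trans hx.1.le, hx.2.le⟩, hcon⟩) (not_le.2 hx.1)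
  · left
    rw [not_nonempty_iff_eq_empty, sdiff_eq_empty] at hne
    exact hne

/-- On `(a, b)`, the variation of `m` on the detached set is at most that of `p`, up to the
oscillation of `m`, which accounts for the components reaching `a` or `b`. -/
theorem lintegral_detached_abs_deriv_le (h : IsContactMajorant p w m) {a b K : ℝ} (ha : 0 < a)
    (hab : a < b) (hK : ∀ x ∈ Icc a b, ∀ y ∈ Icc a b, m x - m y ≤ K) :
    ∫⁻ x in detachedSet p m ∩ Ioo a b, ENNReal.ofReal |deriv m x| ≤
      (∫⁻ x in Ioo a b, ENNReal.ofReal (w x)) + ENNReal.ofReal (4 * K) := by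
  have hK0 : 0 ≤ K := by
    have := hK a (left_mem_Icc.2 hab.le) a (left_mem_Icc.2 hab.le)
    linarith
  rcases h.Icc_subset_or_exists_contact (b := b) ha with hU | ⟨c, d, hac, hcd, hdb, hpc, hpd, h1, h2⟩
  · refine (lintegral_mono_set inter_subset_right).trans ((h.lintegral_Ioo_abs_deriv_le_of_osc hab
      (Ioo_subset_Icc_self.trans hU)
      (fun x hx y hy => hK x (Ioo_subset_Icc_self hx) y (Ioo_subset_Icc_self hy))).trans ?_)
    exact (ENNReal.ofReal_le_ofReal (by linarith)).trans le_add_self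
  · have e1 : ∫⁻ x in Ioo a c, ENNReal.ofReal |deriv m x| ≤ ENNReal.ofReal (2 * K) := by
      rcases hac.eq_or_lt with rfl | hac'
      · simp
      · refine h.lintegral_Ioo_abs_deriv_le_of_osc hac' h1 fun x hx y hy => ?_
        have : Ioo a c ⊆ Icc a b := Ioo_subset_Icc_self.trans (Icc_subset_Icc le_rfl (hcd.trans hdb))
        exact hK x (this hx) y (this hy)
    have e2 : ∫⁻ x in Ioo d b, ENNReal.ofReal |deriv m x| ≤ ENNReal.ofReal (2 * K) := by
      rcases hdb.eq_or_lt with rfl | hdb'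
      · simp
      · refine h.lintegral_Ioo_abs_deriv_le_of_osc hdb' h2 fun x hx y hy => ?_
        have : Ioo d b ⊆ Icc a b := Ioo_subset_Icc_self.trans (Icc_subset_Icc (hac.trans hcd) le_rfl)
        exact hK x (this hx) y (this hy)
    have e3 := h.lintegral_inter_Ioo_abs_deriv_le (ha.trans_le hac) hpc hpd
    have hsub : detachedSet p m ∩ Ioo a b ⊆
        (detachedSet p m ∩ Ioo c d) ∪ (Ioo a c ∪ Ioo d b) := by
      rintro x ⟨hx, hxa, hxb⟩
      rcases lt_trichotomy x c with hxc | rfl | hxc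
      · exact Or.inr (Or.inl ⟨hxa, hxc⟩)
      · exact absurd hpc hx.2.ne
      rcases lt_trichotomy x d with hxd | rfl | hxd
      · exact Or.inl ⟨hx, hxc, hxd⟩
      · exact absurd hpd hx.2.ne
      · exact Or.inr (Or.inr ⟨hxd, hxb⟩)
    calc ∫⁻ x in detachedSet p m ∩ Ioo a b, ENNReal.ofReal |deriv m x|
        ≤ _ := (lintegral_mono_set hsub).trans (lintegral_union_le _ _ _)
      _ ≤ (∫⁻ x in Ioo a b, ENNReal.ofReal (w x)) +
          (ENNReal.ofReal (2 * K) + ENNReal.ofReal (2 * K)) := by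
          refine add_le_add (e3.trans (lintegral_mono_set (Ioo_subset_Ioo hac hdb))) ?_
          exact (lintegral_union_le _ _ _).trans (add_le_add e1 e2)
      _ = _ := by
          rw [← ENNReal.ofReal_add (by linarith) (by linarith)]
          ring_nf

/-- The increments of `m` are controlled by `w` together with `|m'|` on the detached set. -/
theorem ofReal_abs_sub_le (h : IsContactMajorant p w m) {a b : ℝ} (ha : 0 < a) (hab : a ≤ b) :
    ENNReal.ofReal |m b - m a| ≤
      ∫⁻ x in Ioo a b, (ENNReal.ofReal (w x) +
        (detachedSet p m).indicator (fun x => ENNReal.ofReal |deriv m x|) x) := by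
  set H : ℝ → ℝ≥0∞ := fun x => ENNReal.ofReal (w x) +
        (detachedSet p m).indicator (fun x => ENNReal.ofReal |deriv m x|) x with hH
  have hderiv : ∀ α β, Ioo α β ⊆ detachedSet p m →
      ∫⁻ x in Ioo α β, ENNReal.ofReal |deriv m x| ≤ ∫⁻ x in Ioo α β, H x := by
    intro α β hs
    refine setLIntegral_mono' measurableSet_Ioo fun x hx => ?_
    simp only [hH, indicator_of_mem (hs hx)]
    exact le_add_self
  rcases h.Icc_subset_or_exists_contact (b := b) ha with hU | ⟨c, d, hac, hcd, hdb, hpc, hpd, h1, h2⟩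
  · have hs := Ioo_subset_Icc_self.trans hU
    exact (h.ofReal_abs_sub_le_of_Ioo ha hab hs).trans (hderiv _ _ hs)
  · have e1 := (h.ofReal_abs_sub_le_of_Ioo ha hac h1).trans (hderiv _ _ h1)
    have hd0 : 0 < d := ha.trans_le (hac.trans hcd)
    have e2 := (h.ofReal_abs_sub_le_of_Ioo hd0 hdb h2).trans (hderiv _ _ h2)
    have e3 : ENNReal.ofReal |m d - m c| ≤ ∫⁻ x in Ioo c d, H x := by
      rw [← hpc, ← hpd]
      have hc0 := ha.trans_le hac
      refine (ENNReal.ofReal_le_ofReal (h.abs_sub_le c d hc0 hcd)).trans ?_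
      rw [intervalIntegral.integral_of_le hcd, integral_Ioc_eq_integral_Ioo,
        ofReal_integral_eq_lintegral_ofReal]
      · exact lintegral_mono fun x => le_self_add
      · exact (intervalIntegrable_iff_integrableOn_Ioo_of_le hcd).1 (h.weight_integrable c d hc0 hd0)
      · exact Eventually.of_forall h.weight_nonneg
    have htri : |m b - m a| ≤ |m c - m a| + (|m d - m c| + |m b - m d|) := by
      have e : m b - m a = (m c - m a) + ((m d - m c) + (m b - m d)) := by ring
      rw [e]
      exact (abs_add_le _ _).trans (add_le_add le_rfl (abs_add_le _ _))
    refine (ENNReal.ofReal_le_ofReal htri).trans ?_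
    rw [ENNReal.ofReal_add (abs_nonneg _) (by positivity),
      ENNReal.ofReal_add (abs_nonneg _) (abs_nonneg _)]
    refine (add_le_add e1 (add_le_add e3 e2)).trans ?_
    have hd1 : Disjoint (Ioo c d) (Ioo d b) :=
      Set.disjoint_left.2 fun x hx hy => absurd (hx.2.trans hy.1) (lt_irrefl _)
    have hd2 : Disjoint (Ioo a c) (Ioo c d ∪ Ioo d b) :=
      Set.disjoint_left.2 fun x hx hy => by
        rcases hy with hy | hy
        · exact absurd (hx.2.trans hy.1) (lt_irrefl _)
        · exact absurd (hx.2.trans_le (hcd.trans hy.1.le)) (lt_irrefl _)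
    rw [← lintegral_union measurableSet_Ioo hd1,
      ← lintegral_union (measurableSet_Ioo.union measurableSet_Ioo) hd2]
    refine lintegral_mono_set ?_
    rintro x (hx | hx | hx)
    · exact ⟨hx.1, hx.2.trans_le (hcd.trans hdb)⟩
    · exact ⟨hac.trans_lt hx.1, hx.2.trans_le hdb⟩
    · exact ⟨(hac.trans hcd).trans_lt hx.1, hx.2⟩

end IsContactMajorant

/-! ### Polar coordinates and radial functions -/

section Polar

variable {n : ℕ} [NeZero n]

instance : Nontrivial (EuclideanSpace ℝ (Fin n)) := by
  have : Nonempty (Fin n) := ⟨0⟩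
  infer_instance

/-- Polar coordinates for lower integrals. -/
theorem lintegral_polar_of_finrank {E : Type*} [NormedAddCommGroup E] [NormedSpace ℝ E]
    [FiniteDimensional ℝ E] [Nontrivial E] [MeasurableSpace E] [BorelSpace E] (μ : Measure E)
    [μ.IsAddHaarMeasure] {Ψ : E → ℝ≥0∞} (hΨ : Measurable Ψ) :
    ∫⁻ x, Ψ x ∂μ = ∫⁻ ρ in Ioi (0 : ℝ), ENNReal.ofReal (ρ ^ (Module.finrank ℝ E - 1)) *
      ∫⁻ θ, Ψ (ρ • (θ : E)) ∂μ.toSphere := by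
  have hmp := μ.measurePreserving_homeomorphUnitSphereProd
  have e1 : ∫⁻ x, Ψ x ∂μ = ∫⁻ x : ({(0 : E)}ᶜ : Set E), Ψ x ∂(μ.comap (↑)) := by
    rw [lintegral_subtype_comap (measurableSet_singleton _).compl, restrict_compl_singleton]
  have e2 := hmp.lintegral_comp_emb (Homeomorph.measurableEmbedding _)
    (fun q : sphere (0 : E) 1 × Ioi (0 : ℝ) => Ψ (q.2.1 • (q.1 : E)))
  have e3 : ∀ x : ({(0 : E)}ᶜ : Set E),
      ((homeomorphUnitSphereProd E x).2.1 • ((homeomorphUnitSphereProd E x).1 : E)) = x := by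
    intro x
    have hx : ‖(x : E)‖ ≠ 0 := norm_ne_zero_iff.2 x.2
    simp [smul_smul, hx]
  simp only [e3] at e2
  have hmeas : Measurable fun q : sphere (0 : E) 1 × Ioi (0 : ℝ) => Ψ (q.2.1 • (q.1 : E)) :=
    hΨ.comp (by fun_prop)
  rw [e1, e2, lintegral_prod_symm' _ hmeas, Measure.volumeIoiPow,
    lintegral_withDensity_eq_lintegral_mul _ (by fun_prop) hmeas.lintegral_prod_left']
  exact lintegral_subtype_comap measurableSet_Ioi (fun ρ : ℝ => ENNReal.ofReal
    (ρ ^ (Module.finrank ℝ E - 1)) * ∫⁻ θ, Ψ (ρ • (θ : E)) ∂μ.toSphere)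

theorem lintegral_polar {Ψ : EuclideanSpace ℝ (Fin n) → ℝ≥0∞} (hΨ : Measurable Ψ) :
    ∫⁻ x, Ψ x = ∫⁻ ρ in Ioi (0 : ℝ), ENNReal.ofReal (ρ ^ (n - 1)) *
      ∫⁻ θ, Ψ (ρ • (θ : EuclideanSpace ℝ (Fin n)))
        ∂(volume : Measure (EuclideanSpace ℝ (Fin n))).toSphere := by
  rw [lintegral_polar_of_finrank volume hΨ, finrank_euclideanSpace_fin]

/-- A property holding at almost every radius holds at almost every point. -/
theorem ae_norm_of_ae {Q : ℝ → Prop} (hQ : ∀ᵐ ρ, 0 < ρ → Q ρ) :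
    ∀ᵐ x : EuclideanSpace ℝ (Fin n), Q ‖x‖ := by
  obtain ⟨N, hN, hNm, hN0⟩ := exists_measurable_superset_of_null (ae_iff.1 hQ)
  have h1 : ∫⁻ x : EuclideanSpace ℝ (Fin n), N.indicator 1 ‖x‖ = 0 := by
    rw [lintegral_polar (Ψ := fun x : EuclideanSpace ℝ (Fin n) => N.indicator 1 ‖x‖)
      ((measurable_one.indicator hNm).comp measurable_norm)]
    rw [lintegral_eq_zero_iff']
    · have : ∀ᵐ ρ ∂(volume.restrict (Ioi (0:ℝ))), ρ ∉ N :=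
        ae_restrict_of_ae (measure_eq_zero_iff_ae_notMem.1 hN0)
      filter_upwards [this, ae_restrict_mem measurableSet_Ioi] with ρ hρ hρ0
      have hρ0 : 0 < ρ := hρ0
      simp [norm_smul, abs_of_pos hρ0, hρ]
    · refine Measurable.aemeasurable ?_
      refine Measurable.mul (by fun_prop) ?_
      refine Measurable.lintegral_prod_right' (f := fun q : ℝ × sphere (0 : EuclideanSpace ℝ (Fin n)) 1
        => N.indicator 1 ‖q.1 • (q.2 : EuclideanSpace ℝ (Fin n))‖) ?_
      exact (measurable_one.indicator hNm).comp (by fun_prop)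
  have h1 := (lintegral_eq_zero_iff ((measurable_one.indicator hNm).comp measurable_norm)).1 h1
  filter_upwards [h1, Measure.ae_ne volume (0 : EuclideanSpace ℝ (Fin n))] with x hx hx0
  by_contra hcon
  have : ‖x‖ ∈ N := hN (by simpa [hx0] using hcon)
  simp [this] at hx

end Polar

theorem intervalIntegrable_of_weight {n : ℕ} {h : ℝ → ℝ}
    (hh : IntegrableOn (fun ρ => ρ ^ n * h ρ) (Ioi 0)) {s t : ℝ} (hs : 0 < s) (ht : 0 < t) :
    IntervalIntegrable h volume s t := by
  have h1 : IntervalIntegrable (fun ρ => ρ ^ n * h ρ) volume s t := by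
    rw [intervalIntegrable_iff]
    refine hh.mono_set fun x hx => ?_
    exact (lt_min hs ht).trans hx.1
  have h2 : ContinuousOn (fun ρ : ℝ => (ρ ^ n)⁻¹) (uIcc s t) := by
    refine ContinuousOn.inv₀ (by fun_prop) fun x hx => ?_
    have : 0 < x := (lt_min hs ht).trans_le hx.1
    positivity
  refine (h1.continuousOn_mul h2).congr ?_
  intro x hx
  have : 0 < x := (lt_min hs ht).trans hx.1
  simp only
  field_simp

/-- A bound for the growth at the origin of a primitive of `h`, for `ρⁿ h` integrable. -/
theorem pow_mul_integral_abs_le {n : ℕ} {h : ℝ → ℝ}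
    (hh : IntegrableOn (fun ρ => ρ ^ n * h ρ) (Ioi 0)) {s t : ℝ} (hs : 0 < s) (hst : s ≤ t) :
    s ^ n * ∫ u in s..t, |h u| ≤ ∫ u in Ioi 0, u ^ n * |h u| := by
  have hI := intervalIntegrable_of_weight hh hs (hs.trans_le hst)
  have hI2 : IntegrableOn (fun ρ => ρ ^ n * |h ρ|) (Ioi 0) := by
    refine IntegrableOn.congr_fun (f := fun ρ => |ρ ^ n * h ρ|) hh.abs (fun x hx => ?_)
      measurableSet_Ioi
    have : 0 < x := hx
    simp [abs_mul, abs_of_pos this]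
  rw [intervalIntegral.integral_of_le hst, ← integral_const_mul]
  have hsub : Ioc s t ⊆ Ioi 0 := fun x hx => hs.trans hx.1
  calc ∫ u in Ioc s t, s ^ n * |h u| ≤ ∫ u in Ioc s t, u ^ n * |h u| := by
        refine setIntegral_mono_on ?_ (hI2.mono_set hsub) measurableSet_Ioc fun x hx => ?_
        · exact (((intervalIntegrable_iff_integrableOn_Ioc_of_le hst).1 hI).abs).const_mul _
        · gcongr
          exact hx.1.le
    _ ≤ _ := by
        refine setIntegral_mono_set hI2 ?_ hsub.eventuallyLE
        filter_upwards [ae_restrict_mem measurableSet_Ioi] with x hx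
        have : 0 < x := hx
        positivity

theorem hasFDerivAt_norm_of_ne_zero {E : Type*} [NormedAddCommGroup E] [InnerProductSpace ℝ E]
    {x : E} (hx : x ≠ 0) :
    HasFDerivAt (fun y : E => ‖y‖) (‖x‖⁻¹ • innerSL ℝ x) x := by
  have h1 := (hasStrictFDerivAt_norm_sq x).hasFDerivAt.sqrt
    (by have := norm_pos_iff.2 hx; positivity)
  have h2 : (fun y : E => √(‖y‖ ^ 2)) = fun y => ‖y‖ := by
    ext y; exact Real.sqrt_sq (norm_nonneg y)
  rw [h2] at h1
  refine h1.congr_fderiv ?_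
  rw [Real.sqrt_sq (norm_nonneg x)]
  ext v
  simp
  ring

/-! ### Weak gradients of radial functions -/

section WeakGradient

variable {n : ℕ} [NeZero n]

/-- Continuity of the profile at the origin is not needed, since points are null sets. -/
theorem aestronglyMeasurable_comp_norm {m : ℝ → ℝ} (hm : ContinuousOn m (Ioi 0)) :
    AEStronglyMeasurable (fun x : EuclideanSpace ℝ (Fin n) => m ‖x‖) := by
  have h1 : ContinuousOn (fun x : EuclideanSpace ℝ (Fin n) => m ‖x‖) {0}ᶜ :=
    hm.comp continuous_norm.continuousOn fun x hx => norm_pos_iff.2 hx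
  have := h1.aestronglyMeasurable (μ := volume) (measurableSet_singleton _).compl
  rwa [restrict_compl_singleton] at this

/-- The profile grows at the origin no faster than `ρ ^ (1 - n)`, by `pow_mul_integral_abs_le`. -/
theorem locallyIntegrable_comp_norm {m h : ℝ → ℝ}
    (hh : IntegrableOn (fun ρ => ρ ^ (n - 1) * h ρ) (Ioi 0))
    (hm : ∀ s t, 0 < s → s ≤ t → |m t - m s| ≤ ∫ u in s..t, |h u|) :
    LocallyIntegrable (fun x : EuclideanSpace ℝ (Fin n) => m ‖x‖) := by
  have hcont : ContinuousOn m (Ioi 0) := continuousOn_of_abs_sub_le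
    (fun s t hs ht => (intervalIntegrable_of_weight hh hs ht).abs) hm
  intro x
  refine ⟨ball 0 (‖x‖ + 1), isOpen_ball.mem_nhds (by simp), ?_⟩
  set R := ‖x‖ + 1 with hR
  have hR0 : 0 < R := by positivity
  rw [integrableOn_fun_norm_addHaar volume (f := m)]
  have hdim : Module.finrank ℝ (EuclideanSpace ℝ (Fin n)) = n := by simp
  rw [hdim]
  refine IntegrableOn.of_bound (by simp) ?_
    (R ^ (n - 1) * |m R| + ∫ u in Ioi (0 : ℝ), u ^ (n - 1) * |h u|) ?_
  · have hc : ContinuousOn (fun y => y ^ (n - 1) • m y) (Ioo 0 R) :=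
      (continuous_pow _).continuousOn.smul (hcont.mono fun y hy => hy.1)
    exact hc.aestronglyMeasurable measurableSet_Ioo
  · filter_upwards [ae_restrict_mem measurableSet_Ioo] with y hy
    have hy0 : 0 < y := hy.1
    have h1 := hm y R hy.1 hy.2.le
    have h2 := pow_mul_integral_abs_le hh hy.1 hy.2.le
    have h3 : |m y| ≤ |m R| + ∫ u in y..R, |h u| := by
      have := abs_sub_abs_le_abs_sub (m y) (m R)
      rw [abs_sub_comm] at this
      linarith
    rw [norm_smul, Real.norm_eq_abs, Real.norm_eq_abs, abs_of_pos (pow_pos hy0 _)]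
    calc y ^ (n - 1) * |m y| ≤ y ^ (n - 1) * (|m R| + ∫ u in y..R, |h u|) := by gcongr
      _ = y ^ (n - 1) * |m R| + y ^ (n - 1) * ∫ u in y..R, |h u| := by ring
      _ ≤ _ := by
        gcongr
        exact hy.2.le

/-- Integration by parts for the radial function with Lipschitz profile `ρ ↦ c - ∫ u in ρ..R, h u`,
whose derivative `h` is bounded. -/
theorem integral_radial_lipschitz {h : ℝ → ℝ} (hh : Measurable h) {K : ℝ≥0} (hK : ∀ t, |h t| ≤ K)
    (c R : ℝ) {φ : EuclideanSpace ℝ (Fin n) → ℝ} (hφ : ContDiff ℝ ∞ φ) (hφc : HasCompactSupport φ)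
    (i : Fin n) :
    ∫ x, fderiv ℝ φ x (EuclideanSpace.single i 1) * (c - ∫ u in ‖x‖..R, h u) =
      - ∫ x : EuclideanSpace ℝ (Fin n), h ‖x‖ / ‖x‖ * x i * φ x := by
  have hhl : LocallyIntegrable h := by
    refine (locallyIntegrable_const (K : ℝ)).mono hh.aestronglyMeasurable
      (Eventually.of_forall fun x => ?_)
    simpa using hK x
  have hii : ∀ a b, IntervalIntegrable h volume a b := fun a b =>
    (hhl.integrableOn_isCompact isCompact_uIcc).intervalIntegrable
  set U : ℝ → ℝ := fun ρ => c - ∫ u in ρ..R, h u with hU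
  have hUlip : LipschitzWith K U := by
    refine LipschitzWith.of_dist_le_mul fun a b => ?_
    rw [Real.dist_eq, Real.dist_eq]
    have : U a - U b = ∫ u in b..a, h u := by
      have := intervalIntegral.integral_add_adjacent_intervals (hii b a) (hii a R)
      simp only [hU]; linarith
    rw [this]
    exact intervalIntegral.norm_integral_le_of_norm_le_const (f := h) (fun x _ => hK x)
  have hulip : LipschitzWith K fun x : EuclideanSpace ℝ (Fin n) => U ‖x‖ := by
    have := hUlip.comp (lipschitzWith_one_norm (E := EuclideanSpace ℝ (Fin n)))
    rw [mul_one] at this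
    exact this
  obtain ⟨D, hD⟩ := hφ.lipschitzWith_of_hasCompactSupport hφc (by simp)
  have key := LipschitzWith.integral_lineDeriv_mul_eq
    (μ := (volume : Measure (EuclideanSpace ℝ (Fin n)))) hulip hD hφc
    (EuclideanSpace.single i 1)
  have hd : ∀ᵐ x : EuclideanSpace ℝ (Fin n), HasDerivAt U (h ‖x‖) ‖x‖ := by
    refine ae_norm_of_ae (Q := fun ρ => HasDerivAt U (h ρ) ρ) ?_
    filter_upwards [LocallyIntegrable.ae_hasDerivAt_integral hhl] with ρ hρ _
    have : U = fun ρ => c + ∫ u in R..ρ, h u := by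
      ext ρ; simp only [hU]; rw [intervalIntegral.integral_symm]; ring
    rw [this]
    exact (hρ R).const_add c
  have hlhs : ∫ x, lineDeriv ℝ (fun x : EuclideanSpace ℝ (Fin n) => U ‖x‖) x
      (EuclideanSpace.single i 1) * φ x = ∫ x : EuclideanSpace ℝ (Fin n), h ‖x‖ / ‖x‖ * x i * φ x := by
    refine integral_congr_ae ?_
    filter_upwards [hd, Measure.ae_ne volume (0 : EuclideanSpace ℝ (Fin n))] with x hx hx0
    have h1 := hx.comp_hasFDerivAt x (hasFDerivAt_norm_of_ne_zero hx0)
    have h2 := h1.hasLineDerivAt (EuclideanSpace.single i 1)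
    have h3 : lineDeriv ℝ (fun x : EuclideanSpace ℝ (Fin n) => U ‖x‖) x
      (EuclideanSpace.single i 1) = _ := h2.lineDeriv
    rw [h3]
    simp [EuclideanSpace.inner_single_right]
    left
    ring
  have hrhs : ∫ x, lineDeriv ℝ φ x (-EuclideanSpace.single i 1) * U ‖x‖ =
      - ∫ x, fderiv ℝ φ x (EuclideanSpace.single i 1) * U ‖x‖ := by
    rw [← integral_neg]
    refine integral_congr_ae (Eventually.of_forall fun x => ?_)
    simp only
    rw [((hφ.differentiable (by simp)) x).lineDeriv_eq_fderiv]
    simp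
  rw [hlhs, hrhs] at key
  rw [key, neg_neg]

/-- A radial function whose profile has the weighted integrable derivative `h` on `(0, ∞)` is weakly
differentiable across the origin, also when `n = 1`: truncating `h` in size yields Lipschitz
approximations. -/
theorem hasWeakGradient_radial {m h : ℝ → ℝ} (hh : Measurable h)
    (hint : IntegrableOn (fun ρ => ρ ^ (n - 1) * h ρ) (Ioi 0))
    (hm : ∀ s t, 0 < s → s ≤ t → m t - m s = ∫ u in s..t, h u) :
    Integrable (fun x : EuclideanSpace ℝ (Fin n) => (h ‖x‖ / ‖x‖) • x) ∧
    HasWeakGradient (fun x : EuclideanSpace ℝ (Fin n) => m ‖x‖) fun x => (h ‖x‖ / ‖x‖) • x := by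
  have hdim : Module.finrank ℝ (EuclideanSpace ℝ (Fin n)) = n := by simp
  have hnorm : Integrable (fun x : EuclideanSpace ℝ (Fin n) => h ‖x‖) := by
    rw [integrable_fun_norm_addHaar volume (f := h), hdim]
    exact hint
  have hG : Integrable (fun x : EuclideanSpace ℝ (Fin n) => (h ‖x‖ / ‖x‖) • x) := by
    refine hnorm.mono ?_ (Eventually.of_forall fun x => ?_)
    · exact (Measurable.smul ((hh.comp measurable_norm).div measurable_norm) measurable_id).aestronglyMeasurable
    · rw [norm_smul, norm_div, norm_norm]
      rcases eq_or_ne x 0 with rfl | hx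
      · simp
      · rw [div_mul_cancel₀ _ (norm_ne_zero_iff.2 hx)]
  have hmL : LocallyIntegrable (fun x : EuclideanSpace ℝ (Fin n) => m ‖x‖) := by
    refine locallyIntegrable_comp_norm hint fun s t hs hst => ?_
    rw [hm s t hs hst]
    exact intervalIntegral.abs_integral_le_integral_abs hst
  refine ⟨hG, hmL, hG.locallyIntegrable, fun φ hφ hφc i => ?_⟩
  obtain ⟨R, hR0, hR⟩ : ∃ R > 0, tsupport φ ⊆ ball 0 R :=
    (hφc.isBounded).subset_ball_lt 0 0
  set hk : ℕ → ℝ → ℝ := fun k ρ => if |h ρ| ≤ k then h ρ else 0 with hhk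
  have hkm : ∀ k, Measurable (hk k) := fun k =>
    Measurable.ite (measurableSet_le (by fun_prop) measurable_const) hh measurable_const
  have hkK : ∀ k t, |hk k t| ≤ (k : ℝ≥0) := by
    intro k t
    simp only [hhk]
    split_ifs with h1
    · simpa using h1
    · simp
  have hkh : ∀ k t, |hk k t| ≤ |h t| := by
    intro k t
    simp only [hhk]
    split_ifs with h1
    · exact le_rfl
    · simp
  have hklim : ∀ t, Tendsto (fun k => hk k t) atTop (𝓝 (h t)) := by
    intro t
    refine tendsto_const_nhds.congr' ?_
    filter_upwards [eventually_ge_atTop ⌈|h t|⌉₊] with k hk1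
    have : |h t| ≤ k := (Nat.le_ceil _).trans (by exact_mod_cast hk1)
    simp [hhk, this]
  have hipp := fun k => integral_radial_lipschitz (hkm k) (hkK k) (m R) R hφ hφc i
  have hφ' : Continuous fun x => fderiv ℝ φ x (EuclideanSpace.single i 1) :=
    (hφ.continuous_fderiv (by simp)).clm_apply continuous_const
  have hφ'c : HasCompactSupport fun x => fderiv ℝ φ x (EuclideanSpace.single i 1) :=
    hφc.fderiv_apply ℝ _
  have hii : ∀ s, 0 < s → IntervalIntegrable h volume s R := fun s hs =>
    intervalIntegrable_of_weight hint hs hR0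
  have hkii : ∀ k s t, 0 < s → 0 < t → IntervalIntegrable (hk k) volume s t := fun k s t hs ht =>
    (intervalIntegrable_of_weight hint hs ht).mono_fun (hkm k).aestronglyMeasurable
      (Eventually.of_forall fun u => hkh k u)
  -- the dominating function is itself radial with weighted integrable derivative
  have hΓ : LocallyIntegrable
      (fun x : EuclideanSpace ℝ (Fin n) => |m R| + ∫ u in ‖x‖..R, |h u|) := by
    refine (locallyIntegrable_const _).add ?_
    refine locallyIntegrable_comp_norm (m := fun ρ => ∫ u in ρ..R, |h u|) hint fun s t hs hst => ?_
    have := intervalIntegral.integral_add_adjacent_intervals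
      (intervalIntegrable_of_weight hint hs (hs.trans_le hst)).abs (hii t (hs.trans_le hst)).abs
    rw [← this, sub_add_cancel_right, abs_neg, abs_of_nonneg]
    exact intervalIntegral.integral_nonneg hst fun _ _ => abs_nonneg _
  have hlim1 : Tendsto (fun k => ∫ x : EuclideanSpace ℝ (Fin n),
      fderiv ℝ φ x (EuclideanSpace.single i 1) * (m R - ∫ u in ‖x‖..R, hk k u)) atTop
      (𝓝 (∫ x : EuclideanSpace ℝ (Fin n), fderiv ℝ φ x (EuclideanSpace.single i 1) * m ‖x‖)) := by
    refine tendsto_integral_of_dominated_convergence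
      (fun x => ‖fderiv ℝ φ x (EuclideanSpace.single i 1) • (|m R| + ∫ u in ‖x‖..R, |h u|)‖) ?_
      (hΓ.integrable_smul_left_of_hasCompactSupport hφ' hφ'c).norm ?_ ?_
    · intro k
      refine hφ'.aestronglyMeasurable.mul ?_
      refine aestronglyMeasurable_const.sub ?_
      refine aestronglyMeasurable_comp_norm (m := fun ρ => ∫ u in ρ..R, hk k u) ?_
      refine continuousOn_of_abs_sub_le (w := fun u => |hk k u|)
        (fun s t hs ht => (hkii k s t hs ht).abs) fun s t hs hst => ?_
      have := intervalIntegral.integral_add_adjacent_intervals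
        (hkii k s t hs (hs.trans_le hst)) (hkii k t R (hs.trans_le hst) hR0)
      rw [← this, sub_add_cancel_right, abs_neg]
      exact intervalIntegral.abs_integral_le_integral_abs hst
    · intro k
      filter_upwards [Measure.ae_ne volume (0 : EuclideanSpace ℝ (Fin n))] with x hx
      have hx0 : 0 < ‖x‖ := norm_pos_iff.2 hx
      rcases le_or_gt ‖x‖ R with hxR | hxR
      · rw [norm_mul, norm_smul]
        refine mul_le_mul_of_nonneg_left ?_ (norm_nonneg _)
        refine ((norm_sub_le _ _).trans ?_).trans (le_abs_self _)
        refine add_le_add le_rfl ?_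
        refine (intervalIntegral.norm_integral_le_integral_norm hxR).trans ?_
        exact intervalIntegral.integral_mono_on hxR (hkii k _ _ hx0 hR0).norm (hii _ hx0).abs
          fun u _ => hkh k u
      · have : fderiv ℝ φ x (EuclideanSpace.single i 1) = 0 := by
          by_contra hcon
          have h1 := hR (tsupport_fderiv_apply_subset ℝ (EuclideanSpace.single i 1)
            (subset_tsupport _ hcon))
          rw [mem_ball_zero_iff] at h1
          linarith
        simp [this]
    · filter_upwards [Measure.ae_ne volume (0 : EuclideanSpace ℝ (Fin n))] with x hx
      have hx0 : 0 < ‖x‖ := norm_pos_iff.2 hx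
      refine Tendsto.const_mul _ ?_
      have hmx : m ‖x‖ = m R - ∫ u in ‖x‖..R, h u := by
        rcases le_total ‖x‖ R with hxR | hxR
        · linarith [hm _ _ hx0 hxR]
        · rw [intervalIntegral.integral_symm]
          linarith [hm _ _ hR0 hxR]
      rw [hmx]
      refine tendsto_const_nhds.sub ?_
      refine intervalIntegral.tendsto_integral_filter_of_dominated_convergence (fun u => |h u|) ?_ ?_
        (hii _ hx0).abs ?_
      · exact Eventually.of_forall fun k => (hkm k).aestronglyMeasurable
      · exact Eventually.of_forall fun k => Eventually.of_forall fun u _ => hkh k u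
      · exact Eventually.of_forall fun u _ => hklim u
  have hlim2 : Tendsto (fun k => - ∫ x : EuclideanSpace ℝ (Fin n), hk k ‖x‖ / ‖x‖ * x i * φ x) atTop
      (𝓝 (- ∫ x : EuclideanSpace ℝ (Fin n), h ‖x‖ / ‖x‖ * x i * φ x)) := by
    obtain ⟨C, hC⟩ := hφc.exists_bound_of_continuous hφ.continuous
    refine (tendsto_integral_of_dominated_convergence
      (fun x : EuclideanSpace ℝ (Fin n) => ‖h ‖x‖‖ * C) ?_ (hnorm.norm.mul_const C) ?_ ?_).neg
    · intro k
      have hx : Measurable fun x : EuclideanSpace ℝ (Fin n) => x i := by fun_prop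
      exact (((((hkm k).comp measurable_norm).div measurable_norm).mul hx).mul
        hφ.continuous.measurable).aestronglyMeasurable
    · intro k
      refine Eventually.of_forall fun x => ?_
      rw [norm_mul, norm_mul, norm_div, norm_norm]
      refine mul_le_mul ?_ (hC x) (norm_nonneg _) (norm_nonneg _)
      rcases eq_or_ne x 0 with rfl | hx
      · simp
      · have h1 : ‖x i‖ ≤ ‖x‖ := PiLp.norm_apply_le x i
        have h2 : 0 < ‖x‖ := norm_pos_iff.2 hx
        calc ‖hk k ‖x‖‖ / ‖x‖ * ‖x i‖ ≤ ‖hk k ‖x‖‖ / ‖x‖ * ‖x‖ := by gcongr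
          _ = ‖hk k ‖x‖‖ := div_mul_cancel₀ _ h2.ne'
          _ ≤ _ := hkh k _
    · refine Eventually.of_forall fun x => ?_
      exact (((hklim ‖x‖).div_const _).mul_const _).mul_const _
  have := tendsto_nhds_unique (hlim1.congr hipp) hlim2
  simpa [mul_comm, mul_left_comm] using this

end WeakGradient

/-! ### Weak derivatives on the half-line -/

theorem exists_Ioo_of_isCompact_subset_Ioi {K : Set ℝ} (hK : IsCompact K) (hpos : K ⊆ Ioi 0) :
    ∃ a b, 0 < a ∧ a < 1 ∧ 1 < b ∧ K ⊆ Ioo a b := by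
  have hne : (insert 1 K).Nonempty := insert_nonempty _ _
  obtain ⟨a, ha, ha'⟩ := (hK.insert 1).exists_isLeast hne
  obtain ⟨b, hb, hb'⟩ := (hK.insert 1).exists_isGreatest hne
  have ha0 : 0 < a := by
    rcases ha with rfl | ha
    · exact one_pos
    · exact hpos ha
  have ha1 : a ≤ 1 := ha' (mem_insert _ _)
  have hb1 : 1 ≤ b := hb' (mem_insert _ _)
  refine ⟨a / 2, b + 1, by linarith, by linarith, by linarith, fun x hx => ⟨?_, ?_⟩⟩
  · have := ha' (mem_insert_of_mem 1 hx); linarith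
  · have := hb' (mem_insert_of_mem 1 hx); linarith

theorem setIntegral_Ioi_eq_of_tsupport {f ψ : ℝ → ℝ} {a b : ℝ} (ha : 0 < a) (hab : a ≤ b)
    (hψ : tsupport ψ ⊆ Ioo a b) : ∫ x in Ioi 0, f x * ψ x = ∫ x in a..b, f x * ψ x := by
  rw [intervalIntegral.integral_of_le hab]
  refine setIntegral_eq_of_subset_of_forall_sdiff_eq_zero measurableSet_Ioi
    (fun x hx => ha.trans hx.1) fun x hx => ?_
  have : x ∉ tsupport ψ := fun h => hx.2 (Ioo_subset_Ioc_self (hψ h))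
  simp [image_eq_zero_of_notMem_tsupport this]

/-- A locally integrable function on `(0, ∞)` with zero weak derivative is constant. -/
theorem exists_const_of_integral_mul_deriv_eq_zero {u : ℝ → ℝ} (hu : LocallyIntegrableOn u (Ioi 0))
    (h : ∀ ψ : ℝ → ℝ, ContDiff ℝ ∞ ψ → HasCompactSupport ψ → tsupport ψ ⊆ Ioi 0 →
      ∫ x in Ioi 0, u x * deriv ψ x = 0) : ∃ c, ∀ᵐ x, 0 < x → u x = c := by
  let β : ContDiffBump (1 : ℝ) := ⟨1 / 4, 1 / 2, by norm_num, by norm_num⟩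
  set χ₀ : ℝ → ℝ := β.normed volume with hχ₀
  have hχ₀s : ContDiff ℝ ∞ χ₀ := β.contDiff_normed
  have hχ₀c : HasCompactSupport χ₀ := β.hasCompactSupport_normed
  have hχ₀i : ∫ x, χ₀ x = 1 := β.integral_normed
  have hχ₀p : tsupport χ₀ ⊆ Ioi 0 := by
    rw [hχ₀, β.tsupport_normed_eq]
    intro x hx
    have hx : |x - 1| ≤ 1 / 2 := hx
    have := (abs_le.1 hx).1
    simp only [mem_Ioi]; linarith
  -- subtracting a multiple of `χ₀` makes a test function have mean zero
  set c := ∫ x in Ioi 0, u x * χ₀ x with hc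
  have hint : ∀ χ : ℝ → ℝ, Continuous χ → HasCompactSupport χ → tsupport χ ⊆ Ioi 0 →
      IntegrableOn (fun x => u x * χ x) (Ioi 0) := by
    intro χ hχ hχc hχp
    obtain ⟨a, b, ha, ha1, hb1, hK⟩ := exists_Ioo_of_isCompact_subset_Ioi hχc hχp
    have h1 : IntegrableOn u (Icc a b) :=
      hu.integrableOn_compact_subset (fun x hx => ha.trans_le hx.1) isCompact_Icc
    have h2 := h1.mul_continuousOn hχ.continuousOn isCompact_Icc
    refine h2.of_forall_sdiff_eq_zero measurableSet_Ioi fun x hx => ?_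
    have : x ∉ tsupport χ := fun h => hx.2 (Ioo_subset_Icc_self (hK h))
    simp [image_eq_zero_of_notMem_tsupport this]
  refine ⟨c, ?_⟩
  have key := isOpen_Ioi.ae_eq_zero_of_integral_contDiff_smul_eq_zero (U := Ioi (0:ℝ)) (μ := volume)
    (f := fun x => u x - c) (hu.sub (locallyIntegrableOn_const c)) ?_
  · filter_upwards [key] with x hx hx0
    linarith [hx hx0]
  intro χ hχ hχc hχp
  set I := ∫ x, χ x with hI
  set χ₁ : ℝ → ℝ := fun x => χ x - I * χ₀ x with hχ₁
  have hχ₁s : ContDiff ℝ ∞ χ₁ := hχ.sub (contDiff_const.mul hχ₀s)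
  have hχ₁i : ∫ x, χ₁ x = 0 := by
    rw [integral_sub (hχ.continuous.integrable_of_hasCompactSupport hχc)
      ((hχ₀s.continuous.integrable_of_hasCompactSupport hχ₀c).const_mul _), integral_const_mul, hχ₀i]
    simp [hI]
  obtain ⟨a, b, ha, ha1, hb1, hK⟩ := exists_Ioo_of_isCompact_subset_Ioi (hχc.union hχ₀c)
    (union_subset hχp hχ₀p)
  have hzero : ∀ x ∉ Ioo a b, χ₁ x = 0 := by
    intro x hx
    have h1 : x ∉ tsupport χ := fun h => hx (hK (Or.inl h))
    have h2 : x ∉ tsupport χ₀ := fun h => hx (hK (Or.inr h))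
    simp [hχ₁, image_eq_zero_of_notMem_tsupport h1, image_eq_zero_of_notMem_tsupport h2]
  -- the primitive of a test function of mean zero is a test function
  set ψ : ℝ → ℝ := fun x => ∫ t in a..x, χ₁ t with hψ
  have hψd : ∀ x, HasDerivAt ψ (χ₁ x) x := fun x =>
    intervalIntegral.integral_hasDerivAt_right (hχ₁s.continuous.intervalIntegrable _ _)
      (hχ₁s.continuous.stronglyMeasurableAtFilter _ _) hχ₁s.continuous.continuousAt
  have hψ' : deriv ψ = χ₁ := funext fun x => (hψd x).deriv
  have hψs : ContDiff ℝ ∞ ψ := by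
    rw [contDiff_infty_iff_deriv, hψ']
    exact ⟨fun x => (hψd x).differentiableAt, hχ₁s⟩
  have hψ0 : ∀ x ∉ Icc a b, ψ x = 0 := by
    intro x hx
    rcases lt_or_ge x a with hxa | hxa
    · simp only [hψ]
      rw [intervalIntegral.integral_symm, intervalIntegral.integral_of_le hxa.le,
        integral_Ioc_eq_integral_Ioo, setIntegral_eq_zero_of_forall_eq_zero, neg_zero]
      exact fun y hy => hzero y fun h => absurd (h.1.trans hy.2) (lt_irrefl _)
    · have hxb : b < x := lt_of_not_ge fun h => hx ⟨hxa, h⟩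
      simp only [hψ]
      rw [intervalIntegral.integral_of_le hxa, ← hχ₁i]
      refine setIntegral_eq_integral_of_forall_compl_eq_zero fun y hy => hzero y fun h => hy ?_
      exact ⟨h.1, h.2.le.trans hxb.le⟩
  have hψt : tsupport ψ ⊆ Icc a b :=
    closure_minimal (fun x hx => by_contra fun hcon => hx (hψ0 x hcon)) isClosed_Icc
  have h0 := h ψ hψs (isCompact_Icc.of_isClosed_subset (isClosed_tsupport _) hψt)
    (hψt.trans fun x hx => ha.trans_le hx.1)
  rw [hψ'] at h0
  have i1 := hint χ hχ.continuous hχc hχp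
  have i2 := hint χ₀ hχ₀s.continuous hχ₀c hχ₀p
  have e1 : ∫ x in Ioi 0, u x * χ₁ x = (∫ x in Ioi 0, u x * χ x) - I * c := by
    rw [hc, ← integral_const_mul, ← integral_sub i1 (i2.const_mul _)]
    refine integral_congr_ae (Eventually.of_forall fun x => ?_)
    simp only [hχ₁]; ring
  have e2 : ∫ x in Ioi 0, χ x = I := by
    refine setIntegral_eq_integral_of_forall_compl_eq_zero fun y hy => ?_
    exact image_eq_zero_of_notMem_tsupport fun h => hy (hχp h)
  have e3 : ∫ x, χ x • (u x - c) = ∫ x in Ioi 0, (u x * χ x - c * χ x) := by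
    rw [← setIntegral_eq_integral_of_forall_compl_eq_zero (s := Ioi (0:ℝ))]
    · refine integral_congr_ae (Eventually.of_forall fun x => ?_)
      simp only [smul_eq_mul]; ring
    · intro x hx
      simp [image_eq_zero_of_notMem_tsupport fun h => hx (hχp h)]
  rw [e3, integral_sub i1 ((hχ.continuous.integrable_of_hasCompactSupport hχc).integrableOn.const_mul _),
    integral_const_mul, e2]
  rw [e1] at h0
  linarith

/-- A function on `(0, ∞)` with locally integrable weak derivative `v` is a primitive of `v`. -/
theorem exists_eq_add_integral_of_weak_deriv {g v : ℝ → ℝ} (hg : LocallyIntegrableOn g (Ioi 0))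
    (hv : ∀ s t, 0 < s → 0 < t → IntervalIntegrable v volume s t)
    (h : ∀ ψ : ℝ → ℝ, ContDiff ℝ ∞ ψ → HasCompactSupport ψ → tsupport ψ ⊆ Ioi 0 →
      ∫ x in Ioi 0, g x * deriv ψ x = - ∫ x in Ioi 0, v x * ψ x) :
    ∃ c, ∀ᵐ x, 0 < x → g x = c + ∫ t in 1..x, v t := by
  set V : ℝ → ℝ := fun x => ∫ t in 1..x, v t with hV
  have hVc : ContinuousOn V (Ioi 0) := by
    refine continuousOn_of_abs_sub_le (w := fun t => |v t|) (fun s t hs ht => (hv s t hs ht).abs) ?_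
    intro s t hs hst
    have := intervalIntegral.integral_add_adjacent_intervals (hv 1 s one_pos hs)
      (hv s t hs (hs.trans_le hst))
    simp only [hV]
    rw [← this, add_sub_cancel_left]
    exact intervalIntegral.abs_integral_le_integral_abs hst
  have hVl : LocallyIntegrableOn V (Ioi 0) := hVc.locallyIntegrableOn measurableSet_Ioi
  suffices hweak : ∀ ψ : ℝ → ℝ, ContDiff ℝ ∞ ψ → HasCompactSupport ψ → tsupport ψ ⊆ Ioi 0 →
      ∫ x in Ioi 0, (g - V) x * deriv ψ x = 0 by
    obtain ⟨c, hc⟩ := exists_const_of_integral_mul_deriv_eq_zero (hg.sub hVl) hweak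
    refine ⟨c, ?_⟩
    filter_upwards [hc] with x hx hx0
    have := hx hx0
    simp only [Pi.sub_apply, hV] at this
    linarith
  intro ψ hψ hψc hψp
  obtain ⟨a, b, ha, ha1, hb1, hK⟩ := exists_Ioo_of_isCompact_subset_Ioi hψc hψp
  have hab : a ≤ b := by linarith
  have hb : 0 < b := by linarith
  have hK' : tsupport (deriv ψ) ⊆ Ioo a b := (tsupport_deriv_subset (𝕜 := ℝ)).trans hK
  have hψa : ψ a = 0 := image_eq_zero_of_notMem_tsupport fun h => lt_irrefl _ (hK h).1
  have hψb : ψ b = 0 := image_eq_zero_of_notMem_tsupport fun h => lt_irrefl _ (hK h).2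
  have h1 := h ψ hψ hψc hψp
  rw [setIntegral_Ioi_eq_of_tsupport ha hab hK', setIntegral_Ioi_eq_of_tsupport ha hab hK] at h1
  rw [setIntegral_Ioi_eq_of_tsupport ha hab hK']
  have hsub : uIcc a b ⊆ Ioi 0 := by
    rw [uIcc_of_le hab]; exact fun x hx => ha.trans_le hx.1
  have hVac : AbsolutelyContinuousOnInterval V a b :=
    (hv a b ha hb).absolutelyContinuousOnInterval_intervalIntegral
      (by rw [uIcc_of_le hab]; exact ⟨ha1.le, hb1.le⟩)
  have hψac : AbsolutelyContinuousOnInterval ψ a b :=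
    (hψ.of_le (by simp)).contDiffOn.absolutelyContinuousOnInterval
  have h2 := hVac.integral_mul_deriv_eq_deriv_mul hψac
  have h3 : ∫ x in a..b, deriv V x * ψ x = ∫ x in a..b, v x * ψ x := by
    refine intervalIntegral.integral_congr_ae ?_
    filter_upwards [(hv a b ha hb).ae_hasDerivAt_integral] with x hx hxab
    rw [(hx (uIoc_subset_uIcc hxab) 1 (by rw [uIcc_of_le hab]; exact ⟨ha1.le, hb1.le⟩)).deriv]
  rw [hψa, hψb, h3] at h2
  have hψ'c : Continuous (deriv ψ) := hψ.continuous_deriv (by simp)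
  have i1 : IntervalIntegrable (fun x => g x * deriv ψ x) volume a b := by
    rw [intervalIntegrable_iff_integrableOn_Icc_of_le hab]
    exact (hg.integrableOn_compact_subset (fun x hx => ha.trans_le hx.1)
      isCompact_Icc).mul_continuousOn hψ'c.continuousOn isCompact_Icc
  have i2 : IntervalIntegrable (fun x => V x * deriv ψ x) volume a b :=
    ((hVc.mono hsub).mul hψ'c.continuousOn).intervalIntegrable
  have : ∫ x in a..b, (g - V) x * deriv ψ x =
      (∫ x in a..b, g x * deriv ψ x) - ∫ x in a..b, V x * deriv ψ x := by
    rw [← intervalIntegral.integral_sub i1 i2]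
    refine intervalIntegral.integral_congr fun x _ => ?_
    simp only [Pi.sub_apply]; ring
  rw [this, h1, h2]
  ring

/-! ### The profile of a radial Sobolev function -/

/-- Polar coordinates for integrable functions. -/
theorem integral_polar_of_finrank {E : Type*} [NormedAddCommGroup E] [NormedSpace ℝ E]
    [FiniteDimensional ℝ E] [Nontrivial E] [MeasurableSpace E] [BorelSpace E] (μ : Measure E)
    [μ.IsAddHaarMeasure] {Ψ : E → ℝ} (hΨ : Integrable Ψ μ) :
    IntegrableOn (fun ρ : ℝ => ρ ^ (Module.finrank ℝ E - 1) * ∫ θ, Ψ (ρ • (θ : E)) ∂μ.toSphere)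
      (Ioi 0) ∧
    ∫ x, Ψ x ∂μ = ∫ ρ in Ioi (0 : ℝ), ρ ^ (Module.finrank ℝ E - 1) *
      ∫ θ, Ψ (ρ • (θ : E)) ∂μ.toSphere := by
  have hmp := μ.measurePreserving_homeomorphUnitSphereProd
  have e3 : ∀ x : ({(0 : E)}ᶜ : Set E),
      ((homeomorphUnitSphereProd E x).2.1 • ((homeomorphUnitSphereProd E x).1 : E)) = x := by
    intro x
    have hx : ‖(x : E)‖ ≠ 0 := norm_ne_zero_iff.2 x.2
    simp [smul_smul, hx]
  have e1 : ∫ x, Ψ x ∂μ = ∫ x : ({(0 : E)}ᶜ : Set E), Ψ x ∂(μ.comap (↑)) := by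
    rw [integral_subtype_comap (measurableSet_singleton _).compl, restrict_compl_singleton]
  have e2 := hmp.integral_comp (Homeomorph.measurableEmbedding _)
    (fun q : sphere (0 : E) 1 × Ioi (0 : ℝ) => Ψ (q.2.1 • (q.1 : E)))
  have i2 := hmp.integrable_comp_emb (Homeomorph.measurableEmbedding _)
    (g := fun q : sphere (0 : E) 1 × Ioi (0 : ℝ) => Ψ (q.2.1 • (q.1 : E)))
  simp only [Function.comp_def, e3] at e2 i2
  have i1 : Integrable (fun x : ({(0 : E)}ᶜ : Set E) => Ψ x) (μ.comap (↑)) := by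
    have := (integrableOn_iff_comap_subtypeVal (μ := μ) (f := Ψ)
      (measurableSet_singleton (0 : E)).compl).1 hΨ.integrableOn
    exact this
  have i3 := i2.1 i1
  have i4 := i3.integral_prod_right
  have hcoe : ∀ ρ : Ioi (0 : ℝ), ENNReal.ofReal (ρ.1 ^ (Module.finrank ℝ E - 1)) =
    ((Real.toNNReal (ρ.1 ^ (Module.finrank ℝ E - 1)) : ℝ≥0) : ℝ≥0∞) := fun ρ => rfl
  have hm : Measurable fun ρ : Ioi (0 : ℝ) =>
    Real.toNNReal (ρ.1 ^ (Module.finrank ℝ E - 1)) :=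
    (measurable_subtype_coe.pow_const _).real_toNNReal
  constructor
  · rw [integrableOn_iff_comap_subtypeVal measurableSet_Ioi]
    rw [Measure.volumeIoiPow] at i4
    simp only [hcoe] at i4
    rw [integrable_withDensity_iff_integrable_smul hm] at i4
    refine i4.congr (Eventually.of_forall fun ρ => ?_)
    have hρ : (0 : ℝ) < ρ := ρ.2
    simp [NNReal.smul_def, Real.coe_toNNReal _ (pow_nonneg hρ.le _)]
  · rw [e1, e2, integral_prod_symm _ i3, Measure.volumeIoiPow]
    simp only [hcoe]
    rw [integral_withDensity_eq_integral_smul hm]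
    rw [← integral_subtype_comap measurableSet_Ioi (fun ρ : ℝ =>
      ρ ^ (Module.finrank ℝ E - 1) * ∫ θ, Ψ (ρ • (θ : E)) ∂μ.toSphere)]
    refine integral_congr_ae (Eventually.of_forall fun ρ => ?_)
    have hρ : (0 : ℝ) < ρ := ρ.2
    simp [NNReal.smul_def, Real.coe_toNNReal _ (pow_nonneg hρ.le _)]

section Profile

variable {n : ℕ} [NeZero n]

/-- The total mass of the surface measure of the unit sphere in `ℝⁿ`. -/
noncomputable def sphereArea (n : ℕ) : ℝ :=
  (volume : Measure (EuclideanSpace ℝ (Fin n))).toSphere.real univ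

theorem sphereArea_eq (n : ℕ) : sphereArea n =
    n * (volume : Measure (EuclideanSpace ℝ (Fin n))).real (ball 0 1) := by
  rw [sphereArea, Measure.toSphere_real_apply_univ, finrank_euclideanSpace_fin]

theorem sphereArea_pos : 0 < sphereArea n := by
  rw [sphereArea_eq]
  have h1 : 0 < (n : ℝ) := by exact_mod_cast Nat.pos_of_ne_zero (NeZero.ne n)
  have h2 : 0 < (volume : Measure (EuclideanSpace ℝ (Fin n))).real (ball 0 1) :=
    ENNReal.toReal_pos (measure_ball_pos _ _ one_pos).ne' measure_ball_lt_top.ne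
  positivity

theorem integral_norm_eq (g : ℝ → ℝ) : ∫ x : EuclideanSpace ℝ (Fin n), g ‖x‖ =
    sphereArea n * ∫ ρ in Ioi (0 : ℝ), ρ ^ (n - 1) * g ρ := by
  rw [integral_fun_norm_addHaar, finrank_euclideanSpace_fin, sphereArea_eq]
  simp [mul_assoc]

theorem integrable_norm_iff (g : ℝ → ℝ) : Integrable (fun x : EuclideanSpace ℝ (Fin n) => g ‖x‖) ↔
    IntegrableOn (fun ρ => ρ ^ (n - 1) * g ρ) (Ioi 0) := by
  rw [integrable_fun_norm_addHaar, finrank_euclideanSpace_fin]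
  rfl

theorem integral_polar {Ψ : EuclideanSpace ℝ (Fin n) → ℝ} (hΨ : Integrable Ψ) :
    IntegrableOn (fun ρ : ℝ => ρ ^ (n - 1) * ∫ θ, Ψ (ρ • (θ : EuclideanSpace ℝ (Fin n)))
      ∂(volume : Measure (EuclideanSpace ℝ (Fin n))).toSphere) (Ioi 0) ∧
    ∫ x, Ψ x = ∫ ρ in Ioi (0 : ℝ), ρ ^ (n - 1) * ∫ θ, Ψ (ρ • (θ : EuclideanSpace ℝ (Fin n)))
      ∂(volume : Measure (EuclideanSpace ℝ (Fin n))).toSphere := by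
  have := integral_polar_of_finrank volume hΨ
  rwa [finrank_euclideanSpace_fin] at this

/-- Testing the weak gradient of `f` with the radial field `ψ(|x|) |x|⁻ⁿ x`, whose divergence is
`ψ'(|x|) |x|¹⁻ⁿ`; it is smooth because `ψ` vanishes near zero. -/
theorem integral_radial_test {f : EuclideanSpace ℝ (Fin n) → ℝ}
    {F : EuclideanSpace ℝ (Fin n) → EuclideanSpace ℝ (Fin n)} (hF : HasWeakGradient f F)
    {ψ : ℝ → ℝ} (hψ : ContDiff ℝ ∞ ψ) (hψc : HasCompactSupport ψ) (hψp : tsupport ψ ⊆ Ioi 0) :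
    ∫ x, f x * (deriv ψ ‖x‖ / ‖x‖ ^ (n - 1)) =
      - ∫ x, inner ℝ (F x) x / ‖x‖ * (ψ ‖x‖ / ‖x‖ ^ (n - 1)) := by
  obtain ⟨a, b, ha, ha1, hb1, hK⟩ := exists_Ioo_of_isCompact_subset_Ioi hψc hψp
  set χ : ℝ → ℝ := fun ρ => ψ ρ / ρ ^ n with hχ
  set c : EuclideanSpace ℝ (Fin n) → ℝ := fun x => χ ‖x‖ with hc
  have hψ0 : ∀ ρ ∉ Ioo a b, ψ ρ = 0 := fun ρ hρ =>
    image_eq_zero_of_notMem_tsupport fun h => hρ (hK h)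
  have hχs : ∀ ρ, 0 < ρ → ContDiffAt ℝ ∞ χ ρ := fun ρ hρ =>
    hψ.contDiffAt.div (contDiffAt_id.pow n) (pow_ne_zero _ hρ.ne')
  have hcs : ContDiff ℝ ∞ c := by
    rw [contDiff_iff_contDiffAt]
    intro x
    rcases eq_or_ne x 0 with rfl | hx
    · refine (contDiffAt_const (c := (0 : ℝ))).congr_of_eventuallyEq ?_
      filter_upwards [ball_mem_nhds _ ha] with y hy
      rw [mem_ball_zero_iff] at hy
      simp [hc, hχ, hψ0 ‖y‖ fun h => absurd (h.1.trans hy) (lt_irrefl _)]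
    · exact (hχs _ (norm_pos_iff.2 hx)).comp x (contDiffAt_norm ℝ hx)
  have hcc : HasCompactSupport c := by
    refine HasCompactSupport.intro (isCompact_closedBall 0 b) fun x hx => ?_
    rw [mem_closedBall_zero_iff, not_le] at hx
    simp [hc, hχ, hψ0 ‖x‖ fun h => absurd (h.2.trans hx) (lt_irrefl _)]
  have hi : ∀ i : Fin n, ContDiff ℝ ∞ fun x : EuclideanSpace ℝ (Fin n) => x i := fun i =>
    (EuclideanSpace.proj (𝕜 := ℝ) i).contDiff
  set φ : Fin n → EuclideanSpace ℝ (Fin n) → ℝ := fun i x => c x * x i with hφ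
  have hφs : ∀ i, ContDiff ℝ ∞ (φ i) := fun i => hcs.mul (hi i)
  have hφc : ∀ i, HasCompactSupport (φ i) := fun i => hcc.mul_right
  have hE := fun i => hF.integral_eq (φ i) (hφs i) (hφc i) i
  have hdiv : ∀ x : EuclideanSpace ℝ (Fin n), x ≠ 0 →
      ∑ i, fderiv ℝ (φ i) x (EuclideanSpace.single i 1) = deriv ψ ‖x‖ / ‖x‖ ^ (n - 1) := by
    intro x hx
    have hx0 : 0 < ‖x‖ := norm_pos_iff.2 hx
    have hd : HasDerivAt χ ((deriv ψ ‖x‖ * ‖x‖ ^ n - ψ ‖x‖ * (n * ‖x‖ ^ (n - 1))) / (‖x‖ ^ n) ^ 2)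
        ‖x‖ := by
      have h1 : HasDerivAt ψ (deriv ψ ‖x‖) ‖x‖ := ((hψ.differentiable (by simp)) _).hasDerivAt
      exact h1.div (hasDerivAt_pow n ‖x‖) (pow_ne_zero _ hx0.ne')
    have hcd := hd.comp_hasFDerivAt x (hasFDerivAt_norm_of_ne_zero hx)
    have hterm : ∀ i, fderiv ℝ (φ i) x (EuclideanSpace.single i 1) =
        c x + ((deriv ψ ‖x‖ * ‖x‖ ^ n - ψ ‖x‖ * (n * ‖x‖ ^ (n - 1))) / (‖x‖ ^ n) ^ 2) *
          ‖x‖⁻¹ * (x i) ^ 2 := by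
      intro i
      have h2 : HasFDerivAt (fun x : EuclideanSpace ℝ (Fin n) => x i)
          (EuclideanSpace.proj (𝕜 := ℝ) i) x := (EuclideanSpace.proj (𝕜 := ℝ) i).hasFDerivAt
      have h3 : HasFDerivAt (φ i) _ x := hcd.mul h2
      rw [h3.fderiv]
      simp [EuclideanSpace.inner_single_right, hc]
      ring
    simp only [hterm, Finset.sum_add_distrib, ← Finset.mul_sum]
    have hsq : ∑ i, (x i) ^ 2 = ‖x‖ ^ 2 := by
      rw [EuclideanSpace.real_norm_sq_eq]
    rw [hsq]
    obtain ⟨k, rfl⟩ : ∃ k, n = k + 1 := ⟨n - 1, (Nat.succ_pred (NeZero.ne n)).symm⟩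
    simp only [Finset.sum_const, Finset.card_univ, Fintype.card_fin, nsmul_eq_mul, hc, hχ,
      Nat.add_sub_cancel]
    field_simp
    ring
  have hsum1 : ∑ i, ∫ x, f x * fderiv ℝ (φ i) x (EuclideanSpace.single i 1) =
      ∫ x, f x * (deriv ψ ‖x‖ / ‖x‖ ^ (n - 1)) := by
    rw [← integral_finsetSum]
    · refine integral_congr_ae ?_
      filter_upwards [Measure.ae_ne volume (0 : EuclideanSpace ℝ (Fin n))] with x hx
      rw [← Finset.mul_sum, hdiv x hx]
    · intro i _
      have h1 : Continuous fun x => fderiv ℝ (φ i) x (EuclideanSpace.single i 1) :=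
        ((hφs i).continuous_fderiv (by simp)).clm_apply continuous_const
      have := hF.locallyIntegrable.integrable_smul_left_of_hasCompactSupport h1
        ((hφc i).fderiv_apply ℝ _)
      exact this.congr (Eventually.of_forall fun x => by simp [mul_comm])
  have hsum2 : ∑ i, ∫ x, F x i * φ i x =
      ∫ x, inner ℝ (F x) x / ‖x‖ * (ψ ‖x‖ / ‖x‖ ^ (n - 1)) := by
    rw [← integral_finsetSum]
    · refine integral_congr_ae ?_
      filter_upwards [Measure.ae_ne volume (0 : EuclideanSpace ℝ (Fin n))] with x hx
      have hx0 : 0 < ‖x‖ := norm_pos_iff.2 hx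
      have : ∑ i, F x i * φ i x = inner ℝ (F x) x * c x := by
        rw [PiLp.inner_apply, Finset.sum_mul]
        refine Finset.sum_congr rfl fun i _ => ?_
        simp [hφ]; ring
      rw [this]
      obtain ⟨k, rfl⟩ : ∃ k, n = k + 1 := ⟨n - 1, (Nat.succ_pred (NeZero.ne n)).symm⟩
      simp only [hc, hχ, Nat.add_sub_cancel]
      field_simp
      ring
    · intro i _
      have h1 := hF.locallyIntegrable_gradient.integrable_smul_left_of_hasCompactSupport
        (hφs i).continuous (hφc i)
      have h2 := (EuclideanSpace.proj (𝕜 := ℝ) i : EuclideanSpace ℝ (Fin n) →L[ℝ] ℝ).integrable_comp h1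
      exact h2.congr (Eventually.of_forall fun x => by simp [mul_comm])
  rw [← hsum1, ← hsum2, ← Finset.sum_neg_distrib]
  exact Finset.sum_congr rfl fun i _ => hE i

/-- A radial `W^{1,1}` function has a profile whose increments are controlled by a weight `w`; the
weight is the absolute value of the spherical mean of the radial part of the gradient. -/
theorem exists_profile {f : EuclideanSpace ℝ (Fin n) → ℝ}
    {F : EuclideanSpace ℝ (Fin n) → EuclideanSpace ℝ (Fin n)} (hf : Integrable f)
    (hrad : IsRadial f) (hF : HasWeakGradient f F) (hFi : Integrable F) :
    ∃ g w : ℝ → ℝ, (∀ᵐ x, f x = g ‖x‖) ∧ Measurable w ∧ (∀ t, 0 ≤ w t) ∧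
      IntegrableOn (fun ρ => ρ ^ (n - 1) * w ρ) (Ioi 0) ∧
      (∀ s t, 0 < s → s ≤ t → |g t - g s| ≤ ∫ u in s..t, w u) ∧
      sphereArea n * ∫ ρ in Ioi (0 : ℝ), ρ ^ (n - 1) * w ρ ≤ ∫ x, ‖F x‖ := by
  obtain ⟨g₀, hg₀⟩ := hrad
  set σ := (volume : Measure (EuclideanSpace ℝ (Fin n))).toSphere
  have hg₀i : IntegrableOn (fun ρ => ρ ^ (n - 1) * g₀ ρ) (Ioi 0) :=
    (integrable_norm_iff g₀).1 (hf.congr hg₀)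
  set Ψ : EuclideanSpace ℝ (Fin n) → ℝ := fun x => inner ℝ (F x) x / ‖x‖ with hΨ
  have hΨle : ∀ x, ‖Ψ x‖ ≤ ‖F x‖ := by
    intro x
    rw [hΨ, norm_div, norm_norm]
    rcases eq_or_ne x 0 with rfl | hx
    · simp
    · rw [div_le_iff₀ (norm_pos_iff.2 hx)]
      exact norm_inner_le_norm _ _
  have hΨi : Integrable Ψ := by
    refine hFi.mono ?_ (Eventually.of_forall hΨle)
    exact (hFi.1.inner aestronglyMeasurable_id).div₀
      continuous_norm.aestronglyMeasurable
  obtain ⟨hκi, -⟩ := integral_polar hΨi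
  set κ : ℝ → ℝ := fun ρ => ∫ θ, Ψ (ρ • (θ : EuclideanSpace ℝ (Fin n))) ∂σ with hκ
  have hS : 0 < sphereArea n := sphereArea_pos
  -- a measurable version of the spherical mean
  have hκm : AEStronglyMeasurable κ (volume.restrict (Ioi 0)) := by
    have h1 : AEStronglyMeasurable (fun ρ : ℝ => (ρ ^ (n - 1))⁻¹ * (ρ ^ (n - 1) * κ ρ))
      (volume.restrict (Ioi 0)) :=
      ((measurable_id.pow_const _).inv.aestronglyMeasurable).mul hκi.1
    refine h1.congr ?_
    filter_upwards [ae_restrict_mem measurableSet_Ioi] with ρ hρ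
    have hρ : 0 < ρ := hρ
    field_simp
  set k := hκm.mk κ with hk
  have hkm : Measurable k := hκm.stronglyMeasurable_mk.measurable
  have hkκ : κ =ᵐ[volume.restrict (Ioi 0)] k := hκm.ae_eq_mk
  set v : ℝ → ℝ := fun ρ => k ρ / sphereArea n with hv
  have hvi : IntegrableOn (fun ρ => ρ ^ (n - 1) * v ρ) (Ioi 0) := by
    have : IntegrableOn (fun ρ : ℝ => ρ ^ (n - 1) * κ ρ / sphereArea n) (Ioi 0) :=
      Integrable.div_const hκi _
    refine this.congr ?_
    filter_upwards [hkκ] with ρ hρ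
    rw [hv, hρ]; ring
  have hvii : ∀ s t, 0 < s → 0 < t → IntervalIntegrable v volume s t := fun s t hs ht =>
    intervalIntegrable_of_weight hvi hs ht
  have hgl : LocallyIntegrableOn g₀ (Ioi 0) := by
    rw [locallyIntegrableOn_iff isOpen_Ioi.isLocallyClosed]
    intro K hK hKc
    obtain ⟨a, b, ha, ha1, hb1, hKab⟩ := exists_Ioo_of_isCompact_subset_Ioi hKc hK
    have := (intervalIntegrable_iff_integrableOn_Ioo_of_le (by linarith)).1
      (intervalIntegrable_of_weight hg₀i ha (ha.trans (ha1.trans hb1)))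
    exact this.mono_set hKab
  obtain ⟨c, hc⟩ := exists_eq_add_integral_of_weak_deriv hgl hvii (by
    intro ψ hψ hψc hψp
    have h1 := integral_radial_test hF hψ hψc hψp
    obtain ⟨a, b, ha, ha1, hb1, hK⟩ := exists_Ioo_of_isCompact_subset_Ioi hψc hψp
    have e1 : ∫ x, f x * (deriv ψ ‖x‖ / ‖x‖ ^ (n - 1)) =
        sphereArea n * ∫ x in Ioi 0, g₀ x * deriv ψ x := by
      have : ∫ x, f x * (deriv ψ ‖x‖ / ‖x‖ ^ (n - 1)) =
          ∫ x : EuclideanSpace ℝ (Fin n), g₀ ‖x‖ * (deriv ψ ‖x‖ / ‖x‖ ^ (n - 1)) := by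
        refine integral_congr_ae ?_
        filter_upwards [hg₀] with x hx
        rw [hx]
      rw [this, integral_norm_eq fun ρ => g₀ ρ * (deriv ψ ρ / ρ ^ (n - 1))]
      congr 1
      refine setIntegral_congr_fun measurableSet_Ioi fun ρ hρ => ?_
      have hρ : 0 < ρ := hρ
      field_simp
    have i2 : Integrable fun x => Ψ x * (ψ ‖x‖ / ‖x‖ ^ (n - 1)) := by
      obtain ⟨C, hC⟩ := hψc.exists_bound_of_continuous hψ.continuous
      refine (hΨi.mul_const (C / a ^ (n - 1))).mono ?_ (Eventually.of_forall fun x => ?_)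
      · refine hΨi.1.mul ?_
        exact ((hψ.continuous.measurable.comp measurable_norm).div
          (measurable_norm.pow_const _)).aestronglyMeasurable
      · rw [norm_mul, norm_mul]
        refine mul_le_mul_of_nonneg_left ?_ (norm_nonneg _)
        have hC0 : 0 ≤ C := (norm_nonneg _).trans (hC 0)
        rw [Real.norm_of_nonneg (by positivity : 0 ≤ C / a ^ (n - 1))]
        by_cases hx : ‖x‖ ∈ Ioo a b
        · rw [norm_div, norm_pow, norm_norm]
          gcongr
          · exact hC _
          · exact hx.1.le
        · rw [image_eq_zero_of_notMem_tsupport (f := ψ) fun h => hx (hK h)]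
          simp only [zero_div, norm_zero]
          positivity
    have e2 : ∫ x, Ψ x * (ψ ‖x‖ / ‖x‖ ^ (n - 1)) = ∫ ρ in Ioi 0, k ρ * ψ ρ := by
      rw [(integral_polar i2).2]
      refine integral_congr_ae ?_
      filter_upwards [hkκ, ae_restrict_mem measurableSet_Ioi] with ρ hρ hρ0
      have hρ0 : 0 < ρ := hρ0
      have : ∀ θ : sphere (0 : EuclideanSpace ℝ (Fin n)) 1,
          ‖ρ • (θ : EuclideanSpace ℝ (Fin n))‖ = ρ := fun θ => by
        rw [norm_smul, norm_eq_of_mem_sphere, mul_one, Real.norm_of_nonneg hρ0.le]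
      simp only [this]
      rw [integral_mul_const, ← hρ]
      simp only [hκ]
      field_simp
      exact mul_comm _ _
    rw [e1, e2] at h1
    have e3 : ∫ x in Ioi 0, v x * ψ x = (∫ ρ in Ioi 0, k ρ * ψ ρ) / sphereArea n := by
      rw [← integral_div]
      refine integral_congr_ae (Eventually.of_forall fun ρ => ?_)
      simp only [hv]; ring
    rw [e3]
    field_simp
    linarith)
  set g : ℝ → ℝ := fun ρ => c + ∫ t in 1..ρ, v t with hg
  refine ⟨g, fun ρ => |v ρ|, ?_, (hkm.div_const _).abs, fun t => abs_nonneg _, ?_, ?_, ?_⟩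
  · filter_upwards [hg₀, ae_norm_of_ae (n := n) (Q := fun ρ => g₀ ρ = g ρ) hc] with x h1 h2
    rw [h1, h2]
  · refine IntegrableOn.congr_fun (f := fun ρ => |ρ ^ (n - 1) * v ρ|) hvi.abs (fun x hx => ?_)
      measurableSet_Ioi
    have : 0 < x := hx
    simp [abs_mul, abs_of_pos this]
  · intro s t hs hst
    have := intervalIntegral.integral_add_adjacent_intervals (hvii 1 s one_pos hs)
      (hvii s t hs (hs.trans_le hst))
    simp only [hg]
    rw [← this]
    have e : c + ((∫ x in 1..s, v x) + ∫ x in s..t, v x) - (c + ∫ x in 1..s, v x) =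
      ∫ x in s..t, v x := by ring
    rw [e]
    exact intervalIntegral.abs_integral_le_integral_abs hst
  · obtain ⟨j1, j2⟩ := integral_polar hΨi.norm
    refine le_trans ?_ (integral_mono hΨi.norm hFi.norm hΨle)
    rw [j2, ← integral_const_mul]
    refine integral_mono_of_nonneg ?_ j1 ?_
    · filter_upwards [ae_restrict_mem measurableSet_Ioi] with ρ hρ
      have hρ : 0 < ρ := hρ
      positivity
    · filter_upwards [hkκ, ae_restrict_mem measurableSet_Ioi] with ρ hρ hρ0
      have hρ0 : 0 < ρ := hρ0
      have e : sphereArea n * (ρ ^ (n - 1) * |v ρ|) = ρ ^ (n - 1) * |κ ρ| := by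
        rw [hρ, hv, abs_div, abs_of_pos hS]
        field_simp
      rw [e]
      have hle : |κ ρ| ≤ ∫ θ, ‖Ψ (ρ • (θ : EuclideanSpace ℝ (Fin n)))‖ ∂σ :=
        norm_integral_le_integral_norm fun θ : sphere (0 : EuclideanSpace ℝ (Fin n)) 1 =>
          Ψ (ρ • (θ : EuclideanSpace ℝ (Fin n)))
      exact mul_le_mul_of_nonneg_left hle (by positivity)

end Profile

/-! ### Averages of radial functions over dilated balls -/

/-- `p` is a nonnegative profile with `p(|x|)` integrable on `ℝⁿ`, whose increments on `(0, ∞)` are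
controlled by the weight `w`, with `w(|x|)` integrable on `ℝⁿ`. -/
structure IsSobolevProfile (n : ℕ) (p w : ℝ → ℝ) : Prop where
  nonneg : ∀ t, 0 ≤ p t
  integrable : IntegrableOn (fun ρ => ρ ^ (n - 1) * p ρ) (Ioi 0)
  weight_measurable : Measurable w
  weight_nonneg : ∀ t, 0 ≤ w t
  weight_integrable : IntegrableOn (fun ρ => ρ ^ (n - 1) * w ρ) (Ioi 0)
  abs_sub_le : ∀ s t, 0 < s → s ≤ t → |p t - p s| ≤ ∫ u in s..t, w u

/-- The average of the radial function with profile `p` over the ball `B(z, r)`. -/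
noncomputable def ballAvg {n : ℕ} (p : ℝ → ℝ) (z : EuclideanSpace ℝ (Fin n)) (r : ℝ) : ℝ :=
  ⨍ y in ball z r, p ‖y‖

/-- The truncated moment `∫₀ᴿ sⁿ w(s) ds`. -/
noncomputable def truncMoment (n : ℕ) (w : ℝ → ℝ) (R : ℝ) : ℝ := ∫ s in Ioc 0 R, s ^ n * w s

namespace IsSobolevProfile

variable {n : ℕ} {p w : ℝ → ℝ}

theorem intervalIntegrable (h : IsSobolevProfile n p w) {s t : ℝ} (hs : 0 < s) (ht : 0 < t) :
    IntervalIntegrable w volume s t := intervalIntegrable_of_weight h.weight_integrable hs ht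

theorem continuousOn (h : IsSobolevProfile n p w) : ContinuousOn p (Ioi 0) :=
  continuousOn_of_abs_sub_le (fun _ _ hs ht => h.intervalIntegrable hs ht) h.abs_sub_le

theorem ofReal_intervalIntegral (h : IsSobolevProfile n p w) {s t : ℝ} (hs : 0 < s) (hst : s ≤ t) :
    ENNReal.ofReal (∫ u in s..t, w u) = ∫⁻ u in Ioc s t, ENNReal.ofReal (w u) := by
  rw [intervalIntegral.integral_of_le hst, ofReal_integral_eq_lintegral_ofReal]
  · exact (intervalIntegrable_iff_integrableOn_Ioc_of_le hst).1
      (h.intervalIntegrable hs (hs.trans_le hst))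
  · exact Eventually.of_forall h.weight_nonneg

theorem pow_mul_weight_eq [NeZero n] (s : ℝ) : s ^ n * w s = s * (s ^ (n - 1) * w s) := by
  obtain ⟨k, rfl⟩ : ∃ k, n = k + 1 := ⟨n - 1, (Nat.succ_pred (NeZero.ne n)).symm⟩
  simp only [Nat.add_sub_cancel]; ring

theorem integrableOn_moment [NeZero n] (h : IsSobolevProfile n p w) (R : ℝ) :
    IntegrableOn (fun s => s ^ n * w s) (Ioc 0 R) := by
  refine ((h.weight_integrable.mono_set Ioc_subset_Ioi_self).const_mul R).mono ?_ ?_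
  · exact ((measurable_id.pow_const _).mul h.weight_measurable).aestronglyMeasurable
  · filter_upwards [ae_restrict_mem measurableSet_Ioc] with s hs
    rw [pow_mul_weight_eq, norm_mul, norm_mul R]
    refine mul_le_mul_of_nonneg_right ?_ (norm_nonneg _)
    rw [Real.norm_of_nonneg hs.1.le]
    exact hs.2.trans (le_abs_self _)

theorem truncMoment_nonneg (h : IsSobolevProfile n p w) (R : ℝ) : 0 ≤ truncMoment n w R :=
  setIntegral_nonneg measurableSet_Ioc fun s hs =>
    mul_nonneg (pow_nonneg hs.1.le _) (h.weight_nonneg s)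

theorem truncMoment_le [NeZero n] (h : IsSobolevProfile n p w) {R : ℝ} (hR : 0 ≤ R) :
    truncMoment n w R ≤ R * ∫ s in Ioi (0 : ℝ), s ^ (n - 1) * w s := by
  rw [truncMoment]
  calc ∫ s in Ioc 0 R, s ^ n * w s ≤ ∫ s in Ioc 0 R, R * (s ^ (n - 1) * w s) := by
        refine setIntegral_mono_on (h.integrableOn_moment R)
          ((h.weight_integrable.mono_set Ioc_subset_Ioi_self).const_mul R) measurableSet_Ioc ?_
        intro s hs
        rw [pow_mul_weight_eq]
        exact mul_le_mul_of_nonneg_right hs.2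
          (mul_nonneg (pow_nonneg hs.1.le _) (h.weight_nonneg s))
    _ = R * ∫ s in Ioc 0 R, s ^ (n - 1) * w s := integral_const_mul _ _
    _ ≤ _ := by
        refine mul_le_mul_of_nonneg_left ?_ hR
        refine setIntegral_mono_set h.weight_integrable ?_ Ioc_subset_Ioi_self.eventuallyLE
        filter_upwards [ae_restrict_mem measurableSet_Ioi] with s hs
        exact mul_nonneg (pow_nonneg (le_of_lt hs) _) (h.weight_nonneg s)

/-- A region containing the pairs `(t, s)` with `s` between `t` and `c * t`, for `1 / 2 ≤ c ≤ 2`. For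
fixed `s` its section is contained in an interval around `s` of length `4 * |c - 1| * s`. -/
def dilationRegion (c : ℝ) : Set (ℝ × ℝ) :=
  {q | |q.1 - q.2| ≤ 2 * |c - 1| * q.2 ∧ q.1 ≤ 2 * q.2 ∧ q.2 ≤ 2 * q.1}

theorem measurableSet_dilationRegion (c : ℝ) : MeasurableSet (dilationRegion c) := by
  refine IsClosed.measurableSet ?_
  simp only [dilationRegion, ofPred_and]
  exact (isClosed_le (by fun_prop) (by fun_prop)).inter
    ((isClosed_le (by fun_prop) (by fun_prop)).inter (isClosed_le (by fun_prop) (by fun_prop)))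

/-- The increment `p (c * t) - p t` is controlled by `w` over the section of `dilationRegion c` at `t`,
in a form to which Tonelli's theorem applies. -/
theorem ofReal_abs_dilation_sub_le (h : IsSobolevProfile n p w) {c t : ℝ} (ht : 0 < t)
    (hc : 1 / 2 ≤ c) (hc2 : c ≤ 2) : ENNReal.ofReal |p (c * t) - p t| ≤
      ∫⁻ s in Ioi (0 : ℝ), (dilationRegion c).indicator 1 (t, s) * ENNReal.ofReal (w s) := by
  have hc0 : 0 < c := by linarith
  have hct : 0 < c * t := by positivity
  -- `u, v` are `t, c * t` in increasing order
  obtain ⟨u, v, hu, huv, hpuv, hmem⟩ : ∃ u v, 0 < u ∧ u ≤ v ∧ |p (c * t) - p t| = |p v - p u| ∧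
      ∀ s ∈ Ioc u v, |t - s| ≤ 2 * |c - 1| * s ∧ t ≤ 2 * s ∧ s ≤ 2 * t := by
    rcases le_total 1 c with h1 | h1
    · refine ⟨t, c * t, ht, by nlinarith, rfl, fun s hs =>
        ⟨?_, by linarith [hs.1], by nlinarith [hs.2]⟩⟩
      rw [abs_of_nonneg (by linarith : 0 ≤ c - 1), abs_sub_comm, abs_of_nonneg (by linarith [hs.1])]
      nlinarith [hs.1, hs.2, mul_nonneg (by linarith : 0 ≤ c - 1) (by linarith [hs.1] : 0 ≤ s - t)]
    · refine ⟨c * t, t, hct, by nlinarith, abs_sub_comm _ _, fun s hs =>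
        ⟨?_, by nlinarith [hs.1], by linarith [hs.2]⟩⟩
      rw [abs_of_nonpos (by linarith : c - 1 ≤ 0), abs_of_nonneg (by linarith [hs.2])]
      have h2 : t ≤ 2 * s := by nlinarith [hs.1]
      nlinarith [hs.1, hs.2, mul_nonneg (by linarith : 0 ≤ 1 - c) (by linarith : 0 ≤ 2 * s - t)]
  rw [hpuv]
  refine (ENNReal.ofReal_le_ofReal (h.abs_sub_le u v hu huv)).trans ?_
  rw [h.ofReal_intervalIntegral hu huv]
  calc ∫⁻ s in Ioc u v, ENNReal.ofReal (w s)
      ≤ ∫⁻ s in Ioc u v, (dilationRegion c).indicator 1 (t, s) * ENNReal.ofReal (w s) := by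
        refine setLIntegral_mono' measurableSet_Ioc fun s hs => ?_
        rw [indicator_of_mem (show (t, s) ∈ dilationRegion c from hmem s hs)]
        simp
    _ ≤ _ := lintegral_mono_set fun s hs => hu.trans hs.1

variable [NeZero n]

/-- Weighted `L¹` continuity of the dilations of a profile. -/
theorem lintegral_dilation_sub_le (h : IsSobolevProfile n p w) {c R : ℝ} (hc : 1 / 2 ≤ c)
    (hc2 : c ≤ 2) :
    ∫⁻ t in Ioo 0 R, ENNReal.ofReal (t ^ (n - 1)) * ENNReal.ofReal |p (c * t) - p t| ≤
      ENNReal.ofReal (2 ^ (n + 1) * |c - 1| * truncMoment n w (2 * R)) := by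
  have hA := measurableSet_dilationRegion c
  have hwm := h.weight_measurable
  set k : ℝ → ℝ → ℝ≥0∞ := fun t s => ENNReal.ofReal (t ^ (n - 1)) *
    ((dilationRegion c).indicator 1 (t, s) * ENNReal.ofReal (w s)) with hk
  have hkm : Measurable (Function.uncurry k) := by
    refine Measurable.mul (by fun_prop) (Measurable.mul ?_ (by fun_prop))
    exact measurable_one.indicator hA
  calc ∫⁻ t in Ioo 0 R, ENNReal.ofReal (t ^ (n - 1)) * ENNReal.ofReal |p (c * t) - p t|
      ≤ ∫⁻ t in Ioo 0 R, ∫⁻ s in Ioi 0, k t s := by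
        refine setLIntegral_mono' measurableSet_Ioo fun t ht => ?_
        simp only [hk]
        rw [lintegral_const_mul']
        · gcongr
          exact h.ofReal_abs_dilation_sub_le ht.1 hc hc2
        · exact ENNReal.ofReal_ne_top
    _ = ∫⁻ s in Ioi 0, ∫⁻ t in Ioo 0 R, k t s := lintegral_lintegral_swap hkm.aemeasurable
    _ ≤ ∫⁻ s in Ioi 0, (Ioc 0 (2 * R)).indicator
          (fun s => ENNReal.ofReal (2 ^ (n + 1) * |c - 1| * (s ^ n * w s))) s := by
        refine setLIntegral_mono' measurableSet_Ioi fun s hs => ?_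
        have hs0 : 0 < s := hs
        have hws := h.weight_nonneg s
        by_cases hsR : s ≤ 2 * R
        · rw [indicator_of_mem (show s ∈ Ioc 0 (2 * R) from ⟨hs0, hsR⟩)]
          calc ∫⁻ t in Ioo 0 R, k t s
              ≤ ∫⁻ t in Ioo 0 R, (closedBall s (2 * |c - 1| * s)).indicator
                (fun _ => ENNReal.ofReal ((2 * s) ^ (n - 1) * w s)) t := by
                refine setLIntegral_mono' measurableSet_Ioo fun t ht => ?_
                by_cases hts : (t, s) ∈ dilationRegion c
                · have hb : t ∈ closedBall s (2 * |c - 1| * s) := hts.1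
                  simp only [hk]
                  rw [indicator_of_mem hts, indicator_of_mem hb, Pi.one_apply, one_mul,
                    ← ENNReal.ofReal_mul (pow_nonneg ht.1.le _)]
                  refine ENNReal.ofReal_le_ofReal (mul_le_mul_of_nonneg_right ?_ hws)
                  exact pow_le_pow_left₀ ht.1.le hts.2.1 _
                · simp only [hk]
                  rw [indicator_of_notMem hts]
                  simp
            _ ≤ ∫⁻ t, (closedBall s (2 * |c - 1| * s)).indicator
                (fun _ => ENNReal.ofReal ((2 * s) ^ (n - 1) * w s)) t := setLIntegral_le_lintegral _ _
            _ = ENNReal.ofReal (2 ^ (n + 1) * |c - 1| * (s ^ n * w s)) := by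
                rw [lintegral_indicator_const measurableSet_closedBall, Real.volume_closedBall,
                  ← ENNReal.ofReal_mul (by positivity)]
                congr 1
                obtain ⟨j, rfl⟩ : ∃ j, n = j + 1 := ⟨n - 1, (Nat.succ_pred (NeZero.ne n)).symm⟩
                simp only [Nat.add_sub_cancel]
                ring
        · rw [indicator_of_notMem fun hmem => hsR hmem.2]
          refine le_of_eq (setLIntegral_eq_zero measurableSet_Ioo fun t ht => ?_)
          simp only [hk, Pi.zero_apply]
          rw [indicator_of_notMem fun hmem => hsR (hmem.2.2.trans (by linarith [ht.2]))]
          simp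
    _ = ENNReal.ofReal (2 ^ (n + 1) * |c - 1| * truncMoment n w (2 * R)) := by
        rw [lintegral_indicator measurableSet_Ioc, Measure.restrict_restrict measurableSet_Ioc,
          inter_eq_self_of_subset_left Ioc_subset_Ioi_self, truncMoment, ← integral_const_mul,
          ofReal_integral_eq_lintegral_ofReal]
        · exact (h.integrableOn_moment _).const_mul _
        · filter_upwards [ae_restrict_mem measurableSet_Ioc] with s hs
          have := h.weight_nonneg s
          have := hs.1.le
          positivity

theorem integrable_norm (h : IsSobolevProfile n p w) :
    Integrable fun y : EuclideanSpace ℝ (Fin n) => p ‖y‖ := (integrable_norm_iff p).2 h.integrable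

theorem integrable_dilation (h : IsSobolevProfile n p w) {c : ℝ} (hc : 0 < c) :
    Integrable fun y : EuclideanSpace ℝ (Fin n) => p (c * ‖y‖) := by
  have := h.integrable_norm.comp_smul hc.ne'
  simpa [norm_smul, abs_of_pos hc] using this

theorem setIntegral_dilation_sub_le (h : IsSobolevProfile n p w) {c R : ℝ} (hc : 1 / 2 ≤ c)
    (hc2 : c ≤ 2) :
    ∫ y in ball (0 : EuclideanSpace ℝ (Fin n)) R, |p (c * ‖y‖) - p ‖y‖| ≤
      sphereArea n * (2 ^ (n + 1) * |c - 1| * truncMoment n w (2 * R)) := by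
  have hc0 : 0 < c := by linarith
  have e1 : ∫ y in ball (0 : EuclideanSpace ℝ (Fin n)) R, |p (c * ‖y‖) - p ‖y‖| =
      ∫ y : EuclideanSpace ℝ (Fin n), (Iio R).indicator (fun t => |p (c * t) - p t|) ‖y‖ := by
    rw [← integral_indicator measurableSet_ball]
    refine integral_congr_ae (Eventually.of_forall fun y => ?_)
    by_cases hy : ‖y‖ < R <;> simp [indicator, hy]
  rw [e1, integral_norm_eq]
  refine mul_le_mul_of_nonneg_left ?_ sphereArea_pos.le
  have hcont : ContinuousOn (fun t => |p (c * t) - p t|) (Ioi 0) := by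
    refine ((h.continuousOn.comp (by fun_prop) fun t ht => ?_).sub h.continuousOn).abs
    exact mul_pos hc0 ht
  have e2 : ∫ t in Ioi 0, t ^ (n - 1) * (Iio R).indicator (fun t => |p (c * t) - p t|) t =
      ∫ t in Ioo 0 R, t ^ (n - 1) * |p (c * t) - p t| := by
    rw [← Ioi_inter_Iio, ← setIntegral_indicator measurableSet_Iio]
    refine integral_congr_ae (Eventually.of_forall fun t => ?_)
    by_cases ht : t < R <;> simp [indicator, ht]
  have hmom := h.truncMoment_nonneg (2 * R)
  rw [e2, integral_eq_lintegral_of_nonneg_ae]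
  · refine ENNReal.toReal_le_of_le_ofReal (by positivity) ?_
    refine le_trans (le_of_eq ?_) (h.lintegral_dilation_sub_le (R := R) hc hc2)
    refine setLIntegral_congr_fun measurableSet_Ioo fun t ht => ?_
    exact ENNReal.ofReal_mul (pow_nonneg ht.1.le _)
  · filter_upwards [ae_restrict_mem measurableSet_Ioo] with t ht
    have := ht.1.le
    positivity
  · have hc' : ContinuousOn (fun t : ℝ => t ^ (n - 1) * |p (c * t) - p t|) (Ioo 0 R) :=
      (continuous_pow _).continuousOn.mul (hcont.mono fun t ht => ht.1)
    exact hc'.aestronglyMeasurable measurableSet_Ioo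

theorem volume_real_ball (z : EuclideanSpace ℝ (Fin n)) {r : ℝ} (hr : 0 < r) :
    (volume : Measure (EuclideanSpace ℝ (Fin n))).real (ball z r) = r ^ n * (sphereArea n / n) := by
  have hn : (n : ℝ) ≠ 0 := by exact_mod_cast NeZero.ne n
  rw [measureReal_def, Measure.addHaar_ball_of_pos _ _ hr, finrank_euclideanSpace_fin,
    ENNReal.toReal_mul, ENNReal.toReal_ofReal (by positivity), sphereArea_eq, ← measureReal_def]
  field_simp

open scoped Pointwise in
theorem ballAvg_smul {c : ℝ} (hc : 0 < c) (z : EuclideanSpace ℝ (Fin n)) {r : ℝ} (hr : 0 < r) :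
    ballAvg p (c • z) (c * r) = ⨍ y in ball z r, p (c * ‖y‖) := by
  have h1 := Measure.setIntegral_comp_smul_of_pos (volume : Measure (EuclideanSpace ℝ (Fin n)))
    (fun y => p ‖y‖) (ball z r) hc
  have h2 : c • ball z r = ball (c • z) (c * r) := by
    rw [_root_.smul_ball hc.ne', Real.norm_of_nonneg hc.le]
  rw [h2] at h1
  have h3 : ∀ y : EuclideanSpace ℝ (Fin n), ‖c • y‖ = c * ‖y‖ := fun y => by
    rw [norm_smul, Real.norm_of_nonneg hc.le]
  simp only [h3] at h1
  rw [ballAvg, setAverage_eq, setAverage_eq, h1, volume_real_ball _ hr,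
    volume_real_ball _ (mul_pos hc hr), finrank_euclideanSpace_fin]
  have hn : (n : ℝ) ≠ 0 := by exact_mod_cast NeZero.ne n
  have hS : sphereArea n ≠ 0 := sphereArea_pos.ne'
  simp only [smul_eq_mul]
  field_simp
  rw [mul_pow]
  ring

/-- Dilating a ball about the origin changes the average of a radial function by little, at a rate
controlled by the moment of the weight over the region swept by the ball. -/
theorem abs_ballAvg_smul_sub_le (h : IsSobolevProfile n p w) {c : ℝ} (hc : 1 / 2 ≤ c) (hc2 : c ≤ 2)
    {x z : EuclideanSpace ℝ (Fin n)} {r : ℝ} (hx : x ∈ ball z r) :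
    |ballAvg p (c • z) (c * r) - ballAvg p z r| ≤
      n * 2 ^ (n + 1) * |c - 1| * (truncMoment n w (2 * (‖x‖ + 2 * r)) / r ^ n) := by
  have hr : 0 < r := pos_of_mem_ball hx
  have hc0 : 0 < c := by linarith
  have i1 := (h.integrable_dilation hc0).integrableOn (s := ball z r)
  have i2 := h.integrable_norm.integrableOn (s := ball z r)
  have hsub : ball z r ⊆ ball 0 (‖x‖ + 2 * r) := by
    intro y hy
    rw [mem_ball_zero_iff]
    have h1 : dist y x < r + r := (dist_triangle_right y x z).trans_lt (add_lt_add hy hx)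
    have h2 : ‖y‖ ≤ ‖x‖ + dist y x := by
      rw [dist_eq_norm]
      have := norm_add_le x (y - x)
      rwa [add_sub_cancel] at this
    linarith
  rw [ballAvg_smul hc0 z hr, ballAvg, setAverage_eq, setAverage_eq, ← smul_sub,
    ← integral_sub i1 i2, smul_eq_mul, abs_mul, abs_of_nonneg (by positivity),
    volume_real_ball z hr]
  have e : |∫ y in ball z r, (p (c * ‖y‖) - p ‖y‖)| ≤
      sphereArea n * (2 ^ (n + 1) * |c - 1| * truncMoment n w (2 * (‖x‖ + 2 * r))) := by
    refine (abs_integral_le_integral_abs).trans ?_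
    refine le_trans ?_ (h.setIntegral_dilation_sub_le (R := ‖x‖ + 2 * r) hc hc2)
    refine setIntegral_mono_set ?_ (Eventually.of_forall fun y => abs_nonneg _) hsub.eventuallyLE
    exact ((h.integrable_dilation hc0).sub h.integrable_norm).abs.integrableOn
  have hn : (0 : ℝ) < n := by exact_mod_cast Nat.pos_of_ne_zero (NeZero.ne n)
  have hS := sphereArea_pos (n := n)
  refine (mul_le_mul_of_nonneg_left e (by positivity)).trans (le_of_eq ?_)
  field_simp

end IsSobolevProfile

/-! ### The profile of the maximal function -/

/-- The profile of the maximal function of the radial function with profile `p`: its value at a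
point of norm `ρ`. -/
noncomputable def maxProfile (n : ℕ) [NeZero n] (p : ℝ → ℝ) (ρ : ℝ) : ℝ :=
  (maximalFunction (fun y : EuclideanSpace ℝ (Fin n) => p ‖y‖)
    (ρ • EuclideanSpace.single (0 : Fin n) 1)).toReal

/-- The maximal function of a radial function is radial. -/
theorem maximalFunction_norm_congr {n : ℕ} (p : ℝ → ℝ) {x y : EuclideanSpace ℝ (Fin n)}
    (hxy : ‖x‖ = ‖y‖) : maximalFunction (fun y : EuclideanSpace ℝ (Fin n) => p ‖y‖) x =
      maximalFunction (fun y : EuclideanSpace ℝ (Fin n) => p ‖y‖) y := by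
  suffices H : ∀ {x y : EuclideanSpace ℝ (Fin n)}, ‖x‖ = ‖y‖ →
      maximalFunction (fun y : EuclideanSpace ℝ (Fin n) => p ‖y‖) x ≤
        maximalFunction (fun y : EuclideanSpace ℝ (Fin n) => p ‖y‖) y from
    le_antisymm (H hxy) (H hxy.symm)
  intro x y hxy
  set T := (ℝ ∙ (x - y))ᗮ.reflection
  have hT : T x = y := Submodule.reflection_sub hxy
  refine iSup_le fun z => iSup_le fun r => iSup_le fun hx => ?_
  have hy : y ∈ ball (T z) r := by
    rw [← hT, mem_ball, T.dist_map]
    exact hx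
  refine le_trans (le_of_eq ?_) (le_iSup_of_le (T z) (le_iSup_of_le r (le_iSup_of_le hy le_rfl)))
  have hpre : T ⁻¹' ball (T z) r = ball z r := T.isometry.preimage_ball z r
  have hmp := T.measurePreserving
  rw [setLAverage_eq, setLAverage_eq]
  congr 1
  · have := hmp.setLIntegral_comp_preimage_emb T.toHomeomorph.measurableEmbedding
      (fun y => ‖p ‖y‖‖ₑ) (ball (T z) r)
    rw [hpre] at this
    simpa using this
  · have := hmp.measure_preimage (s := ball (T z) r) measurableSet_ball.nullMeasurableSet
    rwa [hpre] at this

theorem intervalIntegral_mono_of_nonneg {w : ℝ → ℝ} (hw : ∀ t, 0 ≤ w t) {a b s t : ℝ}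
    (hwi : IntervalIntegrable w volume a b) (has : a ≤ s) (hst : s ≤ t) (htb : t ≤ b) :
    ∫ u in s..t, w u ≤ ∫ u in a..b, w u :=
  intervalIntegral.integral_mono_interval has hst htb (Eventually.of_forall hw) hwi

namespace IsSobolevProfile

variable {n : ℕ} {p w : ℝ → ℝ}

theorem le_add_integral (h : IsSobolevProfile n p w) {a b s t : ℝ} (ha : 0 < a) (hs : s ∈ Icc a b)
    (ht : t ∈ Icc a b) : p s ≤ p t + ∫ u in a..b, w u := by
  have hb : 0 < b := ha.trans_le (hs.1.trans hs.2)
  have hwi := h.intervalIntegrable ha hb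
  rcases le_total s t with hst | hst
  · have h1 := h.abs_sub_le s t (ha.trans_le hs.1) hst
    have h2 := intervalIntegral_mono_of_nonneg h.weight_nonneg hwi hs.1 hst ht.2
    linarith [(abs_le.1 h1).1]
  · have h1 := h.abs_sub_le t s (ha.trans_le ht.1) hst
    have h2 := intervalIntegral_mono_of_nonneg h.weight_nonneg hwi ht.1 hst hs.2
    linarith [(abs_le.1 h1).2]

theorem norm_mem_Ioo_of_mem_ball {x y z : EuclideanSpace ℝ (Fin n)} {r : ℝ} (hx : x ∈ ball z r)
    (hy : y ∈ ball z r) : ‖y‖ ∈ Ioo (‖x‖ - 2 * r) (‖x‖ + 2 * r) := by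
  have h1 : dist y x < r + r := (dist_triangle_right y x z).trans_lt (add_lt_add hy hx)
  rw [dist_eq_norm] at h1
  have h2 := abs_lt.1 ((abs_norm_sub_norm_le y x).trans_lt h1)
  constructor <;> linarith

theorem exists_integral_lt (h : IsSobolevProfile n p w) {ρ₀ ε : ℝ} (hρ₀ : 0 < ρ₀) (hε : 0 < ε) :
    ∃ η, 0 < η ∧ 2 * η ≤ ρ₀ ∧ ∫ u in (ρ₀ - η)..(ρ₀ + η), w u < ε := by
  have hcont : ContinuousOn (fun t => ∫ u in ρ₀..t, w u) (Ioi 0) := by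
    refine continuousOn_of_abs_sub_le (w := w) (fun s t hs ht => h.intervalIntegrable hs ht) ?_
    intro s t hs hst
    have := intervalIntegral.integral_add_adjacent_intervals (h.intervalIntegrable hρ₀ hs)
      (h.intervalIntegrable hs (hs.trans_le hst))
    rw [← this, add_sub_cancel_left, abs_of_nonneg]
    exact intervalIntegral.integral_nonneg hst fun u _ => h.weight_nonneg u
  obtain ⟨δ, hδ, hball⟩ := Metric.continuousAt_iff.1 (hcont.continuousAt (Ioi_mem_nhds hρ₀)) (ε / 2)
    (by positivity)
  refine ⟨min (δ / 2) (ρ₀ / 2), by positivity, by linarith [min_le_right (δ / 2) (ρ₀ / 2)], ?_⟩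
  set η := min (δ / 2) (ρ₀ / 2) with hη
  have hη0 : 0 < η := by positivity
  have h1 : η ≤ δ / 2 := min_le_left _ _
  have h2 : η ≤ ρ₀ / 2 := min_le_right _ _
  have e1 := hball (x := ρ₀ - η) (by rw [Real.dist_eq, abs_lt]; constructor <;> linarith)
  have e2 := hball (x := ρ₀ + η) (by rw [Real.dist_eq, abs_lt]; constructor <;> linarith)
  simp only [intervalIntegral.integral_same, dist_zero_right, Real.norm_eq_abs] at e1 e2
  have e3 := intervalIntegral.integral_add_adjacent_intervals
    (h.intervalIntegrable (s := ρ₀ - η) (by linarith) hρ₀)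
    (h.intervalIntegrable (t := ρ₀ + η) hρ₀ (by linarith))
  rw [intervalIntegral.integral_symm, abs_neg] at e1
  linarith [(abs_lt.1 e1).2, (abs_lt.1 e2).2]

variable [NeZero n]

theorem ballAvg_le (h : IsSobolevProfile n p w) {z : EuclideanSpace ℝ (Fin n)} {r K : ℝ}
    (hr : 0 < r) (hK : ∀ y ∈ ball z r, y ≠ 0 → p ‖y‖ ≤ K) : ballAvg p z r ≤ K := by
  have h1 : ∫ y in ball z r, p ‖y‖ ≤ ∫ y in ball z r, K := by
    refine setIntegral_mono_on_ae h.integrable_norm.integrableOn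
      (integrableOn_const measure_ball_lt_top.ne) measurableSet_ball ?_
    filter_upwards [Measure.ae_ne volume (0 : EuclideanSpace ℝ (Fin n))] with y hy hyb
    exact hK y hyb hy
  have hv := volume_real_ball z hr
  have hpos : 0 < (volume : Measure (EuclideanSpace ℝ (Fin n))).real (ball z r) :=
    ENNReal.toReal_pos (measure_ball_pos _ _ hr).ne' measure_ball_lt_top.ne
  rw [ballAvg, setAverage_eq, smul_eq_mul, inv_mul_le_iff₀ hpos]
  simpa using h1

theorem le_ballAvg (h : IsSobolevProfile n p w) {z : EuclideanSpace ℝ (Fin n)} {r K : ℝ}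
    (hr : 0 < r) (hK : ∀ y ∈ ball z r, K ≤ p ‖y‖) : K ≤ ballAvg p z r := by
  have h1 : ∫ y in ball z r, K ≤ ∫ y in ball z r, p ‖y‖ :=
    setIntegral_mono_on (integrableOn_const measure_ball_lt_top.ne) h.integrable_norm.integrableOn
      measurableSet_ball hK
  have hpos : 0 < (volume : Measure (EuclideanSpace ℝ (Fin n))).real (ball z r) :=
    ENNReal.toReal_pos (measure_ball_pos _ _ hr).ne' measure_ball_lt_top.ne
  rw [ballAvg, setAverage_eq, smul_eq_mul, le_inv_mul_iff₀ hpos]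
  simpa using h1

theorem ballAvg_nonneg (h : IsSobolevProfile n p w) {z : EuclideanSpace ℝ (Fin n)} {r : ℝ}
    (hr : 0 < r) : 0 ≤ ballAvg p z r := h.le_ballAvg hr fun _ _ => h.nonneg _

/-- Small balls: the average is close to the values of `p` at nearby radii. -/
theorem ballAvg_le_add_integral (h : IsSobolevProfile n p w) {x z : EuclideanSpace ℝ (Fin n)}
    {r a b t : ℝ} (hx : x ∈ ball z r) (ha : 0 < a) (hax : a ≤ ‖x‖ - 2 * r) (hxb : ‖x‖ + 2 * r ≤ b)
    (ht : t ∈ Icc a b) : ballAvg p z r ≤ p t + ∫ u in a..b, w u := by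
  refine h.ballAvg_le (pos_of_mem_ball hx) fun y hy _ => h.le_add_integral ha ?_ ht
  have := norm_mem_Ioo_of_mem_ball hx hy
  exact ⟨hax.trans this.1.le, this.2.le.trans hxb⟩

theorem laverage_eq (h : IsSobolevProfile n p w) (z : EuclideanSpace ℝ (Fin n)) (r : ℝ) :
    ⨍⁻ y in ball z r, ‖p ‖y‖‖ₑ ∂volume = ENNReal.ofReal (ballAvg p z r) := by
  rw [ballAvg, ofReal_setAverage h.integrable_norm.integrableOn
    (Eventually.of_forall fun y => h.nonneg _), setLAverage_eq]
  congr 1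
  refine lintegral_congr fun y => ?_
  rw [Real.enorm_of_nonneg (h.nonneg _)]

/-- The averages over small balls through `x` are close to `p ‖x‖`; the others are bounded because `p` is
integrable. -/
theorem exists_ballAvg_le (h : IsSobolevProfile n p w) {x : EuclideanSpace ℝ (Fin n)} (hx0 : x ≠ 0) :
    ∃ K, ∀ z r, x ∈ ball z r → ballAvg p z r ≤ K := by
  have hx : 0 < ‖x‖ := norm_pos_iff.2 hx0
  set r₀ := ‖x‖ / 4 with hr₀
  have hr₀0 : 0 < r₀ := by positivity
  have hn : (0 : ℝ) < n := by exact_mod_cast Nat.pos_of_ne_zero (NeZero.ne n)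
  have hS := sphereArea_pos (n := n)
  refine ⟨max (p ‖x‖ + ∫ u in ‖x‖/2..2*‖x‖, w u) ((r₀ ^ n * (sphereArea n / n))⁻¹ *
    ∫ y : EuclideanSpace ℝ (Fin n), p ‖y‖), fun z r hxz => ?_⟩
  have hr := pos_of_mem_ball hxz
  rcases lt_or_ge r r₀ with hrr | hrr
  · refine le_max_of_le_left (h.ballAvg_le_add_integral hxz (by positivity) ?_ ?_ ⟨?_, ?_⟩) <;> linarith
  · refine le_max_of_le_right ?_
    rw [ballAvg, setAverage_eq, volume_real_ball z hr, smul_eq_mul]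
    refine mul_le_mul (by gcongr) ?_ (integral_nonneg fun y => h.nonneg _) (by positivity)
    exact setIntegral_le_integral h.integrable_norm (Eventually.of_forall fun y => h.nonneg _)

/-- The maximal function may be infinite at the origin, but nowhere else. -/
theorem maximalFunction_lt_top (h : IsSobolevProfile n p w) {x : EuclideanSpace ℝ (Fin n)}
    (hx0 : x ≠ 0) : maximalFunction (fun y : EuclideanSpace ℝ (Fin n) => p ‖y‖) x < ⊤ := by
  obtain ⟨K, hK⟩ := h.exists_ballAvg_le hx0
  refine lt_of_le_of_lt (iSup_le fun z => iSup_le fun r => iSup_le fun hxz => ?_)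
    (ENNReal.ofReal_lt_top (r := K))
  exact (h.laverage_eq z r).le.trans (ENNReal.ofReal_le_ofReal (hK z r hxz))

theorem toReal_maximalFunction (p : ℝ → ℝ) (x : EuclideanSpace ℝ (Fin n)) :
    (maximalFunction (fun y : EuclideanSpace ℝ (Fin n) => p ‖y‖) x).toReal =
      maxProfile n p ‖x‖ := by
  rw [maxProfile]
  congr 1
  refine maximalFunction_norm_congr p ?_
  simp [norm_smul]

theorem ballAvg_le_maxProfile (h : IsSobolevProfile n p w) {x z : EuclideanSpace ℝ (Fin n)} {r : ℝ}
    (hx0 : x ≠ 0) (hx : x ∈ ball z r) : ballAvg p z r ≤ maxProfile n p ‖x‖ := by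
  rw [← toReal_maximalFunction, ← ENNReal.ofReal_le_iff_le_toReal (h.maximalFunction_lt_top hx0).ne]
  refine (h.laverage_eq z r).ge.trans ?_
  exact le_iSup_of_le z (le_iSup_of_le r (le_iSup_of_le hx le_rfl))

theorem exists_norm_eq {ρ : ℝ} (hρ : 0 < ρ) : ∃ x : EuclideanSpace ℝ (Fin n), x ≠ 0 ∧ ‖x‖ = ρ := by
  have : ‖ρ • (EuclideanSpace.single (0 : Fin n) 1 : EuclideanSpace ℝ (Fin n))‖ = ρ := by
    simp [norm_smul, abs_of_pos hρ]
  exact ⟨_, norm_pos_iff.1 (by rw [this]; exact hρ), this⟩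

theorem maxProfile_le (h : IsSobolevProfile n p w) {ρ K : ℝ} (hρ : 0 < ρ)
    (hK : ∀ (x z : EuclideanSpace ℝ (Fin n)) (r : ℝ), ‖x‖ = ρ → x ∈ ball z r → ballAvg p z r ≤ K) :
    maxProfile n p ρ ≤ K := by
  obtain ⟨x, hx0, rfl⟩ := exists_norm_eq (n := n) hρ
  have hK0 : 0 ≤ K :=
    (h.ballAvg_nonneg one_pos).trans (hK x x 1 rfl (mem_ball_self one_pos))
  rw [← toReal_maximalFunction]
  refine ENNReal.toReal_le_of_le_ofReal hK0
    (iSup_le fun z => iSup_le fun r => iSup_le fun hxz => ?_)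
  exact (h.laverage_eq z r).le.trans (ENNReal.ofReal_le_ofReal (hK x z r rfl hxz))

theorem maxProfile_nonneg (ρ : ℝ) : 0 ≤ maxProfile n p ρ := ENNReal.toReal_nonneg

theorem le_maxProfile (h : IsSobolevProfile n p w) {ρ : ℝ} (hρ : 0 < ρ) : p ρ ≤ maxProfile n p ρ := by
  obtain ⟨x, hx0, rfl⟩ := exists_norm_eq (n := n) hρ
  refine le_of_forall_pos_le_add fun ε hε => ?_
  have hc := h.continuousOn.continuousAt (Ioi_mem_nhds hρ)
  obtain ⟨δ, hδ, hball⟩ := Metric.continuousAt_iff.1 hc ε hε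
  have h1 : p ‖x‖ - ε ≤ ballAvg p x δ := by
    refine h.le_ballAvg hδ fun y hy => ?_
    have h2 : dist ‖y‖ ‖x‖ < δ := by
      rw [Real.dist_eq]
      refine (abs_norm_sub_norm_le y x).trans_lt ?_
      rwa [← dist_eq_norm]
    have h3 := hball h2
    rw [Real.dist_eq] at h3
    linarith [(abs_lt.1 h3).1]
  linarith [h.ballAvg_le_maxProfile hx0 (mem_ball_self hδ)]

/-- The comparison of the average over a ball through `x` with the maximal function at radius `t`: dilate
the ball to one through a point of norm `t`. -/
theorem ballAvg_le_maxProfile_add (h : IsSobolevProfile n p w) {x z : EuclideanSpace ℝ (Fin n)}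
    {r t : ℝ} (hx0 : x ≠ 0) (hx : x ∈ ball z r) (ht1 : ‖x‖ ≤ 2 * t) (ht2 : t ≤ 2 * ‖x‖) :
    ballAvg p z r ≤ maxProfile n p t + n * 2 ^ (n + 1) * (|t - ‖x‖| / ‖x‖) *
      (truncMoment n w (2 * (‖x‖ + 2 * r)) / r ^ n) := by
  have hxp : 0 < ‖x‖ := norm_pos_iff.2 hx0
  have ht : 0 < t := by linarith
  set c := t / ‖x‖ with hc
  have hc0 : 0 < c := by positivity
  have h1 : 1 / 2 ≤ c := by rw [hc, le_div_iff₀ hxp]; linarith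
  have h2 : c ≤ 2 := by rw [hc, div_le_iff₀ hxp]; linarith
  have h3 := h.abs_ballAvg_smul_sub_le h1 h2 hx
  have h4 : |c - 1| = |t - ‖x‖| / ‖x‖ := by
    rw [hc, ← abs_of_pos hxp, ← abs_div, abs_of_pos hxp]
    congr 1
    field_simp
  have h5 : c • x ∈ ball (c • z) (c * r) := by
    rw [mem_ball, dist_smul₀, Real.norm_of_nonneg hc0.le]
    exact mul_lt_mul_of_pos_left hx hc0
  have h6 : ‖c • x‖ = t := by
    rw [norm_smul, Real.norm_of_nonneg hc0.le, hc, div_mul_cancel₀ _ hxp.ne']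
  have h7 := h.ballAvg_le_maxProfile (smul_ne_zero hc0.ne' hx0) h5
  rw [h6] at h7
  rw [h4] at h3
  linarith [(abs_le.1 h3).1]

/-- Near a fixed radius, the maximal function is either close to `p` (small balls) or varies in a
Lipschitz way (large balls). -/
theorem exists_maxProfile_le_max (h : IsSobolevProfile n p w) {ρ₀ η : ℝ} (hη : 0 < η)
    (hη2 : 2 * η ≤ ρ₀) : ∃ C : ℝ, 0 ≤ C ∧ ∀ s t, |s - ρ₀| < η / 2 → |t - ρ₀| < η / 2 →
      maxProfile n p s ≤ max (p t + ∫ u in (ρ₀ - η)..(ρ₀ + η), w u)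
        (maxProfile n p t + C * |s - t|) := by
  set I := ∫ u in Ioi (0 : ℝ), u ^ (n - 1) * w u with hI
  have hI0 : 0 ≤ I := setIntegral_nonneg measurableSet_Ioi fun u hu =>
    mul_nonneg (pow_nonneg (le_of_lt hu) _) (h.weight_nonneg u)
  have hρ₀ : 0 < ρ₀ := by linarith
  set δ := η / 4 with hδ
  have hδ0 : 0 < δ := by positivity
  refine ⟨n * 2 ^ (n + 1) * (2 / ρ₀) * (2 * (2 * ρ₀ / δ + 2) / δ ^ (n - 1) * I), by positivity, ?_⟩
  intro s t hs ht
  have hs' := abs_lt.1 hs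
  have ht' := abs_lt.1 ht
  have hs0 : 0 < s := by linarith
  refine h.maxProfile_le hs0 fun x z r hxs hx => ?_
  have hr := pos_of_mem_ball hx
  have hx0 : x ≠ 0 := norm_pos_iff.1 (hxs ▸ hs0)
  rcases lt_or_ge r δ with hrδ | hrδ
  · refine le_max_of_le_left (h.ballAvg_le_add_integral hx (by linarith) ?_ ?_ ⟨?_, ?_⟩) <;> linarith
  · refine le_max_of_le_right ?_
    refine (h.ballAvg_le_maxProfile_add (t := t) hx0 hx (by linarith) (by linarith)).trans ?_
    rw [hxs, abs_sub_comm t s]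
    have e1 : truncMoment n w (2 * (s + 2 * r)) / r ^ n ≤
        2 * (2 * ρ₀ / δ + 2) / δ ^ (n - 1) * I := by
      have e2 := h.truncMoment_le (R := 2 * (s + 2 * r)) (by positivity)
      obtain ⟨j, hj⟩ : ∃ j, n = j + 1 := ⟨n - 1, (Nat.succ_pred (NeZero.ne n)).symm⟩
      have e3 : r ^ n = r * r ^ (n - 1) := by rw [hj, Nat.add_sub_cancel]; ring
      calc truncMoment n w (2 * (s + 2 * r)) / r ^ n ≤ 2 * (s + 2 * r) * I / r ^ n := by gcongr
        _ = 2 * (s / r + 2) / r ^ (n - 1) * I := by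
            rw [e3]; field_simp
        _ ≤ _ := by
            gcongr
            linarith
    have e4 : |s - t| / s ≤ 2 / ρ₀ * |s - t| := by
      rw [div_mul_eq_mul_div, div_le_div_iff₀ hs0 hρ₀]
      nlinarith [abs_nonneg (s - t)]
    calc maxProfile n p t + n * 2 ^ (n + 1) * (|s - t| / s) *
          (truncMoment n w (2 * (s + 2 * r)) / r ^ n)
        ≤ maxProfile n p t + n * 2 ^ (n + 1) * (2 / ρ₀ * |s - t|) *
          (2 * (2 * ρ₀ / δ + 2) / δ ^ (n - 1) * I) := by
          gcongr
          exact div_nonneg (h.truncMoment_nonneg _) (by positivity)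
      _ = _ := by ring

theorem continuousOn_maxProfile (h : IsSobolevProfile n p w) :
    ContinuousOn (maxProfile n p) (Ioi 0) := by
  intro ρ₀ hρ₀
  have hρ₀ : 0 < ρ₀ := hρ₀
  refine ContinuousAt.continuousWithinAt (Metric.continuousAt_iff'.2 fun ε hε => ?_)
  obtain ⟨η, hη, hη2, hint⟩ := h.exists_integral_lt hρ₀ (half_pos hε)
  obtain ⟨C, hC, hmax⟩ := h.exists_maxProfile_le_max hη hη2
  have hlim : Tendsto (fun s => C * |s - ρ₀|) (𝓝 ρ₀) (𝓝 0) := by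
    have : Continuous fun s => C * |s - ρ₀| := by fun_prop
    simpa using this.tendsto ρ₀
  filter_upwards [hlim.eventually_lt_const (half_pos hε), Metric.ball_mem_nhds ρ₀ (half_pos hη),
    Ioi_mem_nhds hρ₀] with s hs1 hs2 hs3
  rw [mem_ball, Real.dist_eq] at hs2
  have h0 : |ρ₀ - ρ₀| < η / 2 := by simpa using half_pos hη
  have h1 := hmax s ρ₀ hs2 h0
  have h2 := hmax ρ₀ s h0 hs2
  rw [abs_sub_comm ρ₀ s] at h2
  have h3 := h.le_maxProfile hρ₀
  have h4 := h.le_maxProfile hs3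
  have hCs : 0 ≤ C * |s - ρ₀| := by positivity
  rw [Real.dist_eq, abs_lt]
  rcases le_max_iff.1 h1 with h1 | h1 <;> rcases le_max_iff.1 h2 with h2 | h2 <;>
    constructor <;> linarith

/-- Near a point where `p < maxProfile n p`, the alternative of `exists_maxProfile_le_max` that
compares with `p` cannot occur. -/
theorem exists_lipschitzOnWith_maxProfile (h : IsSobolevProfile n p w) {ρ₀ : ℝ} (hρ₀ : 0 < ρ₀)
    (hlt : p ρ₀ < maxProfile n p ρ₀) :
    ∃ K : ℝ≥0, ∃ S ∈ 𝓝 ρ₀, LipschitzOnWith K (maxProfile n p) S := by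
  set d := maxProfile n p ρ₀ - p ρ₀ with hd
  have hd0 : 0 < d := sub_pos.2 hlt
  obtain ⟨η, hη, hη2, hint⟩ := h.exists_integral_lt hρ₀ (by positivity : 0 < d / 4)
  obtain ⟨C, hC, hmax⟩ := h.exists_maxProfile_le_max hη hη2
  have hm := h.continuousOn_maxProfile.continuousAt (Ioi_mem_nhds hρ₀)
  have hp := h.continuousOn.continuousAt (Ioi_mem_nhds hρ₀)
  refine ⟨C.toNNReal, {s | |s - ρ₀| < η / 2 ∧ maxProfile n p ρ₀ - d / 4 < maxProfile n p s ∧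
    p s < p ρ₀ + d / 4}, ?_, ?_⟩
  · filter_upwards [Metric.ball_mem_nhds ρ₀ (half_pos hη),
      hm.eventually_const_lt (show maxProfile n p ρ₀ - d / 4 < _ by linarith),
      hp.eventually_lt_const (show _ < p ρ₀ + d / 4 by linarith)] with s h1 h2 h3
    exact ⟨by rwa [mem_ball, Real.dist_eq] at h1, h2, h3⟩
  · refine LipschitzOnWith.of_le_add_mul _ fun s hs t ht => ?_
    rw [Real.coe_toNNReal _ hC, Real.dist_eq]
    rcases le_max_iff.1 (hmax s t hs.1 ht.1) with h1 | h1
    · linarith [hs.2.1, ht.2.2]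
    · exact h1

/-- Away from the contact set the maximal function has no strict interior local maximum. A ball through
a maximum point either meets the sphere of radius `s` or `t`, and then its average is at most the
maximal function there, or it stays between the two spheres, and then its average is at most the
maximum of `p`, which is smaller than that of `maxProfile n p`. -/
theorem maxProfile_le_max (h : IsSobolevProfile n p w) {s t : ℝ} (hs : 0 < s) (hst : s ≤ t)
    (hlt : ∀ x ∈ Icc s t, p x < maxProfile n p x) :
    ∀ x ∈ Icc s t, maxProfile n p x ≤ max (maxProfile n p s) (maxProfile n p t) := by
  have hsub : Icc s t ⊆ Ioi 0 := fun x hx => hs.trans_le hx.1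
  obtain ⟨x, hx, hxmax⟩ := isCompact_Icc.exists_isMaxOn (nonempty_Icc.2 hst)
    (h.continuousOn_maxProfile.mono hsub)
  obtain ⟨y, hy, hymax⟩ := isCompact_Icc.exists_isMaxOn (nonempty_Icc.2 hst)
    (h.continuousOn.mono hsub)
  have hxmax' : ∀ u ∈ Icc s t, maxProfile n p u ≤ maxProfile n p x := fun u hu => hxmax hu
  have hymax' : ∀ u ∈ Icc s t, p u ≤ p y := fun u hu => hymax hu
  have key : maxProfile n p x ≤ max (p y) (max (maxProfile n p s) (maxProfile n p t)) := by
    refine h.maxProfile_le (hsub hx) fun X z r hX hXz => ?_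
    have hr := pos_of_mem_ball hXz
    by_cases h1 : ∃ Y ∈ ball z r, ‖Y‖ = s
    · obtain ⟨Y, hY, rfl⟩ := h1
      exact le_max_of_le_right (le_max_of_le_left
        (h.ballAvg_le_maxProfile (norm_pos_iff.1 hs) hY))
    by_cases h2 : ∃ Y ∈ ball z r, ‖Y‖ = t
    · obtain ⟨Y, hY, rfl⟩ := h2
      exact le_max_of_le_right (le_max_of_le_right
        (h.ballAvg_le_maxProfile (norm_pos_iff.1 (hs.trans_le hst)) hY))
    refine le_max_of_le_left (h.ballAvg_le hr fun Y hY _ => hymax' _ ?_)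
    have hconn : (norm '' ball z r).OrdConnected :=
      (((convex_ball z r).isPreconnected).image _ continuous_norm.continuousOn).ordConnected
    have hXi : x ∈ norm '' ball z r := ⟨X, hXz, hX⟩
    have hYi : ‖Y‖ ∈ norm '' ball z r := ⟨Y, hY, rfl⟩
    constructor
    · by_contra hcon
      exact h1 (hconn.out hYi hXi ⟨(not_le.1 hcon).le, hx.1⟩)
    · by_contra hcon
      exact h2 (hconn.out hXi hYi ⟨hx.2, (not_le.1 hcon).le⟩)
  have hyx : p y < maxProfile n p x := (hlt y hy).trans_le (hxmax' y hy)
  intro u hu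
  rcases le_max_iff.1 key with h1 | h1
  · exact absurd h1 (not_le.2 hyx)
  · exact (hxmax' u hu).trans h1

theorem isContactMajorant (h : IsSobolevProfile n p w) :
    IsContactMajorant p w (maxProfile n p) where
  continuousOn := h.continuousOn_maxProfile
  weight_nonneg := h.weight_nonneg
  weight_integrable _ _ hs ht := h.intervalIntegrable hs ht
  abs_sub_le := h.abs_sub_le
  le _ ht := h.le_maxProfile ht
  lipschitz _ ht hlt := h.exists_lipschitzOnWith_maxProfile ht hlt
  quasiconvex _ _ hs hst hlt := h.maxProfile_le_max hs hst hlt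

end IsSobolevProfile

/-! ### Oscillation of the maximal function over an annulus -/

/-- The quantity `∫₀^∞ w(u) (u / max(a, u))ⁿ du`, which controls the oscillation of the maximal
function over the annulus `a ≤ |x| ≤ 2a`. -/
noncomputable def annulusEnergy (n : ℕ) (w : ℝ → ℝ) (a : ℝ) : ℝ :=
  ∫ u in Ioi (0 : ℝ), u ^ n * w u / max a u ^ n

/-- The constant in the oscillation estimate over an annulus: `n * 2 ^ (n + 1)` comes from dilating
balls, and `36 ^ n` from `max a u ≤ 36 * r` for radii `r ≥ a / 8` and `u` in the region swept by the
ball. -/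
noncomputable def oscConst (n : ℕ) : ℝ := n * 2 ^ (n + 1) * 36 ^ n

namespace IsSobolevProfile

variable {n : ℕ} {p w : ℝ → ℝ}

theorem annulusEnergy_integrand_nonneg (h : IsSobolevProfile n p w) {a u : ℝ} (hu : 0 < u) :
    0 ≤ u ^ n * w u / max a u ^ n := by
  have := h.weight_nonneg u
  have : 0 < max a u := lt_max_of_lt_right hu
  positivity

variable [NeZero n]

theorem integrableOn_annulusEnergy (h : IsSobolevProfile n p w) {a : ℝ} (ha : 0 < a) :
    IntegrableOn (fun u => u ^ n * w u / max a u ^ n) (Ioi 0) := by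
  have hwm := h.weight_measurable
  obtain ⟨j, hj⟩ : ∃ j, n = j + 1 := ⟨n - 1, (Nat.succ_pred (NeZero.ne n)).symm⟩
  refine (h.weight_integrable.const_mul (a ^ (n - 1))⁻¹).mono ?_ ?_
  · exact ((((measurable_id.pow_const _).mul hwm).div
      ((measurable_const.max measurable_id).pow_const _))).aestronglyMeasurable
  filter_upwards [ae_restrict_mem measurableSet_Ioi] with u hu
  have hu : 0 < u := hu
  have hwu := h.weight_nonneg u
  rw [Real.norm_of_nonneg (h.annulusEnergy_integrand_nonneg hu),
    Real.norm_of_nonneg (by positivity), hj, Nat.add_sub_cancel, div_le_iff₀ (by positivity)]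
  have h1 : a ^ j ≤ max a u ^ j := by gcongr; exact le_max_left _ _
  have h2 : u ≤ max a u := le_max_right _ _
  calc u ^ (j + 1) * w u = (a ^ j)⁻¹ * (u ^ j * w u) * (a ^ j * u) := by
        field_simp
        ring
    _ ≤ (a ^ j)⁻¹ * (u ^ j * w u) * (max a u ^ j * max a u) := by gcongr
    _ = _ := by ring

/-- Over the annulus `a ≤ |x| ≤ 2a` the oscillation of the maximal function is at most a multiple of
`annulusEnergy`: small balls only see the variation of `p` nearby, and large balls can be
dilated. -/
theorem maxProfile_sub_le (h : IsSobolevProfile n p w) {a s t : ℝ} (ha : 0 < a)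
    (hs : s ∈ Icc a (2 * a)) (ht : t ∈ Icc a (2 * a)) :
    maxProfile n p s - maxProfile n p t ≤ oscConst n * annulusEnergy n w a := by
  have hn : (1 : ℝ) ≤ n := by exact_mod_cast Nat.one_le_iff_ne_zero.2 (NeZero.ne n)
  have hE := h.integrableOn_annulusEnergy ha
  have hs0 : 0 < s := ha.trans_le hs.1
  have ht0 : 0 < t := ha.trans_le ht.1
  have hE0 : 0 ≤ annulusEnergy n w a := setIntegral_nonneg measurableSet_Ioi fun u hu =>
    h.annulusEnergy_integrand_nonneg hu
  rw [sub_le_iff_le_add']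
  refine h.maxProfile_le hs0 fun x z r hxs hx => ?_
  have hr := pos_of_mem_ball hx
  have hx0 : x ≠ 0 := norm_pos_iff.1 (hxs ▸ hs0)
  rcases lt_or_ge r (a / 8) with hra | hra
  · have h1 := h.ballAvg_le_add_integral (t := t) (a := a / 2) (b := 4 * a) hx (by linarith)
      (by linarith [hs.1]) (by linarith [hs.2]) ⟨by linarith [ht.1], by linarith [ht.2]⟩
    have h2 : ∫ u in (a / 2)..(4 * a), w u ≤ 2 ^ n * annulusEnergy n w a := by
      rw [intervalIntegral.integral_of_le (by linarith), annulusEnergy, ← integral_const_mul]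
      have hsub : Ioc (a / 2) (4 * a) ⊆ Ioi 0 := fun u hu => (half_pos ha).trans hu.1
      refine le_trans (setIntegral_mono_on ?_ ((hE.mono_set hsub).const_mul (2 ^ n))
        measurableSet_Ioc fun u hu => ?_) (setIntegral_mono_set (hE.const_mul _) ?_ hsub.eventuallyLE)
      · exact (intervalIntegrable_iff_integrableOn_Ioc_of_le (by linarith)).1
          (h.intervalIntegrable (by positivity) (by positivity))
      · have hu0 : 0 < u := hsub hu
        have hwu := h.weight_nonneg u
        have hmax : max a u ≤ 2 * u := max_le (by linarith [hu.1]) (by linarith)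
        have hmax0 : 0 < max a u := lt_max_of_lt_left ha
        rw [← mul_div_assoc, le_div_iff₀ (by positivity)]
        calc w u * max a u ^ n ≤ w u * (2 * u) ^ n := by gcongr
          _ = _ := by ring
      · filter_upwards [ae_restrict_mem measurableSet_Ioi] with u hu
        exact mul_nonneg (by positivity) (h.annulusEnergy_integrand_nonneg hu)
    have h3 : (2 : ℝ) ^ n ≤ oscConst n := by
      rw [oscConst]
      have e1 : (2 : ℝ) ^ n ≤ 2 ^ (n + 1) := pow_le_pow_right₀ (by norm_num) (Nat.le_succ n)
      have e2 : (1 : ℝ) ≤ 36 ^ n := one_le_pow₀ (by norm_num)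
      calc (2 : ℝ) ^ n = 1 * 2 ^ n * 1 := by ring
        _ ≤ n * 2 ^ (n + 1) * 36 ^ n := by gcongr
    have h4 := mul_le_mul_of_nonneg_right h3 hE0
    linarith [h.le_maxProfile ht0]
  · have h1 := h.ballAvg_le_maxProfile_add (t := t) hx0 hx (by linarith [hs.2, ht.1])
      (by linarith [hs.1, ht.2])
    rw [hxs] at h1
    have h2 : |t - s| / s ≤ 1 := by
      rw [div_le_one hs0, abs_le]
      constructor <;> linarith [hs.1, hs.2, ht.1, ht.2]
    have h3 : truncMoment n w (2 * (s + 2 * r)) / r ^ n ≤ 36 ^ n * annulusEnergy n w a := by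
      rw [truncMoment, annulusEnergy, ← integral_const_mul, ← integral_div]
      have hsub : Ioc 0 (2 * (s + 2 * r)) ⊆ Ioi 0 := Ioc_subset_Ioi_self
      refine le_trans (setIntegral_mono_on ((h.integrableOn_moment _).div_const _)
        ((hE.mono_set hsub).const_mul (36 ^ n)) measurableSet_Ioc fun u hu => ?_)
        (setIntegral_mono_set (hE.const_mul _) ?_ hsub.eventuallyLE)
      · have hu0 : 0 < u := hsub hu
        have hwu := h.weight_nonneg u
        have hmax : max a u ≤ 36 * r := max_le (by linarith) (by linarith [hu.2, hs.2])
        have hmax0 : 0 < max a u := lt_max_of_lt_left ha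
        rw [← mul_div_assoc, div_le_div_iff₀ (by positivity) (by positivity)]
        calc u ^ n * w u * max a u ^ n ≤ u ^ n * w u * (36 * r) ^ n := by gcongr
          _ = _ := by ring
      · filter_upwards [ae_restrict_mem measurableSet_Ioi] with u hu
        exact mul_nonneg (by positivity) (h.annulusEnergy_integrand_nonneg hu)
    have hmom := h.truncMoment_nonneg (2 * (s + 2 * r))
    refine h1.trans (add_le_add le_rfl ?_)
    calc n * 2 ^ (n + 1) * (|t - s| / s) * (truncMoment n w (2 * (s + 2 * r)) / r ^ n)
        ≤ n * 2 ^ (n + 1) * 1 * (36 ^ n * annulusEnergy n w a) := by gcongr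
      _ = _ := by rw [oscConst]; ring

end IsSobolevProfile

/-- In dimension one the maximal function is bounded by the total variation of the profile. -/
theorem IsSobolevProfile.maxProfile_one_le {p w : ℝ → ℝ} (h : IsSobolevProfile 1 p w) {ρ : ℝ}
    (hρ : 0 < ρ) : maxProfile 1 p ρ ≤ ∫ u in Ioi (0 : ℝ), w u := by
  have hwi : IntegrableOn w (Ioi 0) := by simpa using h.weight_integrable
  have hpi : IntegrableOn p (Ioi 0) := by simpa using h.integrable
  set I := ∫ u in Ioi (0 : ℝ), w u with hI
  have hp : ∀ t, 0 < t → p t ≤ I := by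
    intro t ht
    by_contra! hcon
    have h1 : ∀ u ∈ Ioi t, p t - I ≤ p u := by
      intro u hu
      have hu : t < u := hu
      have h2 := (abs_le.1 (h.abs_sub_le t u ht hu.le)).1
      have h3 : ∫ v in t..u, w v ≤ I := by
        rw [intervalIntegral.integral_of_le hu.le]
        exact setIntegral_mono_set hwi (Eventually.of_forall h.weight_nonneg)
          (LE.le.eventuallyLE fun v hv => ht.trans hv.1)
      linarith
    -- otherwise `p` stays above a positive constant near infinity
    have h2 : IntegrableOn (fun _ : ℝ => p t - I) (Ioi t) := by
      refine (hpi.mono_set (Ioi_subset_Ioi ht.le)).mono' aestronglyMeasurable_const ?_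
      filter_upwards [ae_restrict_mem measurableSet_Ioi] with u hu
      rw [Real.norm_of_nonneg (by linarith)]
      exact h1 u hu
    rw [integrableOn_const_iff] at h2
    rcases h2 with h2 | h2
    · rw [enorm_eq_zero] at h2
      linarith
    · simp at h2
  refine h.maxProfile_le hρ fun x z r _ hx => h.ballAvg_le (pos_of_mem_ball hx) fun y _ hy => ?_
  exact hp _ (norm_pos_iff.2 hy)

/-! ### The weighted variation of the maximal function -/

/-- A function whose increments are dominated by those of a primitive of `H` is absolutely
continuous. -/
theorem absolutelyContinuousOnInterval_of_abs_sub_le {f H : ℝ → ℝ} {a b : ℝ} (hab : a ≤ b)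
    (hH : IntervalIntegrable H volume a b)
    (hf : ∀ s t, a ≤ s → s ≤ t → t ≤ b → |f t - f s| ≤ ∫ u in s..t, H u) :
    AbsolutelyContinuousOnInterval f a b := by
  have hV := hH.absolutelyContinuousOnInterval_intervalIntegral (left_mem_uIcc (a := a) (b := b))
  rw [absolutelyContinuousOnInterval_iff] at hV ⊢
  have hsub : ∀ s t, s ∈ Icc a b → t ∈ Icc a b → s ≤ t →
      dist (f s) (f t) ≤ dist (∫ u in a..s, H u) (∫ u in a..t, H u) := by
    intro s t hs ht hst
    have h1 := intervalIntegral.integral_interval_sub_left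
      (hH.mono_set (by rw [uIcc_of_le ht.1, uIcc_of_le hab]; exact Icc_subset_Icc le_rfl ht.2))
      (hH.mono_set (by rw [uIcc_of_le hs.1, uIcc_of_le hab]; exact Icc_subset_Icc le_rfl hs.2))
    rw [dist_comm, Real.dist_eq, dist_comm, Real.dist_eq, h1]
    exact (hf s t hs.1 hst ht.2).trans (le_abs_self _)
  intro ε hε
  obtain ⟨δ, hδ, hδE⟩ := hV ε hε
  refine ⟨δ, hδ, fun E hE hEδ => lt_of_le_of_lt ?_ (hδE E hE hEδ)⟩
  refine Finset.sum_le_sum fun i hi => ?_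
  have hm := hE.1 i hi
  rw [uIcc_of_le hab] at hm
  rcases le_total (E.2 i).1 (E.2 i).2 with h1 | h1
  · exact hsub _ _ hm.1 hm.2 h1
  · rw [dist_comm, dist_comm (∫ u in a..(E.2 i).1, H u)]
    exact hsub _ _ hm.2 hm.1 h1

/-- Lebesgue differentiation of the bound on the increments; where `f` is not differentiable, `deriv f`
is zero and the bound is trivial. -/
theorem ae_abs_deriv_le_of_abs_sub_le {f H : ℝ → ℝ} {a b : ℝ} (hab : a ≤ b)
    (hH : IntervalIntegrable H volume a b) (hH0 : ∀ t, 0 ≤ H t)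
    (hf : ∀ s t, a ≤ s → s ≤ t → t ≤ b → |f t - f s| ≤ ∫ u in s..t, H u) :
    ∀ᵐ x, x ∈ Ioo a b → |deriv f x| ≤ H x := by
  filter_upwards [hH.ae_hasDerivAt_integral] with x hx hxab
  by_cases hd : DifferentiableAt ℝ f x
  · have h1 := hx (by rw [uIcc_of_le hab]; exact Ioo_subset_Icc_self hxab) a left_mem_uIcc
    have h2 := (hasDerivAt_iff_tendsto_slope.1 h1).mono_left
      (nhdsWithin_mono x (s := Ioi x) fun y hy => ne_of_gt hy)
    have h3 := (hasDerivAt_iff_tendsto_slope.1 hd.hasDerivAt).mono_left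
      (nhdsWithin_mono x (s := Ioi x) fun y hy => ne_of_gt hy)
    refine le_of_tendsto_of_tendsto h3.abs h2 ?_
    filter_upwards [Ioo_mem_nhdsGT hxab.2] with y hy
    have e1 := hf x y hxab.1.le hy.1.le hy.2.le
    have e2 := intervalIntegral.integral_interval_sub_left
      (hH.mono_set (c := a) (d := y) (by
        rw [uIcc_of_le (hxab.1.le.trans hy.1.le), uIcc_of_le hab]
        exact Icc_subset_Icc le_rfl hy.2.le))
      (hH.mono_set (c := a) (d := x) (by
        rw [uIcc_of_le hxab.1.le, uIcc_of_le hab]; exact Icc_subset_Icc le_rfl hxab.2.le))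
    have hyx : 0 < y - x := sub_pos.2 hy.1
    rw [slope_def_field, slope_def_field, e2, abs_div, abs_of_pos hyx]
    gcongr
  · rw [deriv_zero_of_not_differentiableAt hd, abs_zero]
    exact hH0 x

/-- The function equal to `|m'|` on the detached set and to zero elsewhere. -/
noncomputable def detachedSlope (p m : ℝ → ℝ) : ℝ → ℝ :=
  (detachedSet p m).indicator fun x => |deriv m x|

theorem detachedSlope_nonneg (p m : ℝ → ℝ) (x : ℝ) : 0 ≤ detachedSlope p m x :=
  indicator_nonneg (fun _ _ => abs_nonneg _) x

theorem IsContactMajorant.measurable_detachedSlope {p w m : ℝ → ℝ} (h : IsContactMajorant p w m) :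
    Measurable (detachedSlope p m) :=
  (measurable_deriv m).abs.indicator h.isOpen_detachedSet.measurableSet

theorem IsContactMajorant.lintegral_detachedSlope_le {p w m : ℝ → ℝ} (h : IsContactMajorant p w m)
    {a b K : ℝ} (ha : 0 < a) (hab : a < b) (hK : ∀ x ∈ Icc a b, ∀ y ∈ Icc a b, m x - m y ≤ K) :
    ∫⁻ x in Ioo a b, ENNReal.ofReal (detachedSlope p m x) ≤
      (∫⁻ x in Ioo a b, ENNReal.ofReal (w x)) + ENNReal.ofReal (4 * K) := by
  refine le_trans (le_of_eq ?_) (h.lintegral_detached_abs_deriv_le ha hab hK)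
  rw [← Measure.restrict_restrict h.isOpen_detachedSet.measurableSet,
    ← lintegral_indicator h.isOpen_detachedSet.measurableSet]
  refine lintegral_congr fun x => ?_
  by_cases hx : x ∈ detachedSet p m <;> simp [detachedSlope, hx]

theorem lintegral_Ioi_inv_sq {u : ℝ} (hu : 0 < u) :
    ∫⁻ a in Ioi u, ENNReal.ofReal ((a ^ 2)⁻¹) = ENNReal.ofReal u⁻¹ := by
  have e : ∀ a ∈ Ioi u, a ^ (-2 : ℝ) = (a ^ 2)⁻¹ := fun a ha => by
    have : 0 < a := hu.trans ha
    rw [Real.rpow_neg this.le]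
    norm_cast
  have h1 : IntegrableOn (fun a : ℝ => (a ^ 2)⁻¹) (Ioi u) :=
    (integrableOn_Ioi_rpow_of_lt (by norm_num : (-2 : ℝ) < -1) hu).congr_fun e measurableSet_Ioi
  have h2 : ∫ a in Ioi u, (a ^ 2)⁻¹ = u⁻¹ := by
    rw [← setIntegral_congr_fun measurableSet_Ioi e,
      integral_Ioi_rpow_of_lt (by norm_num : (-2 : ℝ) < -1) hu]
    norm_num [Real.rpow_neg_one]
  rw [← h2, ofReal_integral_eq_lintegral_ofReal h1 (Eventually.of_forall fun a => by positivity)]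

/-- The scale integral of the kernel of `annulusEnergy`; it converges at the small scales because the
dimension is at least two. -/
theorem lintegral_scale_kernel_le (k : ℕ) {u : ℝ} (hu : 0 < u) :
    ∫⁻ a in Ioi (0 : ℝ), ENNReal.ofReal (a ^ k * (u ^ (k + 2) / max a u ^ (k + 2))) ≤
      ENNReal.ofReal (2 * u ^ (k + 1)) := by
  rw [← Ioc_union_Ioi_eq_Ioi hu.le]
  refine (lintegral_union_le _ _ _).trans ?_
  have e1 : ∫⁻ a in Ioc 0 u, ENNReal.ofReal (a ^ k * (u ^ (k + 2) / max a u ^ (k + 2))) ≤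
      ENNReal.ofReal (u ^ (k + 1)) := by
    calc _ ≤ ∫⁻ a in Ioc 0 u, ENNReal.ofReal (u ^ k) := by
          refine setLIntegral_mono' measurableSet_Ioc fun a ha => ENNReal.ofReal_le_ofReal ?_
          rw [max_eq_right ha.2, div_self (by positivity), mul_one]
          exact pow_le_pow_left₀ ha.1.le ha.2 _
      _ = ENNReal.ofReal (u ^ (k + 1)) := by
          rw [setLIntegral_const, Real.volume_Ioc, sub_zero, ← ENNReal.ofReal_mul (by positivity)]
          congr 1
  have e2 : ∫⁻ a in Ioi u, ENNReal.ofReal (a ^ k * (u ^ (k + 2) / max a u ^ (k + 2))) =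
      ENNReal.ofReal (u ^ (k + 1)) := by
    calc _ = ∫⁻ a in Ioi u, ENNReal.ofReal (u ^ (k + 2)) * ENNReal.ofReal ((a ^ 2)⁻¹) := by
          refine setLIntegral_congr_fun measurableSet_Ioi fun a ha => ?_
          have ha : u < a := ha
          have ha0 : 0 < a := hu.trans ha
          rw [← ENNReal.ofReal_mul (by positivity), max_eq_left ha.le]
          congr 1
          field_simp
          ring
      _ = _ := by
          rw [lintegral_const_mul' _ _ ENNReal.ofReal_ne_top, lintegral_Ioi_inv_sq hu,
            ← ENNReal.ofReal_mul (by positivity)]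
          congr 1
          field_simp
          ring
  rw [e2]
  refine (add_le_add e1 le_rfl).trans (le_of_eq ?_)
  rw [← ENNReal.ofReal_add (by positivity) (by positivity)]
  ring_nf

/-- Every radius `ρ` lies in the annulus `(a, 2a)` for the scales `a` in `(ρ / 2, ρ)`, which have
`da / a`-measure at least `1 / 2`. -/
theorem one_le_lintegral_scales {ρ : ℝ} (hρ : 0 < ρ) :
    1 ≤ 2 * ∫⁻ a in Ioi (0 : ℝ), ENNReal.ofReal a⁻¹ * (Ioo a (2 * a)).indicator 1 ρ := by
  have h1 : ENNReal.ofReal (1 / 2) ≤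
      ∫⁻ a in Ioi (0 : ℝ), ENNReal.ofReal a⁻¹ * (Ioo a (2 * a)).indicator 1 ρ := by
    calc ENNReal.ofReal (1 / 2) = ∫⁻ a in Ioo (ρ / 2) ρ, ENNReal.ofReal ρ⁻¹ := by
          rw [setLIntegral_const, Real.volume_Ioo, ← ENNReal.ofReal_mul (by positivity)]
          congr 1
          field_simp
          norm_num
      _ ≤ ∫⁻ a in Ioo (ρ / 2) ρ, ENNReal.ofReal a⁻¹ * (Ioo a (2 * a)).indicator 1 ρ := by
          refine setLIntegral_mono' measurableSet_Ioo fun a ha => ?_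
          have ha0 : 0 < a := (half_pos hρ).trans ha.1
          rw [indicator_of_mem (show ρ ∈ Ioo a (2 * a) from ⟨ha.2, by linarith [ha.1]⟩),
            Pi.one_apply, mul_one]
          refine ENNReal.ofReal_le_ofReal ?_
          gcongr
          exact ha.2.le
      _ ≤ _ := lintegral_mono_set fun a ha => (half_pos hρ).trans ha.1
  calc (1 : ℝ≥0∞) = 2 * ENNReal.ofReal (1 / 2) := by
        rw [← ENNReal.ofReal_ofNat, ← ENNReal.ofReal_mul (by norm_num)]
        norm_num
    _ ≤ _ := by gcongr

/-- The constant in the weighted variation estimate for the detached part. The summand `5` serves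
dimension one, the other summand the higher dimensions. -/
noncomputable def variationConst (n : ℕ) : ℝ := 2 ^ (n + 1) * (1 + 4 * oscConst n) + 5

namespace IsSobolevProfile

/-- In dimension one no decomposition into scales is needed, as `maxProfile 1 p` is bounded by the total
variation. -/
theorem lintegral_detachedSlope_one_le {p w : ℝ → ℝ} (h : IsSobolevProfile 1 p w) :
    ∫⁻ ρ in Ioi (0 : ℝ), ENNReal.ofReal (detachedSlope p (maxProfile 1 p) ρ) ≤
      ENNReal.ofReal (5 * ∫ u in Ioi (0 : ℝ), w u) := by
  have hwi : IntegrableOn w (Ioi 0) := by simpa using h.weight_integrable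
  set I := ∫ u in Ioi (0 : ℝ), w u with hI
  have hI0 : 0 ≤ I := setIntegral_nonneg measurableSet_Ioi fun u _ => h.weight_nonneg u
  have hmono : Monotone fun k : ℕ => Ioo ((k : ℝ) + 2)⁻¹ (k + 2) := by
    intro i j hij
    have hij' : (i : ℝ) ≤ j := by exact_mod_cast hij
    refine Ioo_subset_Ioo ?_ (by linarith)
    gcongr
  have hU : Ioi (0 : ℝ) = ⋃ k : ℕ, Ioo ((k : ℝ) + 2)⁻¹ (k + 2) := by
    ext x
    simp only [mem_Ioi, mem_iUnion, mem_Ioo]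
    constructor
    · intro hx
      obtain ⟨k, hk⟩ := exists_nat_gt (max x x⁻¹)
      have h1 := (le_max_left x x⁻¹).trans_lt hk
      have h2 := (le_max_right x x⁻¹).trans_lt hk
      refine ⟨k, ?_, by linarith⟩
      rw [inv_lt_comm₀ (by positivity) hx]
      linarith
    · rintro ⟨k, hk, -⟩
      exact lt_trans (by positivity) hk
  rw [hU, setLIntegral_iUnion_of_directed _ hmono.directed_le]
  refine iSup_le fun k => ?_
  have hk2 : (0 : ℝ) < (k + 2 : ℝ) := by positivity
  have hlt : ((k : ℝ) + 2)⁻¹ < k + 2 := by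
    have h1 : ((k : ℝ) + 2)⁻¹ < 1 := inv_lt_one_of_one_lt₀ (by linarith [(k.cast_nonneg : (0:ℝ) ≤ k)])
    linarith [(k.cast_nonneg : (0:ℝ) ≤ k)]
  have hpos : 0 < ((k : ℝ) + 2)⁻¹ := by positivity
  refine (h.isContactMajorant.lintegral_detachedSlope_le (K := I) hpos hlt ?_).trans ?_
  · intro x hx y _
    linarith [h.maxProfile_one_le (hpos.trans_le hx.1), maxProfile_nonneg (n := 1) (p := p) y]
  · have e : ∫⁻ x in Ioo ((k : ℝ) + 2)⁻¹ (k + 2), ENNReal.ofReal (w x) ≤ ENNReal.ofReal I := by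
      rw [hI, ofReal_integral_eq_lintegral_ofReal hwi (Eventually.of_forall h.weight_nonneg)]
      exact lintegral_mono_set fun x hx => hpos.trans hx.1
    refine (add_le_add e le_rfl).trans (le_of_eq ?_)
    rw [← ENNReal.ofReal_add hI0 (by positivity)]
    ring_nf

/-- In dimension at least two, decompose the half-line into the scales `(a, 2a)` and integrate the
annular estimates over `da / a`. -/
theorem lintegral_detachedSlope_add_two_le {k : ℕ} {p w : ℝ → ℝ} (h : IsSobolevProfile (k + 2) p w) :
    ∫⁻ ρ in Ioi (0 : ℝ), ENNReal.ofReal (ρ ^ (k + 1)) *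
        ENNReal.ofReal (detachedSlope p (maxProfile (k + 2) p) ρ) ≤
      ENNReal.ofReal (2 ^ (k + 3) * (1 + 4 * oscConst (k + 2)) *
        ∫ u in Ioi (0 : ℝ), u ^ (k + 1) * w u) := by
  set T : ℝ → ℝ≥0∞ := fun ρ => ENNReal.ofReal (detachedSlope p (maxProfile (k + 2) p) ρ) with hT
  have hTm : Measurable T := h.isContactMajorant.measurable_detachedSlope.ennreal_ofReal
  have hwm := h.weight_measurable
  have hC : 0 ≤ oscConst (k + 2) := by rw [oscConst]; positivity
  set C := 1 + 4 * oscConst (k + 2) with hCdef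
  have hC0 : 0 ≤ C := by positivity
  set E : ℝ → ℝ≥0∞ := fun a => ∫⁻ u in Ioi (0 : ℝ),
    ENNReal.ofReal (u ^ (k + 2) * w u / max a u ^ (k + 2)) with hE
  have hEeq : ∀ a, 0 < a → ENNReal.ofReal (annulusEnergy (k + 2) w a) = E a := by
    intro a ha
    rw [annulusEnergy, ofReal_integral_eq_lintegral_ofReal (h.integrableOn_annulusEnergy ha)]
    filter_upwards [ae_restrict_mem measurableSet_Ioi] with u hu
    exact h.annulusEnergy_integrand_nonneg hu
  have hIoo : MeasurableSet {q : ℝ × ℝ | q.2 < q.1 ∧ q.1 < 2 * q.2} :=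
    (measurableSet_lt measurable_snd measurable_fst).inter
      (measurableSet_lt measurable_fst (measurable_snd.const_mul 2))
  have hind : Measurable fun q : ℝ × ℝ => (Ioo q.2 (2 * q.2)).indicator (1 : ℝ → ℝ≥0∞) q.1 :=
    measurable_one.indicator hIoo
  -- the estimate on a single annulus
  have hann : ∀ a, 0 < a → ∫⁻ ρ in Ioi (0 : ℝ), (Ioo a (2 * a)).indicator 1 ρ *
      (ENNReal.ofReal (ρ ^ (k + 1)) * T ρ) ≤
      ENNReal.ofReal (2 ^ (k + 1) * C * a ^ (k + 1)) * E a := by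
    intro a ha
    have hosc := h.isContactMajorant.lintegral_detachedSlope_le
      (K := oscConst (k + 2) * annulusEnergy (k + 2) w a) ha (by linarith : a < 2 * a)
      fun x hx y hy => h.maxProfile_sub_le ha hx hy
    have hw : ∫⁻ x in Ioo a (2 * a), ENNReal.ofReal (w x) ≤ E a := by
      refine le_trans (setLIntegral_mono' measurableSet_Ioo fun x hx => ?_)
        (lintegral_mono_set fun x hx => ha.trans hx.1)
      have hx0 : 0 < x := ha.trans hx.1
      rw [max_eq_right hx.1.le, mul_div_assoc, mul_comm, div_mul_cancel₀ _ (by positivity)]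
    calc ∫⁻ ρ in Ioi (0 : ℝ), (Ioo a (2 * a)).indicator 1 ρ * (ENNReal.ofReal (ρ ^ (k + 1)) * T ρ)
        ≤ ∫⁻ ρ, (Ioo a (2 * a)).indicator
            (fun ρ => ENNReal.ofReal ((2 * a) ^ (k + 1)) * T ρ) ρ := by
          refine (setLIntegral_le_lintegral _ _).trans (lintegral_mono fun ρ => ?_)
          by_cases hρ : ρ ∈ Ioo a (2 * a)
          · rw [indicator_of_mem hρ, indicator_of_mem hρ, Pi.one_apply, one_mul]
            gcongr
            · exact (ha.trans hρ.1).le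
            · exact hρ.2.le
          · simp [hρ]
      _ = ENNReal.ofReal ((2 * a) ^ (k + 1)) * ∫⁻ ρ in Ioo a (2 * a), T ρ := by
          rw [lintegral_indicator measurableSet_Ioo, lintegral_const_mul' _ _ ENNReal.ofReal_ne_top]
      _ ≤ ENNReal.ofReal ((2 * a) ^ (k + 1)) *
            (E a + ENNReal.ofReal (4 * (oscConst (k + 2) * annulusEnergy (k + 2) w a))) := by
          gcongr
          exact hosc.trans (add_le_add hw le_rfl)
      _ = _ := by
          rw [← mul_assoc, ENNReal.ofReal_mul (p := 4 * oscConst (k + 2)) (by positivity), hEeq a ha]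
          have e1 : E a + ENNReal.ofReal (4 * oscConst (k + 2)) * E a = ENNReal.ofReal C * E a := by
            rw [hCdef, ENNReal.ofReal_add zero_le_one (by positivity), ENNReal.ofReal_one, add_mul,
              one_mul]
          rw [e1, ← mul_assoc, ← ENNReal.ofReal_mul (by positivity)]
          congr 2
          ring
  calc ∫⁻ ρ in Ioi (0 : ℝ), ENNReal.ofReal (ρ ^ (k + 1)) * T ρ
      ≤ ∫⁻ ρ in Ioi (0 : ℝ), 2 * ∫⁻ a in Ioi (0 : ℝ), ENNReal.ofReal a⁻¹ *
          ((Ioo a (2 * a)).indicator 1 ρ * (ENNReal.ofReal (ρ ^ (k + 1)) * T ρ)) := by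
        refine setLIntegral_mono' measurableSet_Ioi fun ρ hρ => ?_
        have h1 := one_le_lintegral_scales hρ
        have h2 : ∫⁻ a in Ioi (0 : ℝ), ENNReal.ofReal a⁻¹ *
            ((Ioo a (2 * a)).indicator 1 ρ * (ENNReal.ofReal (ρ ^ (k + 1)) * T ρ)) =
            (∫⁻ a in Ioi (0 : ℝ), ENNReal.ofReal a⁻¹ * (Ioo a (2 * a)).indicator 1 ρ) *
              (ENNReal.ofReal (ρ ^ (k + 1)) * T ρ) := by
          rw [← lintegral_mul_const']
          · simp only [mul_assoc]
          · exact ENNReal.mul_ne_top ENNReal.ofReal_ne_top ENNReal.ofReal_ne_top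
        rw [h2, ← mul_assoc]
        exact le_mul_of_one_le_left zero_le h1
    _ = 2 * ∫⁻ a in Ioi (0 : ℝ), ∫⁻ ρ in Ioi (0 : ℝ), ENNReal.ofReal a⁻¹ *
          ((Ioo a (2 * a)).indicator 1 ρ * (ENNReal.ofReal (ρ ^ (k + 1)) * T ρ)) := by
        rw [lintegral_const_mul' _ _ ENNReal.ofNat_ne_top, lintegral_lintegral_swap]
        refine Measurable.aemeasurable ?_
        exact Measurable.mul (f := fun q : ℝ × ℝ => ENNReal.ofReal q.2⁻¹) (by fun_prop)
          (hind.mul (Measurable.mul (by fun_prop) (hTm.comp measurable_fst)))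
    _ ≤ 2 * ∫⁻ a in Ioi (0 : ℝ), ENNReal.ofReal (2 ^ (k + 1) * C * a ^ k) * E a := by
        gcongr 2 * ?_
        refine setLIntegral_mono' measurableSet_Ioi fun a ha => ?_
        have ha : 0 < a := ha
        rw [lintegral_const_mul' _ _ ENNReal.ofReal_ne_top]
        refine (mul_le_mul_right (hann a ha) _).trans (le_of_eq ?_)
        rw [← mul_assoc, ← ENNReal.ofReal_mul (by positivity)]
        congr 2
        field_simp
        ring
    _ = 2 * ∫⁻ a in Ioi (0 : ℝ), ∫⁻ u in Ioi (0 : ℝ), ENNReal.ofReal (2 ^ (k + 1) * C * a ^ k) *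
          ENNReal.ofReal (u ^ (k + 2) * w u / max a u ^ (k + 2)) := by
        simp only [hE]
        congr 1
        refine lintegral_congr fun a => ?_
        rw [lintegral_const_mul' _ _ ENNReal.ofReal_ne_top]
    _ = 2 * ∫⁻ u in Ioi (0 : ℝ), ∫⁻ a in Ioi (0 : ℝ), ENNReal.ofReal (2 ^ (k + 1) * C * a ^ k) *
          ENNReal.ofReal (u ^ (k + 2) * w u / max a u ^ (k + 2)) := by
        rw [lintegral_lintegral_swap]
        refine Measurable.aemeasurable (Measurable.mul (by fun_prop) (Measurable.ennreal_ofReal ?_))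
        exact ((measurable_snd.pow_const _).mul (hwm.comp measurable_snd)).div
          ((measurable_fst.max measurable_snd).pow_const _)
    _ ≤ 2 * ∫⁻ u in Ioi (0 : ℝ), ENNReal.ofReal (2 ^ (k + 2) * C * (u ^ (k + 1) * w u)) := by
        gcongr 2 * ?_
        refine setLIntegral_mono' measurableSet_Ioi fun u hu => ?_
        have hu : 0 < u := hu
        have hwu := h.weight_nonneg u
        calc ∫⁻ a in Ioi (0 : ℝ), ENNReal.ofReal (2 ^ (k + 1) * C * a ^ k) *
              ENNReal.ofReal (u ^ (k + 2) * w u / max a u ^ (k + 2))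
            = ∫⁻ a in Ioi (0 : ℝ), ENNReal.ofReal (2 ^ (k + 1) * C * w u) *
              ENNReal.ofReal (a ^ k * (u ^ (k + 2) / max a u ^ (k + 2))) := by
              refine setLIntegral_congr_fun measurableSet_Ioi fun a ha => ?_
              have ha : 0 < a := ha
              rw [← ENNReal.ofReal_mul (by positivity), ← ENNReal.ofReal_mul (by positivity)]
              congr 1
              ring
          _ ≤ ENNReal.ofReal (2 ^ (k + 1) * C * w u) * ENNReal.ofReal (2 * u ^ (k + 1)) := by
              rw [lintegral_const_mul' _ _ ENNReal.ofReal_ne_top]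
              gcongr
              exact lintegral_scale_kernel_le k hu
          _ = _ := by
              rw [← ENNReal.ofReal_mul (by positivity)]
              congr 1
              ring
    _ = _ := by
        have hI : IntegrableOn (fun u => 2 ^ (k + 2) * C * (u ^ (k + 1) * w u)) (Ioi 0) :=
          h.weight_integrable.const_mul _
        rw [← ofReal_integral_eq_lintegral_ofReal hI, integral_const_mul, ← ENNReal.ofReal_ofNat,
          ← ENNReal.ofReal_mul (by norm_num)]
        · congr 1
          ring
        · filter_upwards [ae_restrict_mem measurableSet_Ioi] with u hu
          have hu : 0 < u := hu
          have := h.weight_nonneg u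
          positivity

end IsSobolevProfile

namespace IsSobolevProfile

variable {n : ℕ} [NeZero n] {p w : ℝ → ℝ}

/-- The weighted variation of the maximal profile on its detached set is controlled by the weighted
variation of the profile, in every dimension. -/
theorem lintegral_detachedSlope_le (h : IsSobolevProfile n p w) :
    ∫⁻ ρ in Ioi (0 : ℝ), ENNReal.ofReal (ρ ^ (n - 1) * detachedSlope p (maxProfile n p) ρ) ≤
      ENNReal.ofReal (variationConst n * ∫ u in Ioi (0 : ℝ), u ^ (n - 1) * w u) := by
  have hI : 0 ≤ ∫ u in Ioi (0 : ℝ), u ^ (n - 1) * w u :=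
    setIntegral_nonneg measurableSet_Ioi fun u hu =>
      mul_nonneg (pow_nonneg (le_of_lt hu) _) (h.weight_nonneg u)
  have hC : 0 ≤ oscConst n := by rw [oscConst]; positivity
  rcases n with _ | _ | k
  · exact absurd rfl (NeZero.ne 0)
  · simp only [zero_add, tsub_self, pow_zero, one_mul] at hI ⊢
    refine h.lintegral_detachedSlope_one_le.trans (ENNReal.ofReal_le_ofReal ?_)
    gcongr
    rw [variationConst]
    have : 0 ≤ 2 ^ (1 + 1) * (1 + 4 * oscConst 1) := by
      simp only [zero_add] at hC
      positivity
    linarith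
  · have e : ∀ ρ ∈ Ioi (0 : ℝ), ENNReal.ofReal (ρ ^ (k + 1) *
        detachedSlope p (maxProfile (k + 2) p) ρ) = ENNReal.ofReal (ρ ^ (k + 1)) *
        ENNReal.ofReal (detachedSlope p (maxProfile (k + 2) p) ρ) := fun ρ hρ =>
      ENNReal.ofReal_mul (pow_nonneg (le_of_lt hρ) _)
    change ∫⁻ ρ in Ioi (0 : ℝ), ENNReal.ofReal (ρ ^ (k + 1) *
        detachedSlope p (maxProfile (k + 2) p) ρ) ≤ ENNReal.ofReal (variationConst (k + 2) *
        ∫ u in Ioi (0 : ℝ), u ^ (k + 1) * w u)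
    rw [setLIntegral_congr_fun measurableSet_Ioi e]
    refine h.lintegral_detachedSlope_add_two_le.trans (ENNReal.ofReal_le_ofReal ?_)
    refine mul_le_mul_of_nonneg_right ?_ hI
    rw [variationConst]
    linarith

theorem integrable_detachedSlope (h : IsSobolevProfile n p w) :
    IntegrableOn (fun ρ => ρ ^ (n - 1) * detachedSlope p (maxProfile n p) ρ) (Ioi 0) := by
  refine ⟨((measurable_id.pow_const _).mul
    h.isContactMajorant.measurable_detachedSlope).aestronglyMeasurable, ?_⟩
  rw [hasFiniteIntegral_iff_ofReal]
  · exact h.lintegral_detachedSlope_le.trans_lt ENNReal.ofReal_lt_top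
  · filter_upwards [ae_restrict_mem measurableSet_Ioi] with ρ hρ
    exact mul_nonneg (pow_nonneg (le_of_lt hρ) _) (detachedSlope_nonneg _ _ _)

theorem integral_detachedSlope_le (h : IsSobolevProfile n p w) :
    ∫ ρ in Ioi (0 : ℝ), ρ ^ (n - 1) * detachedSlope p (maxProfile n p) ρ ≤
      variationConst n * ∫ u in Ioi (0 : ℝ), u ^ (n - 1) * w u := by
  have hI : 0 ≤ ∫ u in Ioi (0 : ℝ), u ^ (n - 1) * w u :=
    setIntegral_nonneg measurableSet_Ioi fun u hu =>
      mul_nonneg (pow_nonneg (le_of_lt hu) _) (h.weight_nonneg u)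
  have hC : 0 ≤ variationConst n := by rw [variationConst, oscConst]; positivity
  rw [← ENNReal.ofReal_le_ofReal_iff (by positivity),
    ofReal_integral_eq_lintegral_ofReal h.integrable_detachedSlope]
  · exact h.lintegral_detachedSlope_le
  · filter_upwards [ae_restrict_mem measurableSet_Ioi] with ρ hρ
    exact mul_nonneg (pow_nonneg (le_of_lt hρ) _) (detachedSlope_nonneg _ _ _)

/-- The increments of the maximal profile, with the detached part now known to be integrable. -/
theorem abs_maxProfile_sub_le (h : IsSobolevProfile n p w) {s t : ℝ} (hs : 0 < s) (hst : s ≤ t) :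
    |maxProfile n p t - maxProfile n p s| ≤
      ∫ u in s..t, (w u + detachedSlope p (maxProfile n p) u) := by
  have hint := (intervalIntegrable_of_weight h.weight_integrable hs (hs.trans_le hst)).add
    (intervalIntegrable_of_weight h.integrable_detachedSlope hs (hs.trans_le hst))
  have hnn : ∀ u, 0 ≤ w u + detachedSlope p (maxProfile n p) u := fun u =>
    add_nonneg (h.weight_nonneg u) (detachedSlope_nonneg _ _ u)
  rw [← ENNReal.ofReal_le_ofReal_iff (intervalIntegral.integral_nonneg hst fun u _ => hnn u)]
  refine (h.isContactMajorant.ofReal_abs_sub_le hs hst).trans (le_of_eq ?_)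
  rw [intervalIntegral.integral_of_le hst, integral_Ioc_eq_integral_Ioo,
    ofReal_integral_eq_lintegral_ofReal]
  · refine lintegral_congr fun u => ?_
    rw [ENNReal.ofReal_add (h.weight_nonneg u) (detachedSlope_nonneg _ _ u), detachedSlope]
    by_cases hu : u ∈ detachedSet p (maxProfile n p) <;> simp [hu]
  · exact ((intervalIntegrable_iff_integrableOn_Ioc_of_le hst).1 hint).mono_set Ioo_subset_Ioc_self
  · exact Eventually.of_forall hnn

theorem maxProfile_sub_eq_integral_deriv (h : IsSobolevProfile n p w) {s t : ℝ} (hs : 0 < s)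
    (hst : s ≤ t) : maxProfile n p t - maxProfile n p s = ∫ u in s..t, deriv (maxProfile n p) u := by
  have hint := (intervalIntegrable_of_weight h.weight_integrable hs (hs.trans_le hst)).add
    (intervalIntegrable_of_weight h.integrable_detachedSlope hs (hs.trans_le hst))
  exact ((absolutelyContinuousOnInterval_of_abs_sub_le hst hint fun x y hx hxy _ =>
    h.abs_maxProfile_sub_le (hs.trans_le hx) hxy).integral_deriv_eq_sub).symm

theorem ae_abs_deriv_maxProfile_le (h : IsSobolevProfile n p w) :
    ∀ᵐ x : ℝ, 0 < x → |deriv (maxProfile n p) x| ≤ w x + detachedSlope p (maxProfile n p) x := by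
  -- exhaust `(0, ∞)` by countably many compactly contained intervals
  have key : ∀ k : ℕ, ∀ᵐ x : ℝ, x ∈ Ioo ((k : ℝ) + 1)⁻¹ (k + 1) →
      |deriv (maxProfile n p) x| ≤ w x + detachedSlope p (maxProfile n p) x := by
    intro k
    have h0 : (0 : ℝ) < ((k : ℝ) + 1)⁻¹ := by positivity
    have h1 : ((k : ℝ) + 1)⁻¹ ≤ k + 1 := by
      have hk : (0 : ℝ) ≤ k := k.cast_nonneg
      exact (inv_le_one_of_one_le₀ (by linarith)).trans (by linarith)
    exact ae_abs_deriv_le_of_abs_sub_le h1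
      ((intervalIntegrable_of_weight h.weight_integrable h0 (h0.trans_le h1)).add
        (intervalIntegrable_of_weight h.integrable_detachedSlope h0 (h0.trans_le h1)))
      (fun u => add_nonneg (h.weight_nonneg u) (detachedSlope_nonneg _ _ u))
      fun s t hs hst _ => h.abs_maxProfile_sub_le (h0.trans_le hs) hst
  filter_upwards [ae_all_iff.2 key] with x hx hx0
  obtain ⟨k, hk⟩ := exists_nat_gt (max x x⁻¹)
  have h1 := (le_max_left x x⁻¹).trans_lt hk
  have h2 := (le_max_right x x⁻¹).trans_lt hk
  refine hx k ⟨?_, by linarith⟩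
  rw [inv_lt_comm₀ (by positivity) hx0]
  linarith

theorem ae_norm_weight_mul_deriv_le (h : IsSobolevProfile n p w) :
    ∀ᵐ ρ ∂volume.restrict (Ioi (0 : ℝ)), ‖ρ ^ (n - 1) * deriv (maxProfile n p) ρ‖ ≤
      ρ ^ (n - 1) * w ρ + ρ ^ (n - 1) * detachedSlope p (maxProfile n p) ρ := by
  filter_upwards [ae_restrict_mem measurableSet_Ioi,
    ae_restrict_of_ae h.ae_abs_deriv_maxProfile_le] with ρ hρ hle
  have hρ : 0 < ρ := hρ
  rw [norm_mul, Real.norm_eq_abs, Real.norm_eq_abs, abs_of_pos (pow_pos hρ _), ← mul_add]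
  exact mul_le_mul_of_nonneg_left (hle hρ) (by positivity)

theorem integrable_deriv_maxProfile (h : IsSobolevProfile n p w) :
    IntegrableOn (fun ρ => ρ ^ (n - 1) * deriv (maxProfile n p) ρ) (Ioi 0) :=
  (h.weight_integrable.add h.integrable_detachedSlope).mono'
    ((measurable_id.pow_const _).mul (measurable_deriv _)).aestronglyMeasurable
    h.ae_norm_weight_mul_deriv_le

theorem integral_abs_deriv_maxProfile_le (h : IsSobolevProfile n p w) :
    ∫ ρ in Ioi (0 : ℝ), ρ ^ (n - 1) * |deriv (maxProfile n p) ρ| ≤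
      (variationConst n + 1) * ∫ u in Ioi (0 : ℝ), u ^ (n - 1) * w u := by
  have e : ∀ ρ ∈ Ioi (0 : ℝ), ρ ^ (n - 1) * |deriv (maxProfile n p) ρ| =
      ‖ρ ^ (n - 1) * deriv (maxProfile n p) ρ‖ := fun ρ hρ => by
    rw [norm_mul, Real.norm_of_nonneg (pow_nonneg (le_of_lt hρ) _), Real.norm_eq_abs]
  rw [setIntegral_congr_fun measurableSet_Ioi e]
  refine (integral_mono_ae h.integrable_deriv_maxProfile.norm
    (h.weight_integrable.add h.integrable_detachedSlope) h.ae_norm_weight_mul_deriv_le).trans ?_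
  rw [integral_add' h.weight_integrable h.integrable_detachedSlope]
  linarith [h.integral_detachedSlope_le]

end IsSobolevProfile

/-! ### Weak gradients of radial maximal functions -/

theorem maximalFunction_congr_ae {n : ℕ} {f g : EuclideanSpace ℝ (Fin n) → ℝ}
    (h : ∀ᵐ x, ‖f x‖ₑ = ‖g x‖ₑ) (x : EuclideanSpace ℝ (Fin n)) :
    maximalFunction f x = maximalFunction g x := by
  simp only [maximalFunction]
  refine iSup_congr fun z => iSup_congr fun r => iSup_congr fun _ => ?_
  exact laverage_congr (ae_restrict_of_ae h)

/-- Weak gradients are unique up to null sets. -/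
theorem HasWeakGradient.ae_eq {n : ℕ} {f : EuclideanSpace ℝ (Fin n) → ℝ}
    {F₁ F₂ : EuclideanSpace ℝ (Fin n) → EuclideanSpace ℝ (Fin n)} (h₁ : HasWeakGradient f F₁)
    (h₂ : HasWeakGradient f F₂) : F₁ =ᵐ[volume] F₂ := by
  have hloc : ∀ {F : EuclideanSpace ℝ (Fin n) → EuclideanSpace ℝ (Fin n)},
      LocallyIntegrable F → ∀ i, LocallyIntegrable fun x => F x i := by
    intro F hF i x
    obtain ⟨U, hU, hi⟩ := hF x
    exact ⟨U, hU, (EuclideanSpace.proj (𝕜 := ℝ) i).integrable_comp hi⟩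
  have key : ∀ i, (fun x => F₁ x i) =ᵐ[volume] fun x => F₂ x i := by
    intro i
    refine ae_eq_of_integral_contDiff_smul_eq (hloc h₁.locallyIntegrable_gradient i)
      (hloc h₂.locallyIntegrable_gradient i) fun φ hφ hc => ?_
    have e := (h₁.integral_eq φ hφ hc i).symm.trans (h₂.integral_eq φ hφ hc i)
    simpa only [smul_eq_mul, mul_comm] using neg_injective e
  filter_upwards [ae_all_iff.2 key] with x hx
  ext i
  exact hx i

theorem theorem3 (n : ℕ) (hn : 1 ≤ n) :
    ∃ C : ℝ, ∀ f : EuclideanSpace ℝ (Fin n) → ℝ, MemW11 f → IsRadial f →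
      (∀ᵐ x ∂(volume : Measure (EuclideanSpace ℝ (Fin n))), maximalFunction f x < ⊤) ∧
      ∃ G : EuclideanSpace ℝ (Fin n) → EuclideanSpace ℝ (Fin n),
        HasWeakGradient (fun x => (maximalFunction f x).toReal) G ∧
        Integrable G volume ∧
        ∀ F : EuclideanSpace ℝ (Fin n) → EuclideanSpace ℝ (Fin n),
          HasWeakGradient f F → ∫ x, ‖G x‖ ≤ C * ∫ x, ‖F x‖ := by
  have : NeZero n := ⟨by omega⟩
  have hC : 0 ≤ variationConst n + 1 := by rw [variationConst, oscConst]; positivity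
  refine ⟨variationConst n + 1, fun f hf hrad => ?_⟩
  obtain ⟨hfi, F₀, hF₀, hF₀i⟩ := hf
  obtain ⟨g, w, hfg, hwm, hw0, hwi, hg, hle⟩ := exists_profile hfi hrad hF₀ hF₀i
  set p : ℝ → ℝ := fun t => |g t| with hp
  have hP : IsSobolevProfile n p w :=
    { nonneg := fun t => abs_nonneg _
      integrable := (integrable_norm_iff p).1 ((hfi.congr hfg).abs)
      weight_measurable := hwm
      weight_nonneg := hw0
      weight_integrable := hwi
      abs_sub_le := fun s t hs hst => (abs_abs_sub_abs_le_abs_sub _ _).trans (hg s t hs hst) }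
  have hMeq : ∀ x, maximalFunction f x =
      maximalFunction (fun y : EuclideanSpace ℝ (Fin n) => p ‖y‖) x := by
    refine maximalFunction_congr_ae ?_
    filter_upwards [hfg] with x hx
    rw [hx, ← enorm_norm (g ‖x‖), Real.norm_eq_abs]
  have hM : (fun x => (maximalFunction f x).toReal) = fun x => maxProfile n p ‖x‖ := by
    funext x
    rw [hMeq, IsSobolevProfile.toReal_maximalFunction]
  obtain ⟨hGi, hG⟩ := hasWeakGradient_radial (measurable_deriv (maxProfile n p))
    hP.integrable_deriv_maxProfile fun s t hs hst => hP.maxProfile_sub_eq_integral_deriv hs hst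
  have hne : ∀ᵐ x ∂(volume : Measure (EuclideanSpace ℝ (Fin n))), x ≠ 0 := by
    simp [ae_iff]
  refine ⟨?_, _, hM ▸ hG, hGi, fun F hF => ?_⟩
  · filter_upwards [hne] with x hx
    rw [hMeq]
    exact hP.maximalFunction_lt_top hx
  · have hFF : ∫ x, ‖F x‖ = ∫ x, ‖F₀ x‖ :=
      integral_congr_ae ((hF.ae_eq hF₀).mono fun x hx => congrArg norm hx)
    have hGn : (fun x : EuclideanSpace ℝ (Fin n) =>
        ‖(deriv (maxProfile n p) ‖x‖ / ‖x‖) • x‖) =ᵐ[volume]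
        fun x => |deriv (maxProfile n p) ‖x‖| := by
      filter_upwards [hne] with x hx
      rw [norm_smul, norm_div, norm_norm, div_mul_cancel₀ _ (norm_ne_zero_iff.2 hx),
        Real.norm_eq_abs]
    rw [hFF, integral_congr_ae hGn, integral_norm_eq fun ρ => |deriv (maxProfile n p) ρ|]
    calc sphereArea n * ∫ ρ in Ioi (0 : ℝ), ρ ^ (n - 1) * |deriv (maxProfile n p) ρ|
        ≤ sphereArea n * ((variationConst n + 1) * ∫ u in Ioi (0 : ℝ), u ^ (n - 1) * w u) :=
          mul_le_mul_of_nonneg_left hP.integral_abs_deriv_maxProfile_le sphereArea_pos.le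
      _ = (variationConst n + 1) * (sphereArea n * ∫ u in Ioi (0 : ℝ), u ^ (n - 1) * w u) := by
          ring
      _ ≤ (variationConst n + 1) * ∫ x, ‖F₀ x‖ := mul_le_mul_of_nonneg_left hle hC
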